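/- Let $n\ge 2$ and let $\theta=(\theta_{jk})$ be a real antisymmetric $n\times n$ matrix with columns $\theta_1,\dots,\theta_n$. On $L^2(\mathbb T^n)$, $\mathbb T^n=\mathbb R^n/2\pi\mathbb Z^n$ with normalised Haar measure, let $(U_jf)(x)=e^{ix_j}f(x+\pi\theta_j)$, and put $U^k=U_1^{k_1}\cdots U_n^{k_n}$ for $k\in\mathbb Z^n$. Let $A_\theta$ be the $C^*$-algebra generated by $U_1,\dots,U_n$, let $\tau(T)=\langle T1|1\rangle$, let $\alpha_s$ $(s\in\mathbb R^n)$ be the action of $\mathbb R^n$ induced by translations, so that $\alpha_s(U^k)=e^{is\cdot k}U^k$, and let $\mathcal A_\theta=\{u\in A_\theta: s\mapsto\alpha_s(u)\text{ is } C^\infty\}$ be the smooth noncommutative torus, with the derivations $\delta_j(u)=\frac1i\partial_{s_j}\alpha_s(u)|_{s=0}$ and the Fréchet topology defined by the semi-norms $u\mapsto\|\delta^\beta(u)\|$, $\beta\in\mathbb N_0^n$. Each $U_j$ also acts on $\mathcal A_\theta$ by left multiplication. For $q\in\mathbb C$, let $S^q(\mathbb R^n;\mathcal A_\theta)$ be the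 space of classical symbols of order $q$: maps $\rho\in C^\infty(\mathbb R^n;\mathcal A_\theta)$ for which there are $\rho_{q-j}\in C^\infty(\mathbb R^n\setminus 0;\mathcal A_\theta)$, $j\ge0$, homogeneous of degree $q-j$, such that for all $N\ge 0$ and all multi-orders $\alpha,\beta$ there is a constant $C$ with $$\Big\|\delta^\alpha\partial_\xi^\beta\Big(\rho-\sum_{j<N}\rho_{q-j}\Big)(\xi)\Big\|\le C|\xi|^{\Re q-N-|\beta|}\qquad (|\xi|\ge 1).$$ Let $\Psi^q(\mathbb T^n_\theta)$ be the set of the operators $P_\rho:\mathcal A_\theta\to\mathcal A_\theta$, $P_\rho\big(\sum_k u_kU^k\big)=\sum_k u_k\rho(k)U^k$, with $\rho\in S^q(\mathbb R^n;\mathcal A_\theta)$. The homogeneous symbols $\rho_{q-j}$ are determined by $P=P_\rho$; for $q\in\mathbb Z$ the noncommutative residue of $P$ is $$\operatorname{Res}(P)=\int_{\mathbb S^{n-1}}\tau[\rho_{-n}(\xi)]\,d^{n-1}\xi,$$ where $\rho_{-n}$ is the symbol of degree $-n$ of $P$ ($\rho_{-n}=0$ if $q<-n$). Let $\Psi^{-\infty}(\mathbb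 T^n_\theta)$ be the space of smoothing operators, i.e. of linear maps $R:\mathcal A_\theta\to\mathcal A_\theta$ that extend to a continuous linear map $\mathcal A_\theta'\to\mathcal A_\theta$, where $\mathcal A_\theta'$ is the topological dual with its strong topology and $\mathcal A_\theta$ is embedded in $\mathcal A_\theta'$ by $u\mapsto\tau(u\,\cdot)$. **Proposition.** Let $P\in\Psi^q(\mathbb T^n_\theta)$, $q\in\mathbb C$. Assume that either $q\notin\mathbb Z$, or $q\in\mathbb Z$ and $\operatorname{Res}(P)=0$. Then there are operators $P_1,\dots,P_n\in\Psi^{q+1}(\mathbb T^n_\theta)$ and $Q_1,\dots,Q_n\in\Psi^q(\mathbb T^n_\theta)$ such that $$P=[P_1,U_1]+\cdots+[P_n,U_n]+[\delta_1,Q_1]+\cdots+[\delta_n,Q_n]\quad\bmod\ \Psi^{-\infty}(\mathbb T^n_\theta).$$ -/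

import Mathlib

open MeasureTheory Filter Topology
open scoped ContDiff

noncomputable section

namespace NCTorus

/-! ### The Hilbert space `L²(𝕋ⁿ)`, translations and multiplication by characters

The torus `ℝⁿ / 2πℤⁿ` with its normalised Haar measure is realised as `(ℝ / ℤ)ⁿ` through the
rescaling `x ↦ x / 2π` of each coordinate. -/

/-- The normalised Haar measure of the torus. -/
abbrev torusMeasure (n : ℕ) : Measure (UnitAddTorus (Fin n)) :=
  Measure.pi fun _ => AddCircle.haarAddCircle

/-- The Hilbert space `L²(𝕋ⁿ)`. -/
abbrev L2 (n : ℕ) : Type := Lp ℂ 2 (torusMeasure n)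

/-- `ℝⁿ` with its Euclidean norm. -/
abbrev RR (n : ℕ) : Type := EuclideanSpace ℝ (Fin n)

/-- The class in `(ℝ / ℤ)ⁿ` of a point of `ℝⁿ`. -/
def toTorus {n : ℕ} (x : Fin n → ℝ) : UnitAddTorus (Fin n) := fun l => ((x l : ℝ) : UnitAddCircle)

lemma measurePreserving_translate {n : ℕ} (a : UnitAddTorus (Fin n)) :
    MeasurePreserving (fun x => x + a) (torusMeasure n) (torusMeasure n) :=
  measurePreserving_add_right (torusMeasure n) a

lemma compMeasurePreserving_translate {n : ℕ} (a b : UnitAddTorus (Fin n)) (f : L2 n) :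
    Lp.compMeasurePreserving _ (measurePreserving_translate a)
      (Lp.compMeasurePreserving _ (measurePreserving_translate b) f) =
    Lp.compMeasurePreserving _ (measurePreserving_translate (a + b)) f := by
  refine Lp.ext ?_
  have h1 := Lp.coeFn_compMeasurePreserving
    (Lp.compMeasurePreserving _ (measurePreserving_translate b) f) (measurePreserving_translate a)
  have h2 := (measurePreserving_translate a).quasiMeasurePreserving.ae_eq_comp
    (Lp.coeFn_compMeasurePreserving f (measurePreserving_translate b))
  have h3 := Lp.coeFn_compMeasurePreserving f (measurePreserving_translate (a + b))
  filter_upwards [h1, h2, h3] with x e1 e2 e3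
  rw [e1, e3, e2]
  simp [Function.comp, add_assoc]

lemma compMeasurePreserving_translate_zero {n : ℕ} (f : L2 n) :
    Lp.compMeasurePreserving _ (measurePreserving_translate (0 : UnitAddTorus (Fin n))) f = f := by
  refine Lp.ext ?_
  filter_upwards [Lp.coeFn_compMeasurePreserving f
    (measurePreserving_translate (0 : UnitAddTorus (Fin n)))] with x e
  rw [e]
  simp

/-- The translation `(V_a f)(x) = f(x + a)` on `L²(𝕋ⁿ)`. -/
def translate {n : ℕ} (a : UnitAddTorus (Fin n)) : L2 n ≃ₗᵢ[ℂ] L2 n where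
  toLinearEquiv := LinearEquiv.ofLinearMap
    (Lp.compMeasurePreservingₗᵢ ℂ _ (measurePreserving_translate a)).toLinearMap
    (Lp.compMeasurePreservingₗᵢ ℂ _ (measurePreserving_translate (-a))).toLinearMap
    (LinearMap.ext fun f => by
      refine (compMeasurePreserving_translate a (-a) f).trans ?_
      simp only [add_neg_cancel]
      exact compMeasurePreserving_translate_zero f)
    (LinearMap.ext fun f => by
      refine (compMeasurePreserving_translate (-a) a f).trans ?_
      simp only [neg_add_cancel]
      exact compMeasurePreserving_translate_zero f)
  norm_map' f := (Lp.compMeasurePreservingₗᵢ ℂ _ (measurePreserving_translate a)).norm_map f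

lemma coeFn_translate {n : ℕ} (a : UnitAddTorus (Fin n)) (f : L2 n) :
    translate a f =ᵐ[torusMeasure n] fun x => f (x + a) :=
  Lp.coeFn_compMeasurePreserving f (measurePreserving_translate a)

lemma translate_translate {n : ℕ} (a b : UnitAddTorus (Fin n)) (f : L2 n) :
    translate a (translate b f) = translate (a + b) f :=
  compMeasurePreserving_translate a b f

lemma norm_mFourier_apply {n : ℕ} (m : Fin n → ℤ) (x : UnitAddTorus (Fin n)) :
    ‖UnitAddTorus.mFourier m x‖ = 1 := by
  simp only [UnitAddTorus.mFourier, ContinuousMap.coe_mk, norm_prod, fourier_apply,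
    Circle.norm_coe, Finset.prod_const_one]

lemma memLp_character_mul {n : ℕ} (m : Fin n → ℤ) (f : L2 n) :
    MemLp (fun x => UnitAddTorus.mFourier m x * f x) 2 (torusMeasure n) :=
  (Lp.memLp f).of_le
    (((UnitAddTorus.mFourier m).continuous.aestronglyMeasurable).mul (Lp.aestronglyMeasurable f))
    (Eventually.of_forall fun x => by rw [norm_mul, norm_mFourier_apply, one_mul])

/-- Multiplication by the character `x ↦ exp(2πi m·x)` of `(ℝ / ℤ)ⁿ`, as a linear map. -/
def characterMulₗ {n : ℕ} (m : Fin n → ℤ) : L2 n →ₗ[ℂ] L2 n where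
  toFun f := (memLp_character_mul m f).toLp _
  map_add' f g := by
    refine Lp.ext ?_
    filter_upwards [(memLp_character_mul m (f + g)).coeFn_toLp, (memLp_character_mul m f).coeFn_toLp,
      (memLp_character_mul m g).coeFn_toLp, Lp.coeFn_add f g,
      Lp.coeFn_add ((memLp_character_mul m f).toLp _) ((memLp_character_mul m g).toLp _)]
      with x e1 e2 e3 e4 e5
    rw [e1, e5, Pi.add_apply, e2, e3, e4, Pi.add_apply, mul_add]
  map_smul' c f := by
    refine Lp.ext ?_
    filter_upwards [(memLp_character_mul m (c • f)).coeFn_toLp,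
      (memLp_character_mul m f).coeFn_toLp, Lp.coeFn_smul c f,
      Lp.coeFn_smul c ((memLp_character_mul m f).toLp _)] with x e1 e2 e3 e4
    rw [e1, RingHom.id_apply, e4, Pi.smul_apply, e2, e3, Pi.smul_apply]
    simp only [smul_eq_mul]
    ring

lemma coeFn_characterMulₗ {n : ℕ} (m : Fin n → ℤ) (f : L2 n) :
    characterMulₗ m f =ᵐ[torusMeasure n] fun x => UnitAddTorus.mFourier m x * f x :=
  (memLp_character_mul m f).coeFn_toLp

lemma characterMulₗ_neg {n : ℕ} (m m' : Fin n → ℤ) (h : m + m' = 0) (f : L2 n) :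
    characterMulₗ m (characterMulₗ m' f) = f := by
  refine Lp.ext ?_
  filter_upwards [coeFn_characterMulₗ m (characterMulₗ m' f), coeFn_characterMulₗ m' f]
    with x e1 e2
  rw [e1, e2, ← mul_assoc, ← UnitAddTorus.mFourier_add, h, UnitAddTorus.mFourier_zero]
  simp

/-- Multiplication by the character `x ↦ exp(2πi m·x)` of `(ℝ / ℤ)ⁿ`, as a unitary operator. -/
def characterMul {n : ℕ} (m : Fin n → ℤ) : L2 n ≃ₗᵢ[ℂ] L2 n where
  toLinearEquiv := LinearEquiv.ofLinearMap (characterMulₗ m) (characterMulₗ (-m))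
    (LinearMap.ext fun f => characterMulₗ_neg m (-m) (by simp) f)
    (LinearMap.ext fun f => characterMulₗ_neg (-m) m (by simp) f)
  norm_map' f := by
    change ‖characterMulₗ m f‖ = ‖f‖
    rw [Lp.norm_def, Lp.norm_def]
    congr 1
    refine eLpNorm_congr_norm_ae ?_
    filter_upwards [coeFn_characterMulₗ m f] with x e
    rw [e, norm_mul, norm_mFourier_apply, one_mul]

/-! ### The C*-algebra `A_θ` -/

/-- Bounded operators on `L²(𝕋ⁿ)`. -/
abbrev Op (n : ℕ) : Type := L2 n →L[ℂ] L2 n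

/-- The unitary operator `(U_j f)(x) = exp(i x_j) f(x + π θ_j)`, where `θ_j` is the `j`-th column
of `θ`.  In the rescaled coordinates the shift `π θ_j` becomes `θ_j / 2`. -/
def Ugen {n : ℕ} (θ : Matrix (Fin n) (Fin n) ℝ) (j : Fin n) : L2 n ≃ₗᵢ[ℂ] L2 n :=
  (translate (toTorus fun l => θ l j / 2)).trans (characterMul (Pi.single j 1))

/-- The operator `U_j` as an element of the C*-algebra of bounded operators. -/
def Uop {n : ℕ} (θ : Matrix (Fin n) (Fin n) ℝ) (j : Fin n) : Op n :=
  (Ugen θ j : L2 n →L[ℂ] L2 n)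

/-- The noncommutative torus `A_θ`: the C*-algebra generated by `U_1, …, U_n`. -/
def cstarTorus {n : ℕ} (θ : Matrix (Fin n) (Fin n) ℝ) : StarSubalgebra ℂ (Op n) :=
  (StarAlgebra.adjoin ℂ (Set.range (Uop θ))).topologicalClosure

/-- The action `α_s(T) = V_s T V_s⁻¹` of `s ∈ ℝⁿ` on bounded operators, `V_s` being the translation
by `s` (by `s / 2π` in the rescaled coordinates). -/
def act {n : ℕ} (s : RR n) : Op n ≃⋆ₐ[ℂ] Op n :=
  (translate (toTorus fun l => s l / (2 * Real.pi))).conjStarAlgEquiv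

/-- The action `α_s` as a continuous linear map. -/
def actL {n : ℕ} (s : RR n) : Op n →L[ℂ] Op n :=
  LinearMap.mkContinuous (act s).toAlgEquiv.toLinearMap 1 fun T => by
    rw [one_mul]
    exact NonUnitalStarAlgHom.norm_apply_le (act s : Op n →⋆ₙₐ[ℂ] Op n) T

lemma actL_apply {n : ℕ} (s : RR n) (T : Op n) : actL s T = act s T := rfl

lemma toTorus_add {n : ℕ} (x y : Fin n → ℝ) : toTorus (x + y) = toTorus x + toTorus y := by
  funext l
  simp [toTorus]

lemma act_act {n : ℕ} (s t : RR n) (T : Op n) : act s (act t T) = act (s + t) T := by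
  have key : ∀ g : L2 n, translate (toTorus fun l => s l / (2 * Real.pi))
      (translate (toTorus fun l => t l / (2 * Real.pi)) g) =
      translate (toTorus fun l => (s + t) l / (2 * Real.pi)) g := fun g => by
    rw [translate_translate, ← toTorus_add]
    have h : (fun l => s l / (2 * Real.pi)) + (fun l => t l / (2 * Real.pi)) =
        fun l => (s + t) l / (2 * Real.pi) := by
      funext l
      simp [add_div]
    rw [h]
  refine ContinuousLinearMap.ext fun f => ?_
  simp only [act, LinearIsometryEquiv.conjStarAlgEquiv_apply_apply]
  rw [key]
  congr 2
  rw [LinearIsometryEquiv.eq_symm_apply, ← key]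
  simp

lemma translate_characterMul {n : ℕ} (a : UnitAddTorus (Fin n)) (m : Fin n → ℤ) (f : L2 n) :
    translate a (characterMul m f) =
      UnitAddTorus.mFourier m a • characterMul m (translate a f) := by
  refine Lp.ext ?_
  have h1 := coeFn_translate a (characterMul m f)
  have h2 := (measurePreserving_translate a).quasiMeasurePreserving.ae_eq_comp
    (coeFn_characterMulₗ m f)
  have h3 := Lp.coeFn_smul (UnitAddTorus.mFourier m a) (characterMul m (translate a f))
  have h4 := coeFn_characterMulₗ m (translate a f)
  have h5 := coeFn_translate a f
  filter_upwards [h1, h2, h3, h4, h5] with x e1 e2 e3 e4 e5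
  have e2' : (characterMul m f) (x + a) = UnitAddTorus.mFourier m (x + a) * f (x + a) := e2
  have e4' : (characterMul m (translate a f)) x = UnitAddTorus.mFourier m x * translate a f x := e4
  have hm : UnitAddTorus.mFourier m (x + a) =
      UnitAddTorus.mFourier m x * UnitAddTorus.mFourier m a := by
    simp [UnitAddTorus.mFourier, ← Finset.prod_mul_distrib, fourier_apply, smul_add,
      AddCircle.toCircle_add]
  rw [e1, e3, Pi.smul_apply, e2', e4', e5, hm, smul_eq_mul]
  ring

/-- `α_s(U_j) = exp(i s_j) U_j`. -/
lemma act_Uop {n : ℕ} (θ : Matrix (Fin n) (Fin n) ℝ) (s : RR n) (j : Fin n) :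
    act s (Uop θ j) = Complex.exp (s j * Complex.I) • Uop θ j := by
  have hph : UnitAddTorus.mFourier (Pi.single j 1) (toTorus fun l => s l / (2 * Real.pi)) =
      Complex.exp (s j * Complex.I) := by
    rw [UnitAddTorus.mFourier_single, toTorus, fourier_coe_apply]
    congr 1
    push_cast
    have : (Real.pi : ℂ) ≠ 0 := by exact_mod_cast Real.pi_ne_zero
    field_simp
  refine ContinuousLinearMap.ext fun f => ?_
  rw [← hph]
  set a := toTorus fun l => s l / (2 * Real.pi) with ha
  change translate a (characterMul _ (translate _ ((translate a).symm f))) =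
    UnitAddTorus.mFourier (Pi.single j 1) a • characterMul _ (translate _ f)
  rw [translate_characterMul, translate_translate, add_comm, ← translate_translate,
    LinearIsometryEquiv.apply_symm_apply]

/-- Each `α_s` preserves `A_θ`. -/
lemma act_mem {n : ℕ} (θ : Matrix (Fin n) (Fin n) ℝ) (s : RR n) {T : Op n}
    (hT : T ∈ cstarTorus θ) : act s T ∈ cstarTorus θ := by
  have hle : cstarTorus θ ≤ (cstarTorus θ).comap (act s : Op n →⋆ₐ[ℂ] Op n) := by
    refine StarSubalgebra.topologicalClosure_minimal ?_ ?_
    · refine StarAlgebra.adjoin_le ?_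
      rintro _ ⟨j, rfl⟩
      change act s (Uop θ j) ∈ cstarTorus θ
      rw [act_Uop]
      exact (cstarTorus θ).smul_mem (StarSubalgebra.le_topologicalClosure _
        (StarAlgebra.subset_adjoin ℂ _ ⟨j, rfl⟩)) _
    · exact (StarSubalgebra.isClosed_topologicalClosure _).preimage (actL s).continuous
  exact hle hT

lemma Uop_mem {n : ℕ} (θ : Matrix (Fin n) (Fin n) ℝ) (j : Fin n) : Uop θ j ∈ cstarTorus θ :=
  StarSubalgebra.le_topologicalClosure _ (StarAlgebra.subset_adjoin ℂ _ ⟨j, rfl⟩)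

/-! ### The smooth noncommutative torus -/

/-- The smooth noncommutative torus, as a `*`-subalgebra of the bounded operators: the elements
`u` of `A_θ` for which `s ↦ α_s(u)` is of class `C^∞` in norm. -/
def smoothSubalgebra {n : ℕ} (θ : Matrix (Fin n) (Fin n) ℝ) : StarSubalgebra ℂ (Op n) where
  carrier := {u | u ∈ cstarTorus θ ∧ ContDiff ℝ ∞ fun s : RR n => act s u}
  mul_mem' {u v} hu hv := ⟨mul_mem hu.1 hv.1, by
    simp only [map_mul]
    exact hu.2.mul hv.2⟩
  add_mem' {u v} hu hv := ⟨add_mem hu.1 hv.1, by simpa only [map_add] using hu.2.add hv.2⟩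
  algebraMap_mem' c := ⟨(cstarTorus θ).algebraMap_mem c, by
    have : ∀ s : RR n, act s (algebraMap ℂ (Op n) c) = algebraMap ℂ (Op n) c := fun s =>
      (act s).toAlgEquiv.commutes c
    simpa only [this] using contDiff_const⟩
  star_mem' {u} hu := ⟨star_mem hu.1, by
    simp only [map_star]
    exact ((starAddEquiv : Op n ≃+ Op n).toAddMonoidHom.toRealLinearMap
      continuous_star).contDiff.comp hu.2⟩

/-- The smooth noncommutative torus `𝒜_θ = C^∞(𝕋ⁿ_θ)`.  It is a type of its own, because it does
not carry the operator-norm topology but its own Fréchet topology, introduced below. -/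
def SmoothTorus {n : ℕ} (θ : Matrix (Fin n) (Fin n) ℝ) : Type := smoothSubalgebra θ

variable {n : ℕ} {θ : Matrix (Fin n) (Fin n) ℝ}

instance : Ring (SmoothTorus θ) := inferInstanceAs (Ring (smoothSubalgebra θ))
instance : StarRing (SmoothTorus θ) := inferInstanceAs (StarRing (smoothSubalgebra θ))
instance : Algebra ℂ (SmoothTorus θ) := inferInstanceAs (Algebra ℂ (smoothSubalgebra θ))

/-- The inclusion of `𝒜_θ` into the bounded operators on `L²(𝕋ⁿ)`. -/
def toOp : SmoothTorus θ →ₗ[ℂ] Op n := (smoothSubalgebra θ).subtype.toAlgHom.toLinearMap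

/-- The partial derivative `D_{s_j} α_s(u)|_{s=0}`, where `D = -i ∂`. -/
def deltaOp (j : Fin n) (u : Op n) : Op n :=
  (-Complex.I) • lineDeriv ℝ (fun s : RR n => act s u) 0 (EuclideanSpace.single j 1)

lemma deltaOp_eq_fderiv {u : Op n} (hu : ContDiff ℝ ∞ fun s : RR n => act s u) (j : Fin n) :
    deltaOp j u =
      (-Complex.I) • fderiv ℝ (fun s : RR n => act s u) 0 (EuclideanSpace.single j 1) := by
  rw [deltaOp, (hu.differentiable (by simp) 0).lineDeriv_eq_fderiv]

lemma act_deltaOp {u : Op n} (hu : ContDiff ℝ ∞ fun s : RR n => act s u) (j : Fin n) (t : RR n) :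
    act t (deltaOp j u) =
      (-Complex.I) • fderiv ℝ (fun s : RR n => act s u) t (EuclideanSpace.single j 1) := by
  rw [deltaOp_eq_fderiv hu, ← actL_apply, map_smul]
  congr 1
  have h0 : HasFDerivAt (fun s : RR n => act s u) (fderiv ℝ (fun s : RR n => act s u) 0) 0 :=
    (hu.differentiable (by simp) 0).hasFDerivAt
  have h1 := ((actL t).restrictScalars ℝ).hasFDerivAt.comp (0 : RR n) h0
  have h2 : HasFDerivAt (fun s : RR n => act s u) (fderiv ℝ (fun s : RR n => act s u) t)
      (t + (0 : RR n)) := by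
    rw [add_zero]
    exact (hu.differentiable (by simp) t).hasFDerivAt
  have h3 := h2.comp (0 : RR n) ((hasFDerivAt_id (𝕜 := ℝ) (0 : RR n)).const_add t)
  have h4 : (fun s : RR n => act s u) ∘ (fun s => t + s) =
      ((actL t).restrictScalars ℝ) ∘ (fun s : RR n => act s u) := by
    funext s
    exact (act_act t s u).symm
  have h5 := h1.unique (h4 ▸ h3)
  exact DFunLike.congr_fun h5 (EuclideanSpace.single j 1)

lemma deltaOp_mem {u : Op n} (hu : u ∈ smoothSubalgebra θ) (j : Fin n) :
    deltaOp j u ∈ smoothSubalgebra θ := by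
  refine ⟨?_, ?_⟩
  · have hd : HasLineDerivAt ℝ (fun s : RR n => act s u)
        (lineDeriv ℝ (fun s : RR n => act s u) 0 (EuclideanSpace.single j 1)) 0
        (EuclideanSpace.single j 1) :=
      (hu.2.differentiable (by simp) 0).lineDifferentiableAt.hasLineDerivAt
    have ht := hd.tendsto_slope_zero
    refine (cstarTorus θ).smul_mem ?_ _
    refine (StarSubalgebra.isClosed_topologicalClosure _).mem_of_tendsto ht ?_
    refine Eventually.of_forall fun t => ?_
    have := (cstarTorus θ).smul_mem (sub_mem
      (act_mem θ ((0 : RR n) + t • EuclideanSpace.single j (1 : ℝ)) hu.1)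
      (act_mem θ (0 : RR n) hu.1)) ((t⁻¹ : ℝ) : ℂ)
    rwa [Complex.coe_smul] at this
  · have h : (fun s : RR n => act s (deltaOp j u)) = fun s : RR n =>
        (-Complex.I) • fderiv ℝ (fun s : RR n => act s u) s (EuclideanSpace.single j 1) :=
      funext fun s => act_deltaOp hu.2 j s
    rw [h]
    exact ((hu.2.fderiv_right (m := ∞) (by simp)).clm_apply contDiff_const).const_smul _

/-- The derivation `δ_j : 𝒜_θ → 𝒜_θ`, `δ_j(u) = D_{s_j} α_s(u)|_{s=0}`. -/
def delta (θ : Matrix (Fin n) (Fin n) ℝ) (j : Fin n) : Module.End ℂ (SmoothTorus θ) where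
  toFun u := ⟨deltaOp j (toOp u), deltaOp_mem u.2 j⟩
  map_add' u v := Subtype.ext (by
    change deltaOp j (toOp u + toOp v) = deltaOp j (toOp u) + deltaOp j (toOp v)
    have hu := (u.2.2.differentiable (by simp) 0).lineDifferentiableAt
      (v := EuclideanSpace.single j (1 : ℝ))
    have hv := (v.2.2.differentiable (by simp) 0).lineDifferentiableAt
      (v := EuclideanSpace.single j (1 : ℝ))
    simp only [deltaOp, map_add, ← smul_add]
    congr 1
    exact (HasDerivAt.add hu.hasLineDerivAt hv.hasLineDerivAt).deriv)
  map_smul' c u := Subtype.ext (by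
    change deltaOp j (c • toOp u) = c • deltaOp j (toOp u)
    have hu := (u.2.2.differentiable (by simp) 0).lineDifferentiableAt
      (v := EuclideanSpace.single j (1 : ℝ))
    simp only [deltaOp, map_smul]
    rw [smul_comm c]
    congr 1
    exact (HasDerivAt.const_smul c hu.hasLineDerivAt).deriv)

/-- `δ^β = δ_1^{β_1} ⋯ δ_n^{β_n}`. -/
def deltaPow (θ : Matrix (Fin n) (Fin n) ℝ) (β : Fin n → ℕ) : Module.End ℂ (SmoothTorus θ) :=
  (List.ofFn fun j => delta θ j ^ β j).prod

/-- The map `u ↦ δ^β(u)` from `𝒜_θ` to the bounded operators. -/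
def deltaPowOp (β : Fin n → ℕ) : SmoothTorus θ →ₗ[ℂ] Op n := toOp ∘ₗ deltaPow θ β

/-- The Fréchet topology of `𝒜_θ`: the one defined by the semi-norms `u ↦ ‖δ^β(u)‖`, i.e. the
initial topology for the maps `δ^β` from `𝒜_θ` to the bounded operators with the norm topology. -/
instance : TopologicalSpace (SmoothTorus θ) :=
  TopologicalSpace.induced (LinearMap.pi (deltaPowOp (θ := θ))) inferInstance

instance : IsTopologicalAddGroup (SmoothTorus θ) :=
  topologicalAddGroup_induced (LinearMap.pi (deltaPowOp (θ := θ)))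

instance : ContinuousSMul ℂ (SmoothTorus θ) :=
  continuousSMul_induced (LinearMap.pi (deltaPowOp (θ := θ)))

lemma continuous_deltaPowOp (β : Fin n → ℕ) :
    Continuous (deltaPowOp β : SmoothTorus θ → Op n) := by
  have h : Continuous (LinearMap.pi (deltaPowOp (θ := θ))) := continuous_induced_dom
  exact (continuous_apply β).comp h

lemma continuous_toOp : Continuous (toOp : SmoothTorus θ → Op n) := by
  have h := continuous_deltaPowOp (θ := θ) (0 : Fin n → ℕ)
  have : deltaPow θ 0 = 1 := by
    simp [deltaPow]
  rw [deltaPowOp, this] at h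
  exact h

/-! ### The unitaries `U^k`, the trace `τ` and Fourier coefficients -/

lemma Uop_smooth (j : Fin n) : Uop θ j ∈ smoothSubalgebra θ :=
  ⟨Uop_mem θ j, by
    simp only [act_Uop]
    have h : ContDiff ℝ ∞ fun s : RR n => Complex.exp (s j * Complex.I) := by
      have hj : ContDiff ℝ ∞ fun s : RR n => s j := by fun_prop
      exact ((Complex.ofRealCLM.contDiff.comp hj).mul contDiff_const).cexp
    exact h.smul contDiff_const⟩

/-- `U_j` as a unitary element of `𝒜_θ`. -/
def U (θ : Matrix (Fin n) (Fin n) ℝ) (j : Fin n) : unitary (SmoothTorus θ) :=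
  ⟨⟨Uop θ j, Uop_smooth j⟩, by
    have h : Uop θ j ∈ unitary (Op n) := (Unitary.linearIsometryEquiv.symm (Ugen θ j)).2
    exact ⟨Subtype.ext h.1, Subtype.ext h.2⟩⟩

/-- `U^k = U_1^{k_1} ⋯ U_n^{k_n}` for `k ∈ ℤⁿ`. -/
def Upow (θ : Matrix (Fin n) (Fin n) ℝ) (k : Fin n → ℤ) : unitary (SmoothTorus θ) :=
  (List.ofFn fun j => U θ j ^ k j).prod

/-- The constant function `1` in `L²(𝕋ⁿ)`. -/
def oneL2 (n : ℕ) : L2 n := (memLp_const (1 : ℂ)).toLp (fun _ => (1 : ℂ))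

/-- The state `T ↦ ⟨T1 | 1⟩ = ∫ (T1)(x) dx` on the bounded operators. -/
def tauOp (n : ℕ) : Op n →L[ℂ] ℂ :=
  (innerSL ℂ (oneL2 n)).comp (ContinuousLinearMap.apply ℂ (L2 n) (oneL2 n))

/-- The trace `τ` on `𝒜_θ`. -/
def tau (u : SmoothTorus θ) : ℂ := tauOp n (toOp u)

/-- The Fourier coefficient `u_k = ⟨u | U^k⟩ = τ(u (U^k)^*)`. -/
def fourierCoeff (u : SmoothTorus θ) (k : Fin n → ℤ) : ℂ :=
  tau (u * star (Upow θ k : SmoothTorus θ))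

/-! ### Symbols

A map `ρ` from an open subset of `ℝⁿ` to the Fréchet space `𝒜_θ` is `C^∞` exactly when all the
maps `δ^α ρ` are `C^∞` with values in the Banach space of bounded operators, since the topology of
`𝒜_θ` is the initial one for the maps `δ^α` and is complete; moreover
`δ^α ∂_ξ^β ρ = ∂_ξ^β (δ^α ρ)`. The bounds on all `∂_ξ^β` with `|β| = k` are expressed through the
norm of the `k`-th derivative. -/

/-- `ρ ∈ C^∞(Ω; 𝒜_θ)`, for `Ω` open in `ℝⁿ`. -/
def SmoothOn (Ω : Set (RR n)) (ρ : RR n → SmoothTorus θ) : Prop :=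
  ∀ α : Fin n → ℕ, ContDiffOn ℝ ∞ (fun ξ => deltaPowOp α (ρ ξ)) Ω

/-- `ρ ∈ S_q(ℝⁿ; 𝒜_θ)`: a smooth map on `ℝⁿ ∖ 0`, homogeneous of degree `q` (the value of `ρ` at
the origin is irrelevant). -/
def IsHomogeneousSymbol (q : ℂ) (ρ : RR n → SmoothTorus θ) : Prop :=
  SmoothOn {0}ᶜ ρ ∧
    ∀ t : ℝ, 0 < t → ∀ ξ : RR n, ξ ≠ 0 → ρ (t • ξ) = ((t : ℂ) ^ q) • ρ ξ

/-- `ρ ∈ C^∞(ℝⁿ; 𝒜_θ)` has the asymptotic expansion `ρ ∼ ∑_{j ≥ 0} c_j` with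
`c_j = ρ_{q-j} ∈ S_{q-j}(ℝⁿ; 𝒜_θ)`. -/
structure HasExpansion (q : ℂ) (ρ : RR n → SmoothTorus θ) (c : ℕ → RR n → SmoothTorus θ) :
    Prop where
  smooth : SmoothOn Set.univ ρ
  homogeneous : ∀ j : ℕ, IsHomogeneousSymbol (q - j) (c j)
  bound : ∀ (N : ℕ) (α : Fin n → ℕ) (k : ℕ), ∃ C : ℝ, ∀ ξ : RR n, 1 ≤ ‖ξ‖ →
    ‖iteratedFDeriv ℝ k
        (fun η => deltaPowOp α (ρ η - ∑ j ∈ Finset.range N, c j η)) ξ‖ ≤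
      C * ‖ξ‖ ^ (q.re - N - k)

/-- `ρ ∈ S^q(ℝⁿ; 𝒜_θ)`: classical symbols of order `q`. -/
def IsClassicalSymbol (q : ℂ) (ρ : RR n → SmoothTorus θ) : Prop :=
  ∃ c : ℕ → RR n → SmoothTorus θ, HasExpansion q ρ c

/-! ### Pseudodifferential operators -/

/-- A point of `ℤⁿ` as a point of `ℝⁿ`. -/
def latticePoint (k : Fin n → ℤ) : RR n := WithLp.toLp 2 fun j => (k j : ℝ)

/-- `P = P_ρ`, i.e. `P u = ∑_k u_k ρ(k) U^k` for all `u = ∑_k u_k U^k` in `𝒜_θ`, the series being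
convergent in `𝒜_θ`. -/
def IsQuantization (ρ : RR n → SmoothTorus θ) (P : Module.End ℂ (SmoothTorus θ)) : Prop :=
  ∀ u : SmoothTorus θ,
    HasSum (fun k : Fin n → ℤ =>
      fourierCoeff u k • (ρ (latticePoint k) * (Upow θ k : SmoothTorus θ))) (P u)

/-- `Ψ^q(𝕋ⁿ_θ)`: classical pseudodifferential operators of order `q ∈ ℂ`. -/
def Psi (θ : Matrix (Fin n) (Fin n) ℝ) (q : ℂ) : Set (Module.End ℂ (SmoothTorus θ)) :=
  {P | ∃ ρ : RR n → SmoothTorus θ, IsClassicalSymbol q ρ ∧ IsQuantization ρ P}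

/-- `σ` is the homogeneous symbol of degree `-n` of the integer-order operator `P`; it is `0` when
`P` has order `< -n`. -/
def IsSymbolOfDegreeNegDim (P : Module.End ℂ (SmoothTorus θ)) (σ : RR n → SmoothTorus θ) : Prop :=
  ∃ (m : ℤ) (ρ : RR n → SmoothTorus θ) (c : ℕ → RR n → SmoothTorus θ),
    HasExpansion (m : ℂ) ρ c ∧ IsQuantization ρ P ∧
      ((∃ j : ℕ, m - (j : ℤ) = -(n : ℤ) ∧ σ = c j) ∨ (m < -(n : ℤ) ∧ σ = 0))

open Classical in
/-- The symbol `ρ_{-n}` of degree `-n` of an integer-order operator `P` (its values on `ℝⁿ ∖ 0` are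
uniquely determined by `P`). -/
def symbolOfDegreeNegDim (P : Module.End ℂ (SmoothTorus θ)) : RR n → SmoothTorus θ :=
  if h : ∃ σ, IsSymbolOfDegreeNegDim P σ then h.choose else 0

/-- The noncommutative residue `Res(P) = ∫_{𝕊ⁿ⁻¹} τ[ρ_{-n}(ξ)] dⁿ⁻¹ξ` of an integer-order
operator, the integral being with respect to the surface measure of the unit sphere. -/
def Res (P : Module.End ℂ (SmoothTorus θ)) : ℂ :=
  ∫ ξ : Metric.sphere (0 : RR n) 1, tau (symbolOfDegreeNegDim P ξ)
    ∂((volume : Measure (RR n)).toSphere)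

/-! ### Smoothing operators -/

/-- The embedding of `𝒜_θ` into its topological dual `𝒜_θ'`, `u ↦ (v ↦ τ(uv))`. -/
def toDual (u : SmoothTorus θ) : StrongDual ℂ (SmoothTorus θ) where
  toFun v := tau (u * v)
  map_add' v w := by
    simp only [mul_add, tau, map_add]
  map_smul' c v := by
    simp only [mul_smul_comm, tau, map_smul, RingHom.id_apply]
  cont := by
    have h : Continuous fun v : SmoothTorus θ => tauOp n (toOp u * toOp v) :=
      (tauOp n).continuous.comp (continuous_const.mul continuous_toOp)
    exact h

/-- `R ∈ Ψ^{-∞}(𝕋ⁿ_θ)`: the operator `R` extends to a continuous linear map from `𝒜_θ'`, with its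
strong dual topology, to `𝒜_θ`. -/
def IsSmoothing (R : Module.End ℂ (SmoothTorus θ)) : Prop :=
  ∃ R' : StrongDual ℂ (SmoothTorus θ) →L[ℂ] SmoothTorus θ, ∀ u : SmoothTorus θ, R' (toDual u) = R u

/-- The operator of left multiplication by `U_j` on `𝒜_θ`. -/
def mulU (θ : Matrix (Fin n) (Fin n) ℝ) (j : Fin n) : Module.End ℂ (SmoothTorus θ) :=
  LinearMap.mulLeft ℂ (U θ j : SmoothTorus θ)

end NCTorus

end

noncomputable section

namespace NCTorus

variable {n : ℕ} {θ : Matrix (Fin n) (Fin n) ℝ}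

/-! ### Monomials `U^k` and the trace -/

/-! Two exact identities on the lattice drive the proof. If `P_σ` has symbol `σ`, then `[δ_j, P_σ]`
has symbol `δ_j σ` (`Quantizes.lie_delta`); and for a scalar function `b`, the commutator of the
operator with symbol `b U_j^*` with `U_j` has symbol `b(k + e_j) - b(k)` (`Quantizes.lie_mulU`). So
the symbol `ρ` of `P` has to be written as a sum of `δ_j`-derivatives of symbols of order `q` plus a
scalar symbol, and the latter as a sum of finite differences of symbols of order `q + 1`, up to a
rapidly decaying error; a Fourier multiplier with rapidly decaying scalar symbol is smoothing
(`isSmoothing_of_rapidDecay`).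

The first step is `exists_sum_delta_add_tau`: `u = ∑ δ_j(A_j u) + τ(u)`. Subtracting from `u` its
average over one period of the `j`-th circle leaves a `δ_j`-derivative, by an integration by parts,
and averaging over all the circles gives `τ(u)`. The `A_j` come from bounded maps commuting with all
the derivations, so they preserve classical symbols.

There remains the scalar symbol `τ ∘ ρ`. Each of its homogeneous parts is the divergence of a
homogeneous field. In degree `p ≠ -n` Euler's identity gives the field `ξ f / (p + n)`
(`exists_div_of_ne`). In degree `-n` the obstruction is the integral over the sphere, which is `Res
P`; when it vanishes, `f` is a ray integral of a Schwartz function `g` of integral zero, the Fourier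
transform shows that `g` is a divergence, and ray integrals carry this back to `f`
(`exists_div_of_integral_sphere_eq_zero`). Divergences become differences by the Euler–Maclaurin
device: the shift by `e_l` is formally `exp(∂_l)`, so applying `∂_l / (exp(∂_l) - 1)` to the fields
and summing à la Borel (`exists_scalarExpansion`) gives symbols whose differences have the required
expansion (`exists_difference_symbols`).

Since `Res P` is defined through some symbol of `P`, and `P` only sees the values of its symbol on
the lattice, one also needs that lattice values determine the homogeneous parts
(`ScalarExpansion.pad_eq`, `integral_tau_eq_Res`). -/

lemma prod_ofFn_mul_of_commute {M : Type*} [Monoid M] {m : ℕ} (f g : Fin m → M)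
    (h : ∀ i j, Commute (f i) (g j)) :
    (List.ofFn fun j => f j * g j).prod = (List.ofFn f).prod * (List.ofFn g).prod := by
  induction m with
  | zero => simp
  | succ m ih =>
    have hc : Commute (g 0) (List.ofFn fun j : Fin m => f j.succ).prod :=
      Commute.list_prod_right _ _ fun x hx => by
        obtain ⟨j, rfl⟩ := (List.mem_ofFn' _ _).1 hx
        exact (h _ _).symm
    simp only [List.ofFn_succ, List.prod_cons]
    rw [ih (fun j => f j.succ) (fun j => g j.succ) fun i j => h _ _, mul_assoc, mul_assoc,
      ← mul_assoc (g 0), hc.eq, mul_assoc]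

lemma toOp_mul (u v : SmoothTorus θ) : toOp (u * v) = toOp u * toOp v := rfl

lemma toOp_one : toOp (1 : SmoothTorus θ) = 1 := rfl

lemma toOp_star (u : SmoothTorus θ) : toOp (star u) = star (toOp u) := rfl

lemma toOp_injective : Function.Injective (toOp : SmoothTorus θ → Op n) := Subtype.val_injective

instance : StarModule ℂ (SmoothTorus θ) := inferInstanceAs (StarModule ℂ (smoothSubalgebra θ))

lemma act_translate (s : RR n) (T : Op n) (f : L2 n) :
    act s T (translate (toTorus fun l => s l / (2 * Real.pi)) f) =
      translate (toTorus fun l => s l / (2 * Real.pi)) (T f) := by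
  simp only [act, LinearIsometryEquiv.conjStarAlgEquiv_apply_apply]
  simp

lemma translate_oneL2 (a : UnitAddTorus (Fin n)) : translate a (oneL2 n) = oneL2 n := by
  refine Lp.ext ?_
  have h := (memLp_const (μ := torusMeasure n) (p := 2) (1 : ℂ)).coeFn_toLp
  filter_upwards [coeFn_translate a (oneL2 n), h,
    (measurePreserving_translate a).quasiMeasurePreserving.ae_eq_comp h] with x e1 e2 e3
  rw [e1]
  exact Eq.trans e3 e2.symm

lemma norm_oneL2 : ‖oneL2 n‖ = 1 := by
  rw [oneL2, Lp.norm_toLp, eLpNorm_const (1 : ℂ) (by norm_num) (IsProbabilityMeasure.ne_zero _)]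
  simp

lemma tauOp_apply (T : Op n) : tauOp n T = inner ℂ (oneL2 n) (T (oneL2 n)) := rfl

lemma tauOp_one : tauOp n 1 = 1 := by
  rw [tauOp_apply, one_apply_eq_self, inner_self_eq_norm_sq_to_K, norm_oneL2]
  simp

lemma tauOp_act (s : RR n) (T : Op n) : tauOp n (act s T) = tauOp n T := by
  have h := act_translate s T (oneL2 n)
  rw [translate_oneL2] at h
  rw [tauOp_apply, tauOp_apply, h]
  conv_lhs => rw [← translate_oneL2 (toTorus fun l => s l / (2 * Real.pi))]
  exact LinearIsometryEquiv.inner_map_map _ _ _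

lemma norm_act (s : RR n) (T : Op n) : ‖act s T‖ = ‖T‖ := by
  refine le_antisymm (NonUnitalStarAlgHom.norm_apply_le (act s : Op n →⋆ₙₐ[ℂ] Op n) T) ?_
  have h : act (-s) (act s T) = T := by
    rw [act_act, neg_add_cancel]
    refine ContinuousLinearMap.ext fun f => ?_
    have h := act_translate (0 : RR n) T f
    have h0 : (toTorus fun l => (0 : RR n) l / (2 * Real.pi)) = (0 : UnitAddTorus (Fin n)) := by
      funext l; simp [toTorus]
    have h1 : ∀ g : L2 n, translate (0 : UnitAddTorus (Fin n)) g = g :=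
      compMeasurePreserving_translate_zero
    rwa [h0, h1, h1] at h
  conv_lhs => rw [← h]
  exact NonUnitalStarAlgHom.norm_apply_le (act (-s) : Op n →⋆ₙₐ[ℂ] Op n) _

/-- The group law makes `act 0` idempotent, and an isometry killing `act 0 T - T` forces this
difference to vanish. -/
lemma act_zero (T : Op n) : act (0 : RR n) T = T := by
  have h : act (0 : RR n) (act (0 : RR n) T - T) = 0 := by
    rw [map_sub, act_act, add_zero, sub_self]
  rw [← norm_eq_zero, norm_act, norm_eq_zero, sub_eq_zero] at h
  exact h

/-- A translation by a full period acts trivially. -/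
lemma act_period (j : Fin n) (T : Op n) :
    act (EuclideanSpace.single j (2 * Real.pi) : RR n) T = T := by
  refine ContinuousLinearMap.ext fun f => ?_
  have h := act_translate (EuclideanSpace.single j (2 * Real.pi) : RR n) T f
  have h0 : (toTorus fun l => (EuclideanSpace.single j (2 * Real.pi) : RR n) l / (2 * Real.pi)) =
      (0 : UnitAddTorus (Fin n)) := by
    funext l
    by_cases hl : l = j
    · subst hl
      have : (2 * Real.pi) ≠ 0 := by positivity
      simp [toTorus, this]
    · simp [toTorus, hl]
  have h1 : ∀ g : L2 n, translate (0 : UnitAddTorus (Fin n)) g = g :=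
    compMeasurePreserving_translate_zero
  rwa [h0, h1, h1] at h

/-- The unitary scalars of `𝒜_θ`. -/
def unitaryScalars (θ : Matrix (Fin n) (Fin n) ℝ) : Subgroup (unitary (SmoothTorus θ)) where
  carrier := {x | ∃ z : ℂ, (x : SmoothTorus θ) = z • 1}
  one_mem' := ⟨1, by simp⟩
  mul_mem' := by
    rintro x y ⟨z, hz⟩ ⟨w, hw⟩
    exact ⟨z * w, by simp [hz, hw, smul_smul, mul_comm]⟩
  inv_mem' := by
    rintro x ⟨z, hz⟩
    exact ⟨star z, by rw [← Unitary.star_eq_inv, Unitary.coe_star, hz, star_smul, star_one]⟩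

instance : (unitaryScalars θ).Normal := by
  constructor
  rintro x ⟨z, hz⟩ g
  refine ⟨z, ?_⟩
  rw [← Unitary.star_eq_inv]
  simp [hz]

/-- Moving a translation past a character costs a phase, so both products are nonzero multiples of
one operator: the two characters composed with the sum of the translations. The value of the scalar
is never needed. -/
lemma Uop_commutation (j k : Fin n) : ∃ z : ℂ, Uop θ j * Uop θ k = z • (Uop θ k * Uop θ j) := by
  have key : ∀ j k : Fin n, ∃ z : ℂ, z ≠ 0 ∧ ∀ f : L2 n, Uop θ j (Uop θ k f) =
      z • characterMul (Pi.single j 1) (characterMul (Pi.single k 1)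
        (translate ((toTorus fun l => θ l j / 2) + (toTorus fun l => θ l k / 2)) f)) := by
    intro j k
    refine ⟨UnitAddTorus.mFourier (Pi.single k 1) (toTorus fun l => θ l j / 2), ?_, fun f => ?_⟩
    · rw [← norm_ne_zero_iff, norm_mFourier_apply]
      exact one_ne_zero
    · change characterMul _ (translate _ (characterMul _ (translate _ f))) = _
      rw [translate_characterMul, map_smul, translate_translate]
  have comm : ∀ (m m' : Fin n → ℤ) (f : L2 n),
      characterMul m (characterMul m' f) = characterMul m' (characterMul m f) := by
    intro m m' f
    refine Lp.ext ?_
    filter_upwards [coeFn_characterMulₗ m (characterMulₗ m' f), coeFn_characterMulₗ m' f,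
      coeFn_characterMulₗ m' (characterMulₗ m f), coeFn_characterMulₗ m f] with x e1 e2 e3 e4
    refine e1.trans (Eq.trans ?_ e3.symm)
    rw [e2, e4]
    ring
  obtain ⟨z, hz, h⟩ := key j k
  obtain ⟨w, hw, h'⟩ := key k j
  refine ⟨z * w⁻¹, ContinuousLinearMap.ext fun f => ?_⟩
  change Uop θ j (Uop θ k f) = (z * w⁻¹) • Uop θ k (Uop θ j f)
  rw [h, h', smul_smul, mul_assoc, inv_mul_cancel₀ hw, mul_one, comm, add_comm]

lemma U_commutation (j k : Fin n) : ∃ z : ℂ,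
    (U θ j * U θ k : SmoothTorus θ) = z • (U θ k * U θ j : SmoothTorus θ) := by
  obtain ⟨z, hz⟩ := Uop_commutation (θ := θ) j k
  exact ⟨z, toOp_injective hz⟩

lemma norm_of_smul_one_mem_unitary {x : unitary (SmoothTorus θ)} {z : ℂ}
    (h : (x : SmoothTorus θ) = z • 1) : ‖z‖ = 1 := by
  have h1 := Unitary.coe_star_mul_self x
  rw [h, star_smul, star_one, smul_mul_smul_comm, one_mul] at h1
  have h2 := congrArg (fun u => tauOp n (toOp u)) h1
  simp only [map_smul, toOp_one, tauOp_one, smul_eq_mul, mul_one] at h2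
  have h3 := congrArg norm h2
  simp only [norm_mul, norm_star, norm_one] at h3
  nlinarith [norm_nonneg z]

/-- `U^{k+l}` is a unimodular multiple of `U^k U^l`. -/
lemma Upow_add (k l : Fin n → ℤ) : ∃ z : ℂ, ‖z‖ = 1 ∧
    (Upow θ (k + l) : SmoothTorus θ) = z • (Upow θ k * Upow θ l : SmoothTorus θ) := by
  -- Modulo unitary scalars the generators commute, so `k ↦ U^k` becomes a homomorphism there;
  -- lifting the identity back produces the scalar.
  let π := QuotientGroup.mk' (unitaryScalars θ)
  have hcomm : ∀ i j, Commute (π (U θ i)) (π (U θ j)) := by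
    intro i j
    obtain ⟨z, hz⟩ := U_commutation (θ := θ) i j
    rw [Commute, SemiconjBy, ← map_mul, ← map_mul, eq_comm]
    refine (QuotientGroup.eq).2 ⟨z, ?_⟩
    rw [Submonoid.coe_mul, ← Unitary.star_eq_inv, Submonoid.coe_mul, hz, Unitary.coe_star,
      Submonoid.coe_mul, mul_smul_comm, ← Submonoid.coe_mul, Unitary.coe_star_mul_self]
  have hπ : ∀ k, π (Upow θ k) = (List.ofFn fun j => π (U θ j) ^ k j).prod := by
    intro k
    simp [Upow, map_list_prod, List.map_ofFn, Function.comp_def]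
  have h : π (Upow θ k * Upow θ l) = π (Upow θ (k + l)) := by
    rw [map_mul, hπ, hπ, hπ, ← prod_ofFn_mul_of_commute]
    · simp only [Pi.add_apply, zpow_add]
    · exact fun i j => ((hcomm i j).zpow_left _).zpow_right _
  obtain ⟨z, hz⟩ := (QuotientGroup.eq).1 h
  refine ⟨z, norm_of_smul_one_mem_unitary hz, ?_⟩
  have : (Upow θ (k + l) : SmoothTorus θ) =
      ((Upow θ k * Upow θ l * ((Upow θ k * Upow θ l)⁻¹ * Upow θ (k + l)) :
        unitary (SmoothTorus θ)) : SmoothTorus θ) := by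
    rw [mul_inv_cancel_left]
  rw [this, Submonoid.coe_mul, hz, mul_smul_comm, mul_one, Submonoid.coe_mul]

lemma Upow_zero : Upow θ (0 : Fin n → ℤ) = 1 := by simp [Upow]

lemma prod_ofFn_eq_single {M : Type*} [Monoid M] {m : ℕ} (f : Fin m → M) (j : Fin m)
    (h : ∀ i, i ≠ j → f i = 1) : (List.ofFn f).prod = f j := by
  induction m with
  | zero => exact j.elim0
  | succ m ih =>
    rw [List.ofFn_succ, List.prod_cons]
    induction j using Fin.cases with
    | zero =>
      have : (fun i : Fin m => f i.succ) = fun _ => 1 := funext fun i => h _ (Fin.succ_ne_zero i)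
      simp [this]
    | succ j =>
      rw [h 0 (Fin.succ_ne_zero j).symm, one_mul]
      exact ih (fun i => f i.succ) j fun i hi => h _ fun e => hi (Fin.succ_injective _ e)

lemma Upow_single (j : Fin n) : Upow θ (Pi.single j 1) = U θ j := by
  rw [Upow, prod_ofFn_eq_single _ j fun i hi => by simp [hi]]
  simp

/-- The character `s ↦ exp(i s·k)` of `ℝⁿ`. -/
def phase (k : Fin n → ℤ) (s : RR n) : ℂ := Complex.exp ((∑ j, k j * s j : ℝ) * Complex.I)

lemma act_Upow (k : Fin n → ℤ) (s : RR n) :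
    act s (toOp (Upow θ k : SmoothTorus θ)) = phase k s • toOp (Upow θ k : SmoothTorus θ) := by
  have h1 : ∀ (j : Fin n) (m : ℤ), act s (toOp ((U θ j ^ m : unitary _) : SmoothTorus θ)) =
      Complex.exp ((m * s j : ℝ) * Complex.I) •
        toOp ((U θ j ^ m : unitary _) : SmoothTorus θ) := by
    intro j m
    have hn : ∀ m : ℕ, act s (toOp ((U θ j ^ m : unitary _) : SmoothTorus θ)) =
        Complex.exp ((m * s j : ℝ) * Complex.I) •
          toOp ((U θ j ^ m : unitary _) : SmoothTorus θ) := by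
      intro m
      induction m with
      | zero => simp [toOp_one]
      | succ m ih =>
        rw [pow_succ, Submonoid.coe_mul, toOp_mul, map_mul, ih]
        have : act s (toOp (U θ j : SmoothTorus θ)) = _ := act_Uop θ s j
        rw [this, smul_mul_smul_comm, ← Complex.exp_add]
        push_cast
        rw [add_mul, add_mul, one_mul]
        rfl
    cases m with
    | ofNat m => simpa using hn m
    | negSucc m =>
      rw [zpow_negSucc, ← Unitary.star_eq_inv, Unitary.coe_star, toOp_star, map_star, hn,
        star_smul]
      congr 1
      rw [Complex.star_def, ← Complex.exp_conj]
      simp [Int.negSucc_eq]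
      ring_nf
  have h2 : ∀ (L : List (Fin n)), act s (toOp (((L.map fun j => U θ j ^ k j).prod :
      unitary (SmoothTorus θ)) : SmoothTorus θ)) =
      Complex.exp (((L.map fun j => (k j * s j : ℝ)).sum : ℝ) * Complex.I) •
      toOp (((L.map fun j => U θ j ^ k j).prod : unitary (SmoothTorus θ)) : SmoothTorus θ) := by
    intro L
    induction L with
    | nil => simp [toOp_one]
    | cons j L ih =>
      rw [List.map_cons, List.prod_cons, Submonoid.coe_mul, toOp_mul, map_mul, ih, h1,
        smul_mul_smul_comm, ← Complex.exp_add, List.map_cons, List.sum_cons]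
      push_cast
      rw [add_mul]
  have h3 := h2 (List.finRange n)
  rw [← List.ofFn_eq_map, ← List.ofFn_eq_map, List.sum_ofFn] at h3
  exact h3

/-- `τ` is invariant under the action, and the shift by `π / k_j` along the `j`-th axis turns `U^k`
into `-U^k`. -/
lemma tau_Upow (k : Fin n → ℤ) : tau (Upow θ k : SmoothTorus θ) = if k = 0 then 1 else 0 := by
  split_ifs with hk
  · subst hk
    rw [Upow_zero]
    exact tauOp_one
  · obtain ⟨j, hj⟩ : ∃ j, k j ≠ 0 := by
      by_contra! h
      exact hk (funext h)
    let s : RR n := EuclideanSpace.single j (Real.pi / k j)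
    have h := tauOp_act s (toOp (Upow θ k : SmoothTorus θ))
    have hp : phase k s = -1 := by
      have : (∑ i, (k i : ℝ) * s i) = Real.pi := by
        rw [Finset.sum_eq_single j]
        · have : (k j : ℝ) ≠ 0 := by exact_mod_cast hj
          simp [s]
          field_simp
        · intro i _ hi
          simp [s, hi]
        · simp
      rw [phase, this, Complex.exp_pi_mul_I]
    rw [act_Upow, map_smul, hp] at h
    change tauOp n (toOp _) = 0
    simp only [smul_eq_mul, neg_mul, one_mul] at h
    linear_combination (-1/2 : ℂ) * h

/-- The monomials `U^k` span a dense subspace of `A_θ`. -/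
lemma cstarTorus_le_closure_span (T : Op n) (hT : T ∈ cstarTorus θ) :
    T ∈ closure (Submodule.span ℂ
      (Set.range fun k => toOp (Upow θ k : SmoothTorus θ)) : Set (Op n)) := by
  set S := Submodule.span ℂ (Set.range fun k => toOp (Upow θ k : SmoothTorus θ))
  have hle : ∀ T ∈ StarAlgebra.adjoin ℂ (Set.range (Uop θ)), T ∈ S := by
    intro T hT
    have hT' : T ∈ Algebra.adjoin ℂ (Set.range (Uop θ) ∪ star (Set.range (Uop θ))) := by
      rw [← StarAlgebra.adjoin_toSubalgebra]
      exact hT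
    rw [← Subalgebra.mem_toSubmodule, Algebra.adjoin_eq_span] at hT'
    -- The monoid generated by the `U_j` and their adjoints consists of multiples of the `U^k`, and
    -- its linear span is the generated `*`-algebra.
    have key : ∀ x ∈ Submonoid.closure (Set.range (Uop θ) ∪ star (Set.range (Uop θ))),
        ∃ (z : ℂ) (k : Fin n → ℤ), x = z • toOp (Upow θ k : SmoothTorus θ) := by
      intro x hx
      induction hx using Submonoid.closure_induction with
      | mem x hx =>
        rcases hx with ⟨j, rfl⟩ | ⟨j, hj⟩
        · exact ⟨1, Pi.single j 1, by rw [Upow_single, one_smul]; rfl⟩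
        -- The adjoint of `U_j` is identified as a multiple of `U^{-e_j}` from `U^{-e_j + e_j} = 1`.
        · obtain ⟨z, hz, h⟩ := Upow_add (θ := θ) (-Pi.single j 1) (Pi.single j 1)
          refine ⟨z, -Pi.single j 1, ?_⟩
          have hx : x = toOp (star (U θ j) : SmoothTorus θ) := by
            rw [← star_star x, ← hj]
            rfl
          rw [neg_add_cancel, Upow_zero, Upow_single] at h
          have h2 := congrArg (fun y => y * (star (U θ j) : SmoothTorus θ)) h
          simp only [OneMemClass.coe_one, one_mul, smul_mul_assoc, mul_assoc] at h2
          rw [hx, ← map_smul, h2, Unitary.mul_star_self_of_mem (U θ j).2, mul_one]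
      | one => exact ⟨1, 0, by rw [Upow_zero, one_smul]; rfl⟩
      | mul x y _ _ hx hy =>
        obtain ⟨z, k, rfl⟩ := hx
        obtain ⟨w, l, rfl⟩ := hy
        obtain ⟨c, hc, h⟩ := Upow_add (θ := θ) k l
        have hc0 : c ≠ 0 := by
          rw [← norm_ne_zero_iff, hc]
          exact one_ne_zero
        refine ⟨z * w * c⁻¹, k + l, ?_⟩
        rw [h, map_smul, smul_smul, mul_assoc _ c⁻¹, inv_mul_cancel₀ hc0, mul_one, toOp_mul,
          smul_mul_smul_comm]
    refine (Submodule.span_le.2 ?_) hT'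
    intro x hx
    obtain ⟨z, k, rfl⟩ := key x hx
    exact S.smul_mem _ (Submodule.subset_span ⟨k, rfl⟩)
  have hT' : T ∈ closure (StarAlgebra.adjoin ℂ (Set.range (Uop θ)) : Set (Op n)) := hT
  exact closure_mono (fun x hx => hle x hx) hT'

/-! ### The derivations `δ_j` -/

lemma hasDerivAt_act (u : SmoothTorus θ) (s : RR n) (j : Fin n) :
    HasDerivAt (fun t : ℝ => act (s + t • EuclideanSpace.single j (1 : ℝ)) (toOp u))
      (Complex.I • act s (toOp (delta θ j u))) 0 := by
  have h1 : HasFDerivAt (fun s : RR n => act s (toOp u))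
      (fderiv ℝ (fun s : RR n => act s (toOp u)) s) s :=
    (u.2.2.differentiable (by simp) s).hasFDerivAt
  have h2 := h1.hasLineDerivAt (EuclideanSpace.single j (1 : ℝ))
  have h3 : act s (toOp (delta θ j u)) = _ := act_deltaOp u.2.2 j s
  rw [h3, smul_smul, mul_neg, Complex.I_mul_I, neg_neg, one_smul]
  exact h2

/-- Uniqueness of derivatives; this is how `δ_j` of a product, a monomial, a series or an average is
computed. -/
lemma toOp_delta_of_hasDerivAt {u : SmoothTorus θ} {j : Fin n} {T : Op n}
    (h : HasDerivAt (fun t : ℝ => act (t • EuclideanSpace.single j (1 : ℝ)) (toOp u))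
      (Complex.I • T) 0) : toOp (delta θ j u) = T := by
  have h1 := hasDerivAt_act u 0 j
  simp only [zero_add, act_zero] at h1
  exact smul_right_injective _ Complex.I_ne_zero (h1.unique h)

lemma delta_mul (j : Fin n) (u v : SmoothTorus θ) :
    delta θ j (u * v) = delta θ j u * v + u * delta θ j v := by
  refine toOp_injective (toOp_delta_of_hasDerivAt ?_)
  have h := (hasDerivAt_act u 0 j).mul (hasDerivAt_act v 0 j)
  simp only [zero_add, zero_smul, act_zero] at h
  simp only [toOp_mul, map_mul, map_add, smul_add]
  rw [← smul_mul_assoc, ← mul_smul_comm]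
  exact h

lemma delta_Upow (j : Fin n) (k : Fin n → ℤ) :
    delta θ j (Upow θ k : SmoothTorus θ) = (k j : ℂ) • (Upow θ k : SmoothTorus θ) := by
  refine toOp_injective (toOp_delta_of_hasDerivAt ?_)
  have hp : ∀ t : ℝ, phase k (t • EuclideanSpace.single j (1 : ℝ)) =
      Complex.exp (t * (k j * Complex.I)) := by
    intro t
    have : (∑ i, (k i : ℝ) * (t • EuclideanSpace.single j (1 : ℝ) : RR n) i) = k j * t := by
      rw [Finset.sum_eq_single j]
      · simp
      · intro i _ hi
        simp [hi]
      · simp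
    rw [phase, this]
    push_cast
    ring_nf
  simp only [act_Upow, hp]
  have h : HasDerivAt (fun t : ℝ => Complex.exp (t * (k j * Complex.I))) (k j * Complex.I) 0 := by
    have := ((Complex.ofRealCLM.hasDerivAt (x := 0)).mul_const ((k j : ℂ) * Complex.I)).cexp
    simpa using this
  have h' := h.smul_const (toOp (Upow θ k : SmoothTorus θ))
  rw [map_smul, smul_smul, mul_comm Complex.I]
  exact h'

lemma fderiv_apply_hasFDerivAt {E G : Type*} [NormedAddCommGroup E] [NormedSpace ℝ E]
    [NormedAddCommGroup G] [NormedSpace ℝ G] {F : E → G} (hF : ContDiff ℝ ∞ F) (v x : E) :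
    HasFDerivAt (fun y => fderiv ℝ F y v) ((fderiv ℝ (fderiv ℝ F) x).flip v) x := by
  have hd : DifferentiableAt ℝ (fderiv ℝ F) x :=
    ((hF.fderiv_right (m := 1) (by norm_cast)).differentiable (by simp)) x
  have h := hd.hasFDerivAt.clm_apply (hasFDerivAt_const v x)
  convert h using 1
  ext w
  simp

/-- `δ_j δ_k u` is minus a second derivative of `s ↦ α_s(u)` at `0`, and second derivatives are
symmetric. -/
lemma delta_comm (j k : Fin n) : Commute (delta θ j) (delta θ k) := by
  refine LinearMap.ext fun u => toOp_injective ?_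
  set F : RR n → Op n := fun s => act s (toOp u) with hF
  have hFs : ContDiff ℝ ∞ F := u.2.2
  have key : ∀ j k : Fin n, toOp (delta θ j (delta θ k u)) =
      -(fderiv ℝ (fderiv ℝ F) 0 (EuclideanSpace.single j 1) (EuclideanSpace.single k 1)) := by
    intro j k
    refine (deltaOp_eq_fderiv (delta θ k u).2.2 j).trans ?_
    have h : (fun s : RR n => act s (delta θ k u).1) = fun s : RR n =>
        (-Complex.I) • fderiv ℝ F s (EuclideanSpace.single k 1) :=
      funext fun s => act_deltaOp u.2.2 k s
    have hd2 := ((fderiv_apply_hasFDerivAt hFs (EuclideanSpace.single k (1 : ℝ)) 0).const_smul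
        (-Complex.I))
    have h2 : fderiv ℝ (fun s : RR n =>
        (-Complex.I) • fderiv ℝ F s (EuclideanSpace.single k 1)) 0 = _ := hd2.fderiv
    rw [h, h2]
    simp [smul_smul]
  change toOp (delta θ j (delta θ k u)) = toOp (delta θ k (delta θ j u))
  rw [key, key]
  have hsymm : IsSymmSndFDerivAt ℝ F 0 :=
    hFs.contDiffAt.isSymmSndFDerivAt (by simp; norm_cast)
  rw [hsymm.eq]

/-- The composite of the derivations `δ_j`, for `j` in a list. -/
def deltaWord (θ : Matrix (Fin n) (Fin n) ℝ) (w : List (Fin n)) : Module.End ℂ (SmoothTorus θ) :=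
  (w.map (delta θ)).prod

lemma deltaWord_nil : deltaWord θ [] = 1 := rfl

lemma deltaWord_cons (j : Fin n) (w : List (Fin n)) :
    deltaWord θ (j :: w) = delta θ j * deltaWord θ w := by simp [deltaWord]

lemma deltaWord_append (w w' : List (Fin n)) :
    deltaWord θ (w ++ w') = deltaWord θ w * deltaWord θ w' := by simp [deltaWord]

lemma deltaWord_concat (w : List (Fin n)) (j : Fin n) :
    deltaWord θ (w ++ [j]) = deltaWord θ w * delta θ j := by
  simp [deltaWord_append, deltaWord_cons, deltaWord_nil]

lemma exists_deltaPow_eq_deltaWord (α : Fin n → ℕ) :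
    ∃ w : List (Fin n), deltaPow θ α = deltaWord θ w := by
  have : ∀ L : List (Fin n), ∃ w, (L.map fun j => delta θ j ^ α j).prod = deltaWord θ w := by
    intro L
    induction L with
    | nil => exact ⟨[], rfl⟩
    | cons j L ih =>
      obtain ⟨w, hw⟩ := ih
      refine ⟨List.replicate (α j) j ++ w, ?_⟩
      rw [deltaWord_append, List.map_cons, List.prod_cons, hw]
      simp [deltaWord]
  obtain ⟨w, hw⟩ := this (List.finRange n)
  refine ⟨w, ?_⟩
  rw [← hw, deltaPow, List.ofFn_eq_map]

lemma deltaPow_zero : deltaPow θ 0 = 1 := by simp [deltaPow]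

lemma deltaPow_single_add (j : Fin n) (α : Fin n → ℕ) :
    deltaPow θ (Pi.single j 1 + α) = delta θ j * deltaPow θ α := by
  have h := prod_ofFn_mul_of_commute (fun i => delta θ i ^ (Pi.single j 1 : Fin n → ℕ) i)
    (fun i => delta θ i ^ α i) fun i k => ((delta_comm i k).pow_left _).pow_right _
  rw [deltaPow, deltaPow]
  simp only [Pi.add_apply, pow_add]
  rw [h, prod_ofFn_eq_single _ j fun i hi => by simp [hi]]
  simp

/-- Commutation of the derivations sorts the word. Together with the converse, this lets inductions
on words replace inductions on multi-orders without changing the family of semi-norms. -/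
lemma exists_deltaWord_eq_deltaPow (w : List (Fin n)) :
    ∃ α : Fin n → ℕ, deltaWord θ w = deltaPow θ α := by
  induction w with
  | nil => exact ⟨0, deltaPow_zero.symm⟩
  | cons j w ih =>
    obtain ⟨α, h⟩ := ih
    exact ⟨Pi.single j 1 + α, by rw [deltaPow_single_add, deltaWord_cons, h]⟩

/-! ### The Fréchet topology -/

lemma continuous_deltaWord (w : List (Fin n)) :
    Continuous fun u : SmoothTorus θ => toOp (deltaWord θ w u) := by
  obtain ⟨α, h⟩ := exists_deltaWord_eq_deltaPow (θ := θ) w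
  rw [h]
  exact continuous_deltaPowOp α

lemma isInducing_deltaPowOp :
    Topology.IsInducing (LinearMap.pi (deltaPowOp (θ := θ))) := ⟨rfl⟩

/-- A map into `𝒜_θ` is continuous if its composites with all words in the `δ_j` are. -/
lemma continuous_of_deltaWord {X : Type*} [TopologicalSpace X] {f : X → SmoothTorus θ}
    (h : ∀ w, Continuous fun x => toOp (deltaWord θ w (f x))) : Continuous f := by
  rw [isInducing_deltaPowOp.continuous_iff]
  refine continuous_pi fun α => ?_
  obtain ⟨w, hw⟩ := exists_deltaPow_eq_deltaWord (θ := θ) α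
  have := h w
  rw [← hw] at this
  exact this

lemma hasSum_of_deltaWord {ι : Type*} {f : ι → SmoothTorus θ} {v : SmoothTorus θ}
    (h : ∀ w, HasSum (fun i => toOp (deltaWord θ w (f i))) (toOp (deltaWord θ w v))) :
    HasSum f v := by
  rw [HasSum, isInducing_deltaPowOp.tendsto_nhds_iff, tendsto_pi_nhds]
  intro α
  obtain ⟨w, hw⟩ := exists_deltaPow_eq_deltaWord (θ := θ) α
  have := h w
  rw [← hw] at this
  refine this.congr fun s => ?_
  simp [deltaPowOp]

instance : T2Space (SmoothTorus θ) :=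
  T2Space.of_injective_continuous toOp_injective continuous_toOp

lemma continuous_delta (j : Fin n) : Continuous (delta θ j) :=
  continuous_of_deltaWord fun w => by
    have := continuous_deltaWord (θ := θ) (w ++ [j])
    rwa [deltaWord_concat] at this

lemma delta_U_mul (l j : Fin n) (u : SmoothTorus θ) :
    delta θ l (U θ j * u) = U θ j * delta θ l u + (if l = j then (1 : ℂ) else 0) • (U θ j * u) := by
  rw [delta_mul, ← Upow_single, delta_Upow, add_comm, smul_mul_assoc]
  congr 2
  by_cases h : l = j
  · subst h; simp
  · simp [h]

lemma continuous_mulU (j : Fin n) : Continuous (mulU θ j) := by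
  refine continuous_of_deltaWord fun w => ?_
  -- The induction needs an arbitrary continuous `u'` in place of `u`, because the Leibniz rule
  -- replaces `u'` by `δ_l u'`.
  have : ∀ w : List (Fin n), ∀ u' : SmoothTorus θ → SmoothTorus θ, Continuous u' →
      Continuous fun u => toOp (deltaWord θ w (U θ j * u' u)) := by
    intro w
    induction w using List.reverseRecOn with
    | nil =>
      intro u' hu'
      exact continuous_const.mul (continuous_toOp.comp hu')
    | append_singleton w l ih =>
      intro u' hu'
      simp only [deltaWord_concat, Module.End.mul_apply, delta_U_mul, map_add, map_smul]
      refine (ih _ ((continuous_delta l).comp hu')).add ?_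
      exact Continuous.const_smul (ih _ hu') (if l = j then (1 : ℂ) else 0)
  exact this w id continuous_id

/-! ### Absolutely convergent series in `𝒜_θ` -/

/-- All the semi-norms of the family are summable. -/
def AbsSummable {ι : Type*} (f : ι → SmoothTorus θ) : Prop :=
  ∀ w, Summable fun i => ‖toOp (deltaWord θ w (f i))‖

lemma AbsSummable.map_delta {ι : Type*} {f : ι → SmoothTorus θ} (hf : AbsSummable f) (j : Fin n) :
    AbsSummable fun i => delta θ j (f i) := fun w => by
  have := hf (w ++ [j])
  rwa [deltaWord_concat] at this

lemma AbsSummable.norm {ι : Type*} {f : ι → SmoothTorus θ} (hf : AbsSummable f) :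
    Summable fun i => ‖toOp (f i)‖ := hf []

/-! ### Termwise differentiation and convergence of series -/

/-- The linear map on `ℝⁿ` with given values on the standard basis. -/
def gradient {G : Type*} [NormedAddCommGroup G] [NormedSpace ℝ G] (n : ℕ) :
    (Fin n → G) →L[ℝ] RR n →L[ℝ] G :=
  ∑ j, (ContinuousLinearMap.smulRightL ℝ (RR n) G (EuclideanSpace.proj j)).comp
    (ContinuousLinearMap.proj (R := ℝ) (φ := fun _ : Fin n => G) j)

section Gradient

variable {G : Type*} [NormedAddCommGroup G] [NormedSpace ℝ G]

lemma gradient_apply (v : Fin n → G) (s : RR n) : gradient n v s = ∑ j, s j • v j := by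
  simp [gradient]

lemma gradient_single (v : Fin n → G) (j : Fin n) :
    gradient n v (EuclideanSpace.single j 1) = v j := by
  rw [gradient_apply, Finset.sum_eq_single j]
  · simp
  · intro i _ hi
    simp [hi]
  · simp

lemma gradient_eq (L : RR n →L[ℝ] G) :
    gradient n (fun j => L (EuclideanSpace.single j 1)) = L := by
  ext s
  have h := (EuclideanSpace.basisFun (Fin n) ℝ).sum_repr s
  rw [gradient_apply]
  conv_rhs => rw [← h]
  simp

lemma norm_gradient_le (v : Fin n → G) : ‖gradient n v‖ ≤ ∑ j, ‖v j‖ := by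
  refine ContinuousLinearMap.opNorm_le_bound _ (Finset.sum_nonneg fun _ _ => norm_nonneg _) ?_
  intro s
  rw [gradient_apply, Finset.sum_mul]
  refine norm_sum_le_of_le _ fun j _ => ?_
  rw [norm_smul, mul_comm]
  gcongr
  exact PiLp.norm_apply_le s j

/-- Termwise differentiation of a series of functions on `ℝⁿ`, whose iterated partial derivatives
are indexed by words. -/
lemma hasFDerivAt_tsum_words [CompleteSpace G] {ι : Type*} {F : List (Fin n) → ι → RR n → G}
    (hF : ∀ w i s, HasFDerivAt (F w i) (gradient n fun j => F (j :: w) i s) s)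
    {b : List (Fin n) → ι → ℝ} (hb : ∀ w, Summable (b w)) (hFb : ∀ w i s, ‖F w i s‖ ≤ b w i)
    (w : List (Fin n)) (s : RR n) :
    HasFDerivAt (fun s => ∑' i, F w i s) (gradient n fun j => ∑' i, F (j :: w) i s) s := by
  have h1 : ∀ w s, Summable fun i => F w i s := fun w s =>
    (hb w).of_norm_bounded fun i => hFb w i s
  have h2 : Summable fun i => ∑ j, b (j :: w) i := summable_sum fun j _ => hb (j :: w)
  have h3 := hasFDerivAt_tsum (x₀ := s) h2 (fun i x => hF w i x) (fun i x =>
    (norm_gradient_le _).trans (Finset.sum_le_sum fun j _ => hFb _ i x)) (h1 w s) s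
  have h4 : Summable fun i => (fun j => F (j :: w) i s) := Pi.summable.2 fun j => h1 _ s
  rw [← (gradient n).map_tsum h4] at h3
  refine h3.congr_fderiv ?_
  congr 1
  funext j
  rw [tsum_apply h4]

/-- Differentiation only lengthens the word, so the claim for all words at once is closed under
induction on the order. -/
lemma contDiff_tsum_words [CompleteSpace G] {ι : Type*} {F : List (Fin n) → ι → RR n → G}
    (hF : ∀ w i s, HasFDerivAt (F w i) (gradient n fun j => F (j :: w) i s) s)
    {b : List (Fin n) → ι → ℝ} (hb : ∀ w, Summable (b w)) (hFb : ∀ w i s, ‖F w i s‖ ≤ b w i)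
    (w : List (Fin n)) : ContDiff ℝ ∞ fun s => ∑' i, F w i s := by
  rw [contDiff_infty]
  intro m
  induction m generalizing w with
  | zero =>
    exact contDiff_zero.2 (continuous_iff_continuousAt.2 fun s =>
      (hasFDerivAt_tsum_words hF hb hFb w s).continuousAt)
  | succ m ih =>
    push_cast
    rw [contDiff_succ_iff_fderiv_apply]
    refine ⟨fun s => (hasFDerivAt_tsum_words hF hb hFb w s).differentiableAt, by simp, fun y => ?_⟩
    simp only [(hasFDerivAt_tsum_words hF hb hFb w _).fderiv, gradient_apply]
    exact ContDiff.sum fun j _ => (ih (j :: w)).const_smul _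

end Gradient

lemma hasFDerivAt_act (u : SmoothTorus θ) (s : RR n) :
    HasFDerivAt (fun s : RR n => act s (toOp u))
      (gradient n fun j => Complex.I • act s (toOp (delta θ j u))) s := by
  have h1 : HasFDerivAt (fun s : RR n => act s (toOp u))
      (fderiv ℝ (fun s : RR n => act s (toOp u)) s) s :=
    (u.2.2.differentiable (by simp) s).hasFDerivAt
  have h2 : ∀ j, Complex.I • act s (toOp (delta θ j u)) =
      fderiv ℝ (fun s : RR n => act s (toOp u)) s (EuclideanSpace.single j 1) := fun j =>
    (hasDerivAt_act u s j).unique (h1.hasLineDerivAt _)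
  simp only [h2]
  rwa [gradient_eq]

/-- The power of `i` compensates the factor `1/i` in each `δ_j`. -/
lemma AbsSummable.hasFDerivAt_words {ι : Type*} (f : ι → SmoothTorus θ) (w : List (Fin n)) (i : ι)
    (s : RR n) :
    HasFDerivAt (fun s => Complex.I ^ w.length • act s (toOp (deltaWord θ w (f i))))
      (gradient n fun j =>
        Complex.I ^ (j :: w).length • act s (toOp (deltaWord θ (j :: w) (f i)))) s := by
  have h := (hasFDerivAt_act (deltaWord θ w (f i)) s).const_smul (Complex.I ^ w.length)
  refine h.congr_fderiv ?_
  refine ContinuousLinearMap.ext fun v => ?_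
  rw [smul_apply, gradient_apply, gradient_apply, Finset.smul_sum]
  refine Finset.sum_congr rfl fun j _ => ?_
  rw [List.length_cons, pow_succ, mul_smul, smul_comm (Complex.I ^ _) (v j), deltaWord_cons]
  rfl

lemma AbsSummable.hasFDerivAt_tsum_act {ι : Type*} {f : ι → SmoothTorus θ} (hf : AbsSummable f)
    (s : RR n) : HasFDerivAt (fun s : RR n => ∑' i, act s (toOp (f i)))
      (gradient n fun j => ∑' i, Complex.I • act s (toOp (delta θ j (f i)))) s := by
  have h := hasFDerivAt_tsum_words (AbsSummable.hasFDerivAt_words f) hf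
    (fun w i s => by rw [norm_smul, norm_act]; simp) [] s
  simpa [deltaWord_nil, deltaWord_cons] using h

lemma AbsSummable.contDiff_tsum_act {ι : Type*} {f : ι → SmoothTorus θ} (hf : AbsSummable f) :
    ContDiff ℝ ∞ fun s : RR n => ∑' i, act s (toOp (f i)) := by
  have h := contDiff_tsum_words (AbsSummable.hasFDerivAt_words f) hf
    (fun w i s => by rw [norm_smul, norm_act]; simp) []
  simpa [deltaWord_nil] using h

/-- Completeness of `𝒜_θ` in the form needed. The norm sum lies in the closed algebra `A_θ`;
termwise differentiation shows that its orbit is smooth and that `δ_j` of the sum is the sum of the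
`δ_j`, so the series converges in every semi-norm. -/
lemma AbsSummable.exists_hasSum {ι : Type*} {f : ι → SmoothTorus θ} (hf : AbsSummable f) :
    ∃ v, HasSum f v := by
  have hs : ∀ {f : ι → SmoothTorus θ}, AbsSummable f → Summable fun i => toOp (f i) :=
    fun hf => Summable.of_norm hf.norm
  have hact : ∀ {f : ι → SmoothTorus θ} (hf : AbsSummable f) (s : RR n),
      act s (∑' i, toOp (f i)) = ∑' i, act s (toOp (f i)) := fun hf s =>
    (actL s).map_tsum (hs hf)
  have hmem : ∀ {f : ι → SmoothTorus θ}, AbsSummable f →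
      (∑' i, toOp (f i)) ∈ smoothSubalgebra θ := by
    intro f hf
    refine ⟨?_, ?_⟩
    · refine (StarSubalgebra.isClosed_topologicalClosure _).mem_of_tendsto (hs hf).hasSum ?_
      exact Eventually.of_forall fun s => sum_mem fun i _ => (f i).2.1
    · simp only [hact hf]
      exact hf.contDiff_tsum_act
  let S : (f : ι → SmoothTorus θ) → AbsSummable f → SmoothTorus θ :=
    fun f hf => ⟨∑' i, toOp (f i), hmem hf⟩
  have hdelta : ∀ (f : ι → SmoothTorus θ) (hf : AbsSummable f) (j : Fin n),
      delta θ j (S f hf) = S _ (hf.map_delta j) := by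
    intro f hf j
    refine toOp_injective (toOp_delta_of_hasDerivAt ?_)
    have h := (hf.hasFDerivAt_tsum_act 0).hasLineDerivAt (EuclideanSpace.single j (1 : ℝ))
    have hS : ∀ t : ℝ, act (t • EuclideanSpace.single j (1 : ℝ)) (toOp (S f hf)) =
        ∑' i, act (0 + t • EuclideanSpace.single j (1 : ℝ) : RR n) (toOp (f i)) := fun t => by
      rw [zero_add]
      exact hact hf _
    simp only [hS]
    rw [gradient_single] at h
    simp only [act_zero, tsum_const_smul''] at h
    exact h
  have hword : ∀ (w : List (Fin n)) (f : ι → SmoothTorus θ) (hf : AbsSummable f),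
      HasSum (fun i => toOp (deltaWord θ w (f i))) (toOp (deltaWord θ w (S f hf))) := by
    intro w
    induction w using List.reverseRecOn with
    | nil => exact fun f hf => (hs hf).hasSum
    | append_singleton w j ih =>
      intro f hf
      simp only [deltaWord_concat, Module.End.mul_apply, hdelta]
      exact ih _ (hf.map_delta j)
  exact ⟨S f hf, hasSum_of_deltaWord fun w => hword w f hf⟩

/-! ### Averages over the periods of the action -/

lemma continuous_toTorus : Continuous (toTorus : (Fin n → ℝ) → UnitAddTorus (Fin n)) :=
  continuous_pi fun l => (AddCircle.continuous_mk' 1).comp (continuous_apply l)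

lemma continuous_translate {X : Type*} [TopologicalSpace X] {a : X → UnitAddTorus (Fin n)}
    {f : X → L2 n} (ha : Continuous a) (hf : Continuous f) :
    Continuous fun x => translate (a x) (f x) := by
  let g : X → C(UnitAddTorus (Fin n), UnitAddTorus (Fin n)) := fun x =>
    ⟨fun y => y + a x, by fun_prop⟩
  have hg : Continuous g := ContinuousMap.continuous_of_continuous_uncurry _ (by
    change Continuous fun p : X × UnitAddTorus (Fin n) => p.2 + a p.1
    fun_prop)
  exact hf.compMeasurePreservingLp hg (fun x => measurePreserving_translate (a x)) (by simp)

lemma translate_symm (a : UnitAddTorus (Fin n)) (f : L2 n) :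
    (translate a).symm f = translate (-a) f := rfl

lemma act_apply (s : RR n) (T : Op n) (f : L2 n) :
    act s T f = translate (toTorus fun l => s l / (2 * Real.pi))
      (T ((translate (toTorus fun l => s l / (2 * Real.pi))).symm f)) := by
  simp only [act, LinearIsometryEquiv.conjStarAlgEquiv_apply_apply]

/-- The vector of `ℝⁿ` along the `j`-th coordinate axis whose length is one period. -/
def periodVec (j : Fin n) : RR n := EuclideanSpace.single j (2 * Real.pi)

/-- For a general bounded `T` the orbit is only strongly continuous, which is why averages are first
formed vector by vector. Having them on all bounded operators gives the bounded extension used later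
in the density argument. -/
lemma continuous_act_apply (j : Fin n) (T : Op n) (f : L2 n) :
    Continuous fun s : ℝ => act (s • periodVec j) T f := by
  have ha : Continuous fun s : ℝ =>
      (toTorus fun l => (s • periodVec j : RR n) l / (2 * Real.pi) : UnitAddTorus (Fin n)) :=
    continuous_toTorus.comp (by fun_prop)
  simp only [act_apply, translate_symm]
  exact continuous_translate ha (T.continuous.comp (continuous_translate ha.neg continuous_const))

lemma norm_act_apply_le (s : RR n) (T : Op n) (f : L2 n) : ‖act s T f‖ ≤ ‖T‖ * ‖f‖ := by
  rw [← norm_act s T]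
  exact (act s T).le_opNorm f

/-- The weighted average `f ↦ ∫₀¹ s^m α_{s p_j}(T) f ds`, where `p_j` is the `j`-th period. -/
def avgFun (m : ℕ) (j : Fin n) (T : Op n) (f : L2 n) : L2 n :=
  ∫ s in (0 : ℝ)..1, (s : ℂ) ^ m • act (s • periodVec j) T f

lemma continuous_avg_integrand (m : ℕ) (j : Fin n) (T : Op n) (f : L2 n) :
    Continuous fun s : ℝ => (s : ℂ) ^ m • act (s • periodVec j) T f :=
  (Complex.continuous_ofReal.pow m).smul (continuous_act_apply j T f)

lemma intervalIntegrable_avg (m : ℕ) (j : Fin n) (T : Op n) (f : L2 n) :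
    IntervalIntegrable (fun s : ℝ => (s : ℂ) ^ m • act (s • periodVec j) T f) volume 0 1 :=
  (continuous_avg_integrand m j T f).intervalIntegrable _ _

lemma norm_avgFun_le (m : ℕ) (j : Fin n) (T : Op n) (f : L2 n) :
    ‖avgFun m j T f‖ ≤ ‖T‖ * ‖f‖ := by
  have h := intervalIntegral.norm_integral_le_of_norm_le_const (a := (0 : ℝ)) (b := 1)
    (f := fun s : ℝ => (s : ℂ) ^ m • act (s • periodVec j) T f) (C := ‖T‖ * ‖f‖) fun s hs => by
      rw [Set.uIoc_of_le zero_le_one] at hs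
      rw [norm_smul, norm_pow, Complex.norm_real, Real.norm_of_nonneg hs.1.le]
      exact (mul_le_of_le_one_left (norm_nonneg _) (pow_le_one₀ hs.1.le hs.2)).trans
        (norm_act_apply_le _ _ _)
  rw [avgFun]
  simpa using h

/-- The weighted average `T ↦ ∫₀¹ s^m α_{s p_j}(T) ds`, as a bounded map on bounded operators. -/
def avgOp (m : ℕ) (j : Fin n) : Op n →L[ℂ] Op n :=
  LinearMap.mkContinuous₂ (LinearMap.mk₂ ℂ (avgFun m j)
    (fun T T' f => by
      simp only [avgFun, map_add, add_apply, smul_add]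
      exact intervalIntegral.integral_add (intervalIntegrable_avg m j T f)
        (intervalIntegrable_avg m j T' f))
    (fun c T f => by
      simp only [avgFun, map_smul, smul_apply, smul_comm _ c]
      exact intervalIntegral.integral_smul c _)
    (fun T f f' => by
      simp only [avgFun, map_add, smul_add]
      exact intervalIntegral.integral_add (intervalIntegrable_avg m j T f)
        (intervalIntegrable_avg m j T f'))
    (fun c T f => by
      simp only [avgFun, map_smul, smul_comm _ c]
      exact intervalIntegral.integral_smul c _)) 1 fun T f => by
    rw [one_mul]
    exact norm_avgFun_le m j T f

lemma avgOp_apply (m : ℕ) (j : Fin n) (T : Op n) (f : L2 n) :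
    avgOp m j T f = ∫ s in (0 : ℝ)..1, (s : ℂ) ^ m • act (s • periodVec j) T f := rfl

lemma act_avgOp (m : ℕ) (j : Fin n) (t : RR n) (T : Op n) :
    act t (avgOp m j T) = avgOp m j (act t T) := by
  refine ContinuousLinearMap.ext fun f => ?_
  rw [act_apply, avgOp_apply, avgOp_apply]
  set a := toTorus fun l => t l / (2 * Real.pi)
  have h := ContinuousLinearMap.intervalIntegral_comp_comm
    (translate a).toContinuousLinearEquiv.toContinuousLinearMap
    (intervalIntegrable_avg m j T ((translate a).symm f))
  refine h.symm.trans ?_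
  congr 1
  funext s
  change translate a ((s : ℂ) ^ m • act (s • periodVec j) T ((translate a).symm f)) = _
  rw [map_smul, ← act_apply, act_act, act_act, add_comm]

lemma continuous_act (u : SmoothTorus θ) : Continuous fun s : RR n => act s (toOp u) :=
  u.2.2.continuous

lemma continuous_avg_integrand_op (m : ℕ) (j : Fin n) (u : SmoothTorus θ) :
    Continuous fun s : ℝ => (s : ℂ) ^ m • act (s • periodVec j) (toOp u) :=
  (Complex.continuous_ofReal.pow m).smul ((continuous_act u).comp (by fun_prop))

/-- For smooth `u` the orbit is norm continuous, so the vectorwise integral is an integral of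
operators. -/
lemma avgOp_toOp (m : ℕ) (j : Fin n) (u : SmoothTorus θ) :
    avgOp m j (toOp u) = ∫ s in (0 : ℝ)..1, (s : ℂ) ^ m • act (s • periodVec j) (toOp u) := by
  refine ContinuousLinearMap.ext fun f => ?_
  rw [avgOp_apply, ContinuousLinearMap.intervalIntegral_apply
    ((continuous_avg_integrand_op m j u).intervalIntegrable _ _)]
  rfl

/-- The integral over a probability space stays in the closed convex set `A_θ`; smoothness survives
because the average is a bounded map commuting with the action. -/
lemma avgOp_mem (m : ℕ) (j : Fin n) (u : SmoothTorus θ) :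
    avgOp m j (toOp u) ∈ smoothSubalgebra θ := by
  refine ⟨?_, ?_⟩
  · rw [avgOp_toOp, intervalIntegral.integral_of_le zero_le_one]
    have : IsProbabilityMeasure (volume.restrict (Set.Ioc (0 : ℝ) 1)) := ⟨by simp⟩
    refine Convex.integral_mem (s := (cstarTorus θ : Set (Op n))) ?_
      (StarSubalgebra.isClosed_topologicalClosure _) ?_ ?_
    · intro x hx y hy a b _ _ _
      have h := add_mem ((cstarTorus θ).smul_mem hx (a : ℂ)) ((cstarTorus θ).smul_mem hy (b : ℂ))
      rwa [Complex.coe_smul, Complex.coe_smul] at h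
    · exact Eventually.of_forall fun s => (cstarTorus θ).smul_mem (act_mem θ _ u.2.1) _
    · exact ((continuous_avg_integrand_op m j u).intervalIntegrable 0 1).1
  · simp only [act_avgOp]
    exact ((avgOp m j).restrictScalars ℝ).contDiff.comp u.2.2

/-- The weighted average `u ↦ ∫₀¹ s^m α_{s p_j}(u) ds` on `𝒜_θ`. -/
def avg (θ : Matrix (Fin n) (Fin n) ℝ) (m : ℕ) (j : Fin n) : Module.End ℂ (SmoothTorus θ) where
  toFun u := ⟨avgOp m j (toOp u), avgOp_mem m j u⟩
  map_add' u v := Subtype.ext (by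
    change avgOp m j (toOp (u + v)) = avgOp m j (toOp u) + avgOp m j (toOp v)
    simp)
  map_smul' c u := Subtype.ext (by
    change avgOp m j (toOp (c • u)) = c • avgOp m j (toOp u)
    simp)

lemma toOp_avg (m : ℕ) (j : Fin n) (u : SmoothTorus θ) :
    toOp (avg θ m j u) = avgOp m j (toOp u) := rfl

lemma hasDerivAt_clm_apply {G : Type*} [NormedAddCommGroup G] [NormedSpace ℂ G] (B : G →L[ℂ] G)
    {f : ℝ → G} {f' : G} {x : ℝ} (hf : HasDerivAt f (Complex.I • f') x) :
    HasDerivAt (fun t => B (f t)) (Complex.I • B f') x := by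
  have h := (B.restrictScalars ℝ).hasFDerivAt.comp_hasDerivAt x hf
  rw [← map_smul]
  exact h

lemma avg_delta_comm (m : ℕ) (j l : Fin n) : Commute (avg θ m j) (delta θ l) := by
  refine LinearMap.ext fun u => ?_
  have h := hasDerivAt_act u 0 l
  simp only [zero_add, act_zero] at h
  have h' := hasDerivAt_clm_apply (avgOp m j) h
  simp only [← act_avgOp] at h'
  have key : toOp (delta θ l (avg θ m j u)) = avgOp m j (toOp (delta θ l u)) :=
    toOp_delta_of_hasDerivAt h'
  rw [Module.End.mul_apply, Module.End.mul_apply]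
  exact (toOp_injective key).symm

lemma hasDerivAt_comp_affine {G : Type*} [NormedAddCommGroup G] [NormedSpace ℂ G]
    {f : ℝ → G} {f' : G} (hf : HasDerivAt f f' 0) (s c : ℝ) :
    HasDerivAt (fun t => f ((t - s) * c)) ((c : ℂ) • f') s := by
  have h2 : HasDerivAt (fun t : ℝ => (t - s) * c) c s := by
    simpa using ((hasDerivAt_id s).sub_const s).mul_const c
  rw [Complex.coe_smul]
  exact HasDerivAt.scomp_of_eq s hf h2 (by simp)

lemma hasDerivAt_act_period (u : SmoothTorus θ) (j : Fin n) (s : ℝ) :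
    HasDerivAt (fun s : ℝ => act (s • periodVec j) (toOp u))
      ((2 * Real.pi * Complex.I) • act (s • periodVec j) (toOp (delta θ j u))) s := by
  have h := hasDerivAt_comp_affine (hasDerivAt_act u (s • periodVec j) j) s (2 * Real.pi)
  have hp : ∀ t : ℝ, s • periodVec j + ((t - s) * (2 * Real.pi)) •
      EuclideanSpace.single j (1 : ℝ) = t • periodVec j := by
    intro t
    have hp : periodVec j = (2 * Real.pi) • EuclideanSpace.single j (1 : ℝ) := by
      ext i
      by_cases hi : i = j <;> simp [periodVec, hi]
    rw [hp, mul_smul (t - s), sub_smul, add_sub_cancel]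
  simp only [hp] at h
  rw [mul_smul]
  push_cast at h
  exact h

lemma continuous_act_period (u : SmoothTorus θ) (j : Fin n) :
    Continuous fun s : ℝ => act (s • periodVec j) (toOp u) :=
  (continuous_act u).comp (continuous_id.smul continuous_const)

/-- Integration by parts against the weight `s`, whose boundary term at `0` vanishes. -/
lemma integral_smul_deriv_unit {G : Type*} [NormedAddCommGroup G] [NormedSpace ℂ G]
    [CompleteSpace G] {v v' : ℝ → G} (hv : ∀ s, HasDerivAt v (v' s) s) (hv' : Continuous v') :
    ∫ s in (0 : ℝ)..1, (s : ℂ) • v' s = v 1 - ∫ s in (0 : ℝ)..1, v s := by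
  have h := intervalIntegral.integral_smul_deriv_eq_deriv_smul_of_hasDerivAt
    (a := (0 : ℝ)) (b := 1) (u := fun s : ℝ => s) (u' := fun _ => 1) (v := v) (v' := v')
    (by fun_prop) (fun s _ => (hv s).continuousAt.continuousWithinAt)
    (fun s _ => hasDerivAt_id s) (fun s _ => hv s) (by simp) (hv'.intervalIntegrable _ _)
  simpa using h

/-- An element of `𝒜_θ` differs from its average over the `j`-th period by an element of the
range of `δ_j`. -/
lemma delta_avg_one (j : Fin n) (u : SmoothTorus θ) :
    delta θ j ((2 * Real.pi * Complex.I) • avg θ 1 j u) = u - avg θ 0 j u := by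
  rw [map_smul]
  have hc : delta θ j (avg θ 1 j u) = avg θ 1 j (delta θ j u) :=
    (DFunLike.congr_fun (avg_delta_comm 1 j j) u).symm
  rw [hc]
  refine toOp_injective ?_
  rw [map_smul, map_sub, toOp_avg, toOp_avg, avgOp_toOp, avgOp_toOp]
  -- The orbit along the `j`-th period has derivative `2πi α(δ_j u)`. The boundary term at `s = 1`
  -- is a full period, hence `u` itself, and the remaining integral is the plain average.
  have h := integral_smul_deriv_unit (hasDerivAt_act_period u j)
    (Continuous.const_smul (continuous_act_period (delta θ j u) j) (2 * Real.pi * Complex.I))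
  have h1 : act ((1 : ℝ) • periodVec j) (toOp u) = toOp u := by
    rw [one_smul]
    exact act_period j _
  rw [h1] at h
  rw [← intervalIntegral.integral_smul]
  simp only [pow_one, pow_zero, one_smul]
  refine Eq.trans ?_ h
  congr 1
  funext s
  rw [smul_comm]

/-! ### Decomposition of an element into derivatives and its trace -/

/-- Linear maps on `𝒜_θ` that commute with the derivations and are bounded in norm. -/
def IsInvariantBounded (A : Module.End ℂ (SmoothTorus θ)) : Prop :=
  (∃ B : Op n →L[ℂ] Op n, ∀ u, toOp (A u) = B (toOp u)) ∧ ∀ l, Commute A (delta θ l)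

lemma isInvariantBounded_avg (m : ℕ) (j : Fin n) : IsInvariantBounded (avg θ m j) :=
  ⟨⟨avgOp m j, fun _ => rfl⟩, avg_delta_comm m j⟩

lemma IsInvariantBounded.mul {A A' : Module.End ℂ (SmoothTorus θ)} (h : IsInvariantBounded A)
    (h' : IsInvariantBounded A') : IsInvariantBounded (A * A') := by
  obtain ⟨⟨B, hB⟩, hc⟩ := h
  obtain ⟨⟨B', hB'⟩, hc'⟩ := h'
  exact ⟨⟨B.comp B', fun u => by simp [hB, hB']⟩, fun l => (hc l).mul_left (hc' l)⟩

lemma IsInvariantBounded.add {A A' : Module.End ℂ (SmoothTorus θ)} (h : IsInvariantBounded A)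
    (h' : IsInvariantBounded A') : IsInvariantBounded (A + A') := by
  obtain ⟨⟨B, hB⟩, hc⟩ := h
  obtain ⟨⟨B', hB'⟩, hc'⟩ := h'
  exact ⟨⟨B + B', fun u => by simp [hB, hB']⟩, fun l => (hc l).add_left (hc' l)⟩

lemma IsInvariantBounded.smul {A : Module.End ℂ (SmoothTorus θ)} (h : IsInvariantBounded A)
    (c : ℂ) : IsInvariantBounded (c • A) := by
  obtain ⟨⟨B, hB⟩, hc⟩ := h
  exact ⟨⟨c • B, fun u => by simp [hB]⟩, fun l => (hc l).smul_left c⟩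

lemma isInvariantBounded_zero : IsInvariantBounded (0 : Module.End ℂ (SmoothTorus θ)) :=
  ⟨⟨0, fun _ => by simp⟩, fun _ => Commute.zero_left _⟩

lemma isInvariantBounded_one : IsInvariantBounded (1 : Module.End ℂ (SmoothTorus θ)) :=
  ⟨⟨ContinuousLinearMap.id ℂ _, fun _ => rfl⟩, fun _ => Commute.one_left _⟩

lemma isInvariantBounded_prod_avg (L : List (Fin n)) :
    IsInvariantBounded (L.map (avg θ 0)).prod := by
  induction L with
  | nil => exact isInvariantBounded_one
  | cons j L ih => simpa using (isInvariantBounded_avg 0 j).mul ih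

lemma IsInvariantBounded.deltaWord {A : Module.End ℂ (SmoothTorus θ)} (h : IsInvariantBounded A)
    (w : List (Fin n)) : Commute A (NCTorus.deltaWord θ w) :=
  Commute.list_prod_right _ _ fun x hx => by
    obtain ⟨k, _, rfl⟩ := List.mem_map.1 hx
    exact h.2 k

/-- One bounded `B` serves for every `δ^α`; hence such an `A` maps classical symbols to classical
symbols of the same order. -/
lemma IsInvariantBounded.deltaPowOp {A : Module.End ℂ (SmoothTorus θ)}
    (h : IsInvariantBounded A) :
    ∃ B : Op n →L[ℂ] Op n, ∀ α u, NCTorus.deltaPowOp α (A u) = B (NCTorus.deltaPowOp α u) := by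
  obtain ⟨B, hB⟩ := h.1
  refine ⟨B, fun α u => ?_⟩
  obtain ⟨w, hw⟩ := exists_deltaPow_eq_deltaWord (θ := θ) α
  rw [NCTorus.deltaPowOp, hw, LinearMap.comp_apply, LinearMap.comp_apply, ← hB]
  congr 1
  exact (DFunLike.congr_fun (h.deltaWord w) u).symm

/-- Telescoping: with `v` the average of `u` over the tail and `E_j` the average over the head, `u -
E_j v = (u - v) + (v - E_j v)`, and the last bracket is in the range of `δ_j` by `delta_avg_one`. -/
lemma sub_prod_avg_eq (L : List (Fin n)) : ∃ A : Fin n → Module.End ℂ (SmoothTorus θ),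
    (∀ j, IsInvariantBounded (A j)) ∧
      ∀ u, u - (L.map (avg θ 0)).prod u = ∑ j, delta θ j (A j u) := by
  induction L with
  | nil => exact ⟨0, fun j => isInvariantBounded_zero, fun u => by simp⟩
  | cons j L ih =>
    obtain ⟨A, hA, h⟩ := ih
    refine ⟨fun i => A i + if i = j then
      (2 * Real.pi * Complex.I : ℂ) • (avg θ 1 j * (L.map (avg θ 0)).prod) else 0,
      fun i => (hA i).add ?_, fun u => ?_⟩
    · split_ifs
      · exact ((isInvariantBounded_avg 1 j).mul (isInvariantBounded_prod_avg L)).smul _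
      · exact isInvariantBounded_zero
    · simp only [LinearMap.add_apply, map_add, Finset.sum_add_distrib, ← h u]
      rw [Finset.sum_eq_single j]
      · simp only [if_true, LinearMap.smul_apply, Module.End.mul_apply, delta_avg_one,
          List.map_cons, List.prod_cons]
        abel
      · intro i _ hi
        simp [hi]
      · simp

lemma avgOp_zero_Upow (j : Fin n) (k : Fin n → ℤ) :
    avgOp 0 j (toOp (Upow θ k : SmoothTorus θ)) =
      (if k j = 0 then (1 : ℂ) else 0) • toOp (Upow θ k : SmoothTorus θ) := by
  have hp : ∀ s : ℝ, phase k (s • periodVec j) =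
      Complex.exp ((2 * Real.pi * k j * Complex.I) * s) := by
    intro s
    have : (∑ i, (k i : ℝ) * (s • periodVec j : RR n) i) = k j * (s * (2 * Real.pi)) := by
      rw [Finset.sum_eq_single j]
      · simp [periodVec]
      · intro i _ hi
        simp [periodVec, hi]
      · simp
    rw [phase, this]
    push_cast
    ring_nf
  rw [avgOp_toOp]
  simp only [act_Upow, pow_zero, one_smul, hp]
  rw [intervalIntegral.integral_smul_const]
  congr 1
  split_ifs with hk
  · simp [hk]
  · have hc : (2 * Real.pi * k j * Complex.I : ℂ) ≠ 0 := by
      simp [hk, Real.pi_ne_zero]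
    rw [integral_exp_mul_complex hc]
    have : Complex.exp (2 * Real.pi * k j * Complex.I * (1 : ℝ)) = 1 := by
      rw [Complex.exp_eq_one_iff]
      exact ⟨k j, by push_cast; ring⟩
    rw [this]
    simp

/-- Both sides come from bounded maps on operators. They agree on monomials, since averaging in the
direction `j` kills `U^k` unless `k_j = 0`, and the monomials span a dense subspace of `A_θ`. -/
lemma prod_avg_finRange (u : SmoothTorus θ) :
    ((List.finRange n).map (avg θ 0)).prod u = tau u • 1 := by
  have h1 : ∀ L : List (Fin n), ∃ B : Op n →L[ℂ] Op n,
      (∀ u : SmoothTorus θ, toOp ((L.map (avg θ 0)).prod u) = B (toOp u)) ∧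
      ∀ k : Fin n → ℤ, B (toOp (Upow θ k : SmoothTorus θ)) =
        (if ∀ j ∈ L, k j = 0 then (1 : ℂ) else 0) • toOp (Upow θ k : SmoothTorus θ) := by
    intro L
    induction L with
    | nil => exact ⟨ContinuousLinearMap.id ℂ _, fun u => rfl, fun k => by simp⟩
    | cons j L ih =>
      obtain ⟨B, hB, hk⟩ := ih
      refine ⟨(avgOp 0 j).comp B, fun u => ?_, fun k => ?_⟩
      · rw [List.map_cons, List.prod_cons, Module.End.mul_apply, toOp_avg, hB]
        rfl
      · rw [ContinuousLinearMap.comp_apply, hk, map_smul, avgOp_zero_Upow, smul_smul]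
        congr 1
        by_cases h1 : k j = 0 <;> by_cases h2 : ∀ i ∈ L, k i = 0 <;> simp [h1, h2]
  obtain ⟨B, hB, hk⟩ := h1 (List.finRange n)
  refine toOp_injective ?_
  rw [hB, map_smul, toOp_one]
  let R : Op n →L[ℂ] Op n := (tauOp n).smulRight 1
  have hspan : ∀ T ∈ Submodule.span ℂ (Set.range fun k => toOp (Upow θ k : SmoothTorus θ)),
      B T = R T := by
    intro T hT
    induction hT using Submodule.span_induction with
    | mem T hT =>
      obtain ⟨k, rfl⟩ := hT
      have hR : R (toOp (Upow θ k : SmoothTorus θ)) =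
        tau (Upow θ k : SmoothTorus θ) • (1 : Op n) := rfl
      simp only [hk, hR, tau_Upow]
      by_cases h : k = 0
      · subst h
        simp [Upow_zero, toOp_one]
      · have : ¬ ∀ j ∈ List.finRange n, k j = 0 := fun h' => h (funext fun j => h' j (by simp))
        rw [if_neg this, if_neg h, zero_smul, zero_smul]
    | zero => simp
    | add x y _ _ hx hy => rw [map_add, map_add, hx, hy]
    | smul c x _ hx => rw [map_smul, map_smul, hx]
  have := closure_minimal (t := {T | B T = R T}) hspan
    (isClosed_eq B.continuous R.continuous) (cstarTorus_le_closure_span _ u.2.1)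
  exact this

/-- Every element of `𝒜_θ` is the sum of its trace and of derivatives. -/
lemma exists_sum_delta_add_tau (θ : Matrix (Fin n) (Fin n) ℝ) :
    ∃ A : Fin n → Module.End ℂ (SmoothTorus θ), (∀ j, IsInvariantBounded (A j)) ∧
      ∀ u, u = ∑ j, delta θ j (A j u) + tau u • 1 := by
  obtain ⟨A, hA, h⟩ := sub_prod_avg_eq (θ := θ) (List.finRange n)
  refine ⟨A, hA, fun u => ?_⟩
  rw [← h, prod_avg_finRange, sub_add_cancel]

/-! ### Fourier coefficients -/

lemma tau_add (u v : SmoothTorus θ) : tau (u + v) = tau u + tau v := by simp [tau]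

lemma tau_smul (c : ℂ) (u : SmoothTorus θ) : tau (c • u) = c * tau u := by simp [tau]

/-- `τ` is constant along the orbits of the action. -/
lemma tau_delta (j : Fin n) (u : SmoothTorus θ) : tau (delta θ j u) = 0 := by
  have h := hasDerivAt_act u 0 j
  simp only [zero_add, act_zero] at h
  have h2 := ((tauOp n).restrictScalars ℝ).hasFDerivAt.comp_hasDerivAt (0 : ℝ) h
  have h3 : (((tauOp n).restrictScalars ℝ) ∘ fun t : ℝ =>
      act (t • EuclideanSpace.single j (1 : ℝ)) (toOp u)) = fun _ => tauOp n (toOp u) :=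
    funext fun t => tauOp_act _ _
  rw [h3] at h2
  have h4 := h2.unique (hasDerivAt_const (0 : ℝ) _)
  change tauOp n (Complex.I • toOp (delta θ j u)) = 0 at h4
  rw [map_smul, smul_eq_mul] at h4
  exact (mul_eq_zero.1 h4).resolve_left Complex.I_ne_zero

lemma delta_one (j : Fin n) : delta θ j 1 = 0 := by
  have h := delta_Upow (θ := θ) j 0
  rw [Upow_zero] at h
  simpa using h

/-- Obtained by applying `δ_j` to `U^k (U^k)^* = 1`. -/
lemma delta_star_Upow (j : Fin n) (k : Fin n → ℤ) :
    delta θ j (star (Upow θ k : SmoothTorus θ)) = -(k j : ℂ) • star (Upow θ k : SmoothTorus θ) := by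
  have h := delta_mul (θ := θ) j (Upow θ k) (star (Upow θ k : SmoothTorus θ))
  rw [Unitary.mul_star_self_of_mem (Upow θ k).2, delta_one, delta_Upow, smul_mul_assoc,
    Unitary.mul_star_self_of_mem (Upow θ k).2] at h
  have h2 := congrArg (fun x => star (Upow θ k : SmoothTorus θ) * x) h
  simp only [mul_add, ← mul_assoc, Unitary.star_mul_self_of_mem (Upow θ k).2, one_mul, mul_zero,
    mul_smul_comm, mul_one] at h2
  rw [neg_smul]
  exact eq_neg_of_add_eq_zero_right h2.symm

/-- Integration by parts: `τ` kills `δ_j(u (U^k)^*)`. -/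
lemma fourierCoeff_delta (j : Fin n) (u : SmoothTorus θ) (k : Fin n → ℤ) :
    fourierCoeff (delta θ j u) k = k j * fourierCoeff u k := by
  have h := tau_delta (θ := θ) j (u * star (Upow θ k : SmoothTorus θ))
  rw [delta_mul, delta_star_Upow, tau_add, mul_smul_comm, tau_smul] at h
  rw [fourierCoeff, fourierCoeff]
  linear_combination h

lemma norm_toOp_mul_unitary (u : SmoothTorus θ) (v : unitary (SmoothTorus θ)) :
    ‖toOp (u * (v : SmoothTorus θ))‖ = ‖toOp u‖ := by
  have hv : toOp (v : SmoothTorus θ) ∈ unitary (Op n) := by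
    refine ⟨?_, ?_⟩
    · rw [← toOp_star, ← toOp_mul, Unitary.star_mul_self_of_mem v.2, toOp_one]
    · rw [← toOp_star, ← toOp_mul, Unitary.mul_star_self_of_mem v.2, toOp_one]
  rw [toOp_mul]
  exact CStarRing.norm_mul_mem_unitary _ hv

lemma norm_tau_le (u : SmoothTorus θ) : ‖tau u‖ ≤ ‖toOp u‖ := by
  rw [tau, tauOp_apply]
  refine (norm_inner_le_norm _ _).trans ?_
  rw [norm_oneL2, one_mul]
  simpa [norm_oneL2] using (toOp u).le_opNorm (oneL2 n)

lemma norm_fourierCoeff_le (u : SmoothTorus θ) (k : Fin n → ℤ) :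
    ‖fourierCoeff u k‖ ≤ ‖toOp u‖ := by
  rw [← norm_toOp_mul_unitary u (star (Upow θ k)), Unitary.coe_star]
  exact norm_tau_le _

/-- If `l_j ≠ k_j`, computing the coefficient of `δ_j(U^l)` in two ways multiplies the coefficient
of `U^l` by `l_j` and by `k_j`, so it vanishes. -/
lemma fourierCoeff_Upow (l k : Fin n → ℤ) :
    fourierCoeff (Upow θ l : SmoothTorus θ) k = if l = k then 1 else 0 := by
  split_ifs with h
  · subst h
    rw [fourierCoeff, Unitary.mul_star_self_of_mem (Upow θ l).2]
    exact tauOp_one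
  · obtain ⟨j, hj⟩ := Function.ne_iff.1 h
    have h1 := fourierCoeff_delta j (Upow θ l : SmoothTorus θ) k
    rw [delta_Upow] at h1
    have h2 : fourierCoeff ((l j : ℂ) • (Upow θ l : SmoothTorus θ)) k =
        l j * fourierCoeff (Upow θ l : SmoothTorus θ) k := by
      rw [fourierCoeff, smul_mul_assoc, tau_smul]
      rfl
    rw [h2] at h1
    have h3 : ((l j : ℂ) - k j) ≠ 0 := by
      rw [sub_ne_zero]
      exact_mod_cast hj
    exact (mul_eq_zero.1 (by linear_combination h1 :
      ((l j : ℂ) - k j) * fourierCoeff (Upow θ l : SmoothTorus θ) k = 0)).resolve_left h3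

lemma delta_star_U (l j : Fin n) : delta θ l (star (U θ j : SmoothTorus θ)) =
    -(if l = j then (1 : ℂ) else 0) • star (U θ j : SmoothTorus θ) := by
  have h := delta_star_Upow (θ := θ) l (Pi.single j 1)
  rw [Upow_single] at h
  rw [h]
  by_cases hl : l = j
  · subst hl; simp
  · simp [hl]

/-- The only instance of the trace property that is needed. Conjugation by `U_l` commutes with every
`δ_j`, so in the decomposition of `u` only the scalar part contributes to the trace. -/
lemma tau_conj_U (l : Fin n) (u : SmoothTorus θ) :
    tau ((U θ l : SmoothTorus θ) * u * star (U θ l : SmoothTorus θ)) = tau u := by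
  obtain ⟨A, _, h⟩ := exists_sum_delta_add_tau θ
  have hd : ∀ j v, U θ l * delta θ j v * star (U θ l : SmoothTorus θ) =
      delta θ j (U θ l * v * star (U θ l : SmoothTorus θ)) := by
    intro j v
    rw [delta_mul, delta_U_mul, delta_star_U, add_mul, mul_smul_comm, smul_mul_assoc, neg_smul]
    abel
  have h1 : U θ l * u * star (U θ l : SmoothTorus θ) =
      ∑ j, delta θ j (U θ l * A j u * star (U θ l : SmoothTorus θ)) + tau u • 1 := by
    conv_lhs => rw [h u]
    rw [mul_add, add_mul, Finset.mul_sum, Finset.sum_mul, mul_smul_comm, mul_one, smul_mul_assoc,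
      Unitary.mul_star_self_of_mem (U θ l).2]
    simp only [hd]
  have hsum : tau (∑ j, delta θ j (U θ l * A j u * star (U θ l : SmoothTorus θ))) = 0 := by
    have : ∀ f : Fin n → SmoothTorus θ, tau (∑ j, f j) = ∑ j, tau (f j) := fun f => by
      simp [tau]
    rw [this]
    exact Finset.sum_eq_zero fun j _ => tau_delta _ _
  have h1' : tau (1 : SmoothTorus θ) = 1 := tauOp_one
  rw [h1, tau_add, hsum, tau_smul, h1', zero_add, mul_one]

/-- The phase between `U^{e_l + k}` and `U_l U^k` appears once in the monomial and once, conjugated,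
in the coefficient, so it cancels. Left multiplication by `U_l` thus acts as a shift of the lattice.
-/
lemma fourierCoeff_U_mul_smul (l : Fin n) (u x : SmoothTorus θ) (k : Fin n → ℤ) :
    fourierCoeff ((U θ l : SmoothTorus θ) * u) (Pi.single l 1 + k) •
        (x * (Upow θ (Pi.single l 1 + k) : SmoothTorus θ)) =
      fourierCoeff u k • (x * (U θ l * Upow θ k : SmoothTorus θ)) := by
  obtain ⟨z, hz, h⟩ := Upow_add (θ := θ) (Pi.single l 1) k
  rw [Upow_single] at h
  have h1 : fourierCoeff ((U θ l : SmoothTorus θ) * u) (Pi.single l 1 + k) = star z * fourierCoeff u k := by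
    rw [fourierCoeff, h, star_smul, star_mul, mul_smul_comm, tau_smul, ← mul_assoc,
      mul_assoc _ u, tau_conj_U]
    rfl
  rw [h1, h, mul_smul_comm, smul_smul, mul_right_comm, Complex.star_def, Complex.conj_mul', hz]
  simp

/-! ### Growth of sequences indexed by the lattice -/

/-- The weight `1 + |k|`. -/
def wt (k : Fin n → ℤ) : ℝ := 1 + ‖latticePoint k‖

lemma one_le_wt (k : Fin n → ℤ) : 1 ≤ wt k := by simp [wt]

lemma wt_pos (k : Fin n → ℤ) : 0 < wt k := zero_lt_one.trans_le (one_le_wt k)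

lemma abs_le_wt (k : Fin n → ℤ) (j : Fin n) : |(k j : ℝ)| ≤ wt k := by
  have := PiLp.norm_apply_le (latticePoint k) j
  rw [wt]
  exact (show |(k j : ℝ)| ≤ ‖latticePoint k‖ from this).trans (by linarith)

lemma wt_le (k : Fin n → ℤ) : wt k ≤ 1 + ∑ j, |(k j : ℝ)| := by
  have h := (EuclideanSpace.basisFun (Fin n) ℝ).sum_repr (latticePoint k)
  rw [wt, ← h]
  gcongr
  refine norm_sum_le_of_le _ fun j _ => ?_
  simp [norm_smul, latticePoint]

lemma summable_prod_fin {f : ℤ → ℝ} (hf : Summable f) (h0 : ∀ i, 0 ≤ f i) (m : ℕ) :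
    Summable fun k : Fin m → ℤ => ∏ i, f (k i) := by
  induction m with
  | zero => exact .of_finite
  | succ m ih =>
    rw [← (Fin.consEquiv fun _ : Fin (m + 1) => ℤ).summable_iff]
    have := hf.mul_of_nonneg ih h0 fun k => Finset.prod_nonneg fun i _ => h0 _
    refine this.congr fun p => ?_
    simp [Fin.prod_univ_succ, Fin.consEquiv]

/-- `∏ (1 + |k_i|) ≤ wt k ^ n`, so the exponent `2n` allows comparison with a product of `n`
convergent series `∑ (1 + |i|)^{-2}`. -/
lemma summable_wt : Summable fun k : Fin n → ℤ => ((wt k) ^ (2 * n))⁻¹ := by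
  have h1 : Summable fun i : ℤ => ((1 + |(i : ℝ)|) ^ 2)⁻¹ := by
    have h := (Real.summable_one_div_int_pow (p := 2)).2 (by norm_num)
    refine Summable.of_norm_bounded_eventually h ?_
    have : {x : ℤ | ¬ ‖((1 + |(x : ℝ)|) ^ 2)⁻¹‖ ≤ 1 / (x : ℝ) ^ 2} ⊆ {0} := by
      intro x hx
      by_contra hx0
      refine hx ?_
      have hx1 : (x : ℝ) ≠ 0 := by exact_mod_cast hx0
      rw [Real.norm_of_nonneg (by positivity), one_div, ← sq_abs (x : ℝ)]
      have : 0 < |(x : ℝ)| := abs_pos.2 hx1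
      gcongr
      linarith
    exact (Set.finite_singleton 0).subset this
  refine Summable.of_nonneg_of_le (fun k => by have := wt_pos k; positivity) (fun k => ?_)
    (summable_prod_fin h1 (fun i => by positivity) n)
  rw [Finset.prod_inv_distrib, Finset.prod_pow, mul_comm 2 n, pow_mul]
  have hp : ∏ i, (1 + |(k i : ℝ)|) ≤ wt k ^ n := by
    have : ∀ i ∈ Finset.univ, (1 + |(k i : ℝ)|) ≤ wt k := fun i _ => by
      have := PiLp.norm_apply_le (latticePoint k) i
      rw [wt]
      exact add_le_add_right (show |(k i : ℝ)| ≤ ‖latticePoint k‖ from this) 1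
    refine (Finset.prod_le_prod (fun i _ => by positivity) this).trans ?_
    simp
  have : 0 < ∏ i, (1 + |(k i : ℝ)|) := Finset.prod_pos fun i _ => by positivity
  gcongr

/-- Scalar sequences on the lattice that decay faster than any power. -/
def RapidDecay (r : (Fin n → ℤ) → ℂ) : Prop :=
  ∀ M : ℕ, ∃ C : ℝ, ∀ k, wt k ^ M * ‖r k‖ ≤ C

/-- Since `k_j u_k` is a coefficient of `δ_j u` and the weight is at most `1 + ∑ |k_j|`, each
further power of the weight costs one derivative. -/
lemma rapidDecay_fourierCoeff (u : SmoothTorus θ) : RapidDecay (fourierCoeff u) := by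
  intro M
  induction M generalizing u with
  | zero => exact ⟨‖toOp u‖, fun k => by simpa using norm_fourierCoeff_le u k⟩
  | succ M ih =>
    obtain ⟨C, hC⟩ := ih u
    choose D hD using fun j => ih (delta θ j u)
    refine ⟨C + ∑ j, D j, fun k => ?_⟩
    have hw := wt_pos k
    calc wt k ^ (M + 1) * ‖fourierCoeff u k‖
        = wt k * (wt k ^ M * ‖fourierCoeff u k‖) := by ring
      _ ≤ (1 + ∑ j, |(k j : ℝ)|) * (wt k ^ M * ‖fourierCoeff u k‖) := by
          gcongr
          exact wt_le k
      _ = wt k ^ M * ‖fourierCoeff u k‖ + ∑ j, wt k ^ M * ‖fourierCoeff (delta θ j u) k‖ := by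
          simp only [fourierCoeff_delta, norm_mul, Complex.norm_intCast]
          rw [add_mul, one_mul, Finset.sum_mul]
          congr 1
          exact Finset.sum_congr rfl fun j _ => by ring
      _ ≤ C + ∑ j, D j := add_le_add (hC k) (Finset.sum_le_sum fun j _ => hD j k)

/-- Sequences on the lattice all of whose semi-norms grow at most polynomially. -/
def PolyGrowth (x : (Fin n → ℤ) → SmoothTorus θ) : Prop :=
  ∀ w, ∃ (C : ℝ) (M : ℕ), ∀ k, ‖toOp (deltaWord θ w (x k))‖ ≤ C * wt k ^ M

lemma growth_add {f g : (Fin n → ℤ) → ℝ} (hf : ∃ (C : ℝ) (M : ℕ), ∀ k, f k ≤ C * wt k ^ M)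
    (hg : ∃ (C : ℝ) (M : ℕ), ∀ k, g k ≤ C * wt k ^ M) :
    ∃ (C : ℝ) (M : ℕ), ∀ k, f k + g k ≤ C * wt k ^ M := by
  obtain ⟨C, M, h⟩ := hf
  obtain ⟨D, N, h'⟩ := hg
  refine ⟨|C| + |D|, M + N, fun k => ?_⟩
  have h1 := one_le_wt k
  have h2 : C * wt k ^ M ≤ |C| * wt k ^ (M + N) := by
    refine mul_le_mul (le_abs_self C) (pow_le_pow_right₀ h1 (by omega)) ?_ (abs_nonneg _)
    have := wt_pos k
    positivity
  have h3 : D * wt k ^ N ≤ |D| * wt k ^ (M + N) := by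
    refine mul_le_mul (le_abs_self D) (pow_le_pow_right₀ h1 (by omega)) ?_ (abs_nonneg _)
    have := wt_pos k
    positivity
  linarith [h k, h' k, add_mul |C| |D| (wt k ^ (M + N))]

lemma PolyGrowth.mul_Upow {x : (Fin n → ℤ) → SmoothTorus θ} (hx : PolyGrowth x) :
    PolyGrowth fun k => x k * (Upow θ k : SmoothTorus θ) := by
  intro w
  induction w using List.reverseRecOn generalizing x with
  | nil =>
    obtain ⟨C, M, h⟩ := hx []
    refine ⟨C, M, fun k => ?_⟩
    have := h k
    rw [deltaWord_nil] at this ⊢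
    exact (norm_toOp_mul_unitary _ _).trans_le this
  | append_singleton w j ih =>
    -- `δ_j(x_k U^k) = (δ_j x_k + k_j x_k) U^k` has again the form to which the induction hypothesis
    -- applies, at the price of one power of the weight.
    have hy : PolyGrowth fun k => delta θ j (x k) + (k j : ℂ) • x k := by
      intro w
      have h1 := hx (w ++ [j])
      obtain ⟨C, M, h2⟩ := hx w
      obtain ⟨C', M', h3⟩ := growth_add h1 ⟨C, M + 1, fun k => by
        have : |(k j : ℝ)| * ‖toOp (deltaWord θ w (x k))‖ ≤ wt k * (C * wt k ^ M) :=
          mul_le_mul (abs_le_wt k j) (h2 k) (norm_nonneg _) (wt_pos k).le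
        exact this.trans_eq (by ring)⟩
      refine ⟨C', M', fun k => (le_trans ?_ (h3 k))⟩
      rw [map_add, map_add, map_smul, map_smul, deltaWord_concat]
      refine (norm_add_le _ _).trans ?_
      rw [norm_smul, Complex.norm_intCast]
      rfl
    obtain ⟨C, M, h⟩ := ih hy
    refine ⟨C, M, fun k => ?_⟩
    have h1 := h k
    simp only [add_mul, smul_mul_assoc] at h1
    simp only [deltaWord_concat, Module.End.mul_apply, delta_mul, delta_Upow, mul_smul_comm]
    exact h1

lemma absSummable_of_polyGrowth {x : (Fin n → ℤ) → SmoothTorus θ} (hx : PolyGrowth x)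
    {a : (Fin n → ℤ) → ℂ} (ha : RapidDecay a) : AbsSummable fun k => a k • x k := by
  intro w
  obtain ⟨C, M, h⟩ := hx w
  obtain ⟨D, h'⟩ := ha (M + 2 * n)
  refine Summable.of_nonneg_of_le (fun _ => norm_nonneg _) (fun k => ?_)
    (summable_wt.mul_left (D * C))
  have hw := wt_pos k
  rw [map_smul, map_smul, norm_smul]
  rw [← div_eq_mul_inv, le_div_iff₀ (by positivity)]
  have hC : 0 ≤ C := by
    have := (norm_nonneg _).trans (h k)
    exact nonneg_of_mul_nonneg_left this (by positivity)
  calc ‖a k‖ * ‖toOp (deltaWord θ w (x k))‖ * wt k ^ (2 * n)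
      ≤ ‖a k‖ * (C * wt k ^ M) * wt k ^ (2 * n) := by
        gcongr
        exact h k
    _ = (wt k ^ (M + 2 * n) * ‖a k‖) * C := by ring
    _ ≤ D * C := by
        gcongr
        exact h' k

/-! ### Quantization of sequences -/

/-- `P u = ∑_k u_k x_k U^k` for all `u`. -/
def Quantizes (x : (Fin n → ℤ) → SmoothTorus θ) (P : Module.End ℂ (SmoothTorus θ)) : Prop :=
  ∀ u : SmoothTorus θ,
    HasSum (fun k => fourierCoeff u k • (x k * (Upow θ k : SmoothTorus θ))) (P u)

lemma fourierCoeff_add (u v : SmoothTorus θ) (k : Fin n → ℤ) :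
    fourierCoeff (u + v) k = fourierCoeff u k + fourierCoeff v k := by
  simp [fourierCoeff, add_mul, tau_add]

lemma fourierCoeff_smul (c : ℂ) (u : SmoothTorus θ) (k : Fin n → ℤ) :
    fourierCoeff (c • u) k = c * fourierCoeff u k := by
  simp [fourierCoeff, tau_smul]

lemma PolyGrowth.exists_quantizes {x : (Fin n → ℤ) → SmoothTorus θ} (hx : PolyGrowth x) :
    ∃ P, Quantizes x P := by
  choose P hP using fun u : SmoothTorus θ =>
    (absSummable_of_polyGrowth hx.mul_Upow (rapidDecay_fourierCoeff u)).exists_hasSum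
  refine ⟨⟨⟨P, fun u v => ?_⟩, fun c u => ?_⟩, hP⟩
  · refine (hP (u + v)).unique ?_
    simpa only [fourierCoeff_add, add_smul] using (hP u).add (hP v)
  · refine (hP (c • u)).unique ?_
    rw [RingHom.id_apply]
    simpa only [fourierCoeff_smul, mul_smul] using (hP u).const_smul c

lemma Quantizes.sub {x y : (Fin n → ℤ) → SmoothTorus θ} {P Q : Module.End ℂ (SmoothTorus θ)}
    (hP : Quantizes x P) (hQ : Quantizes y Q) : Quantizes (fun k => x k - y k) (P - Q) := fun u => by
  rw [LinearMap.sub_apply]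
  simpa only [sub_mul, smul_sub] using (hP u).sub (hQ u)

lemma Quantizes.add {x y : (Fin n → ℤ) → SmoothTorus θ} {P Q : Module.End ℂ (SmoothTorus θ)}
    (hP : Quantizes x P) (hQ : Quantizes y Q) : Quantizes (fun k => x k + y k) (P + Q) := fun u => by
  rw [LinearMap.add_apply]
  simpa only [add_mul, smul_add] using (hP u).add (hQ u)

lemma Quantizes.sum {ι : Type*} {s : Finset ι} {x : ι → (Fin n → ℤ) → SmoothTorus θ}
    {P : ι → Module.End ℂ (SmoothTorus θ)} (h : ∀ i, Quantizes (x i) (P i)) :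
    Quantizes (fun k => ∑ i ∈ s, x i k) (∑ i ∈ s, P i) := fun u => by
  rw [LinearMap.sum_apply]
  simpa only [Finset.sum_mul, Finset.smul_sum] using hasSum_sum fun i (_ : i ∈ s) => h i u

lemma Quantizes.apply_Upow {x : (Fin n → ℤ) → SmoothTorus θ} {P : Module.End ℂ (SmoothTorus θ)}
    (hP : Quantizes x P) (k : Fin n → ℤ) :
    P (Upow θ k : SmoothTorus θ) = x k * (Upow θ k : SmoothTorus θ) := by
  refine (hP (Upow θ k)).unique ?_
  have h := hasSum_single (f := fun l => fourierCoeff (Upow θ k : SmoothTorus θ) l •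
    (x l * (Upow θ l : SmoothTorus θ))) k fun l hl => by
      rw [fourierCoeff_Upow, if_neg hl.symm, zero_smul]
  simpa [fourierCoeff_Upow] using h

/-- Evaluating on the invertible `U^k` recovers `x_k`: the operator determines its symbol on the
lattice. -/
lemma Quantizes.unique {x y : (Fin n → ℤ) → SmoothTorus θ} {P : Module.End ℂ (SmoothTorus θ)}
    (hx : Quantizes x P) (hy : Quantizes y P) : x = y := by
  funext k
  have h := (hx.apply_Upow k).symm.trans (hy.apply_Upow k)
  have h2 := congrArg (fun z => z * star (Upow θ k : SmoothTorus θ)) h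
  simpa only [mul_assoc, Unitary.mul_star_self_of_mem (Upow θ k).2, mul_one] using h2

lemma hasSum_of_forall_eq {ι X : Type*} [AddCommMonoid X] [TopologicalSpace X] {f g : ι → X} {a : X}
    (h : HasSum f a) (hfg : ∀ i, g i = f i) : HasSum g a := by
  rwa [funext hfg]

/-- The commutator of `δ_j` with the quantization of `x` is the quantization of `δ_j(x)`. -/
lemma Quantizes.lie_delta {x : (Fin n → ℤ) → SmoothTorus θ} {P : Module.End ℂ (SmoothTorus θ)}
    (hP : Quantizes x P) (j : Fin n) : Quantizes (fun k => delta θ j (x k)) ⁅delta θ j, P⁆ := by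
  intro u
  have h1 := (hP u).map (delta θ j) (continuous_delta j)
  have h2 := h1.sub (hP (delta θ j u))
  rw [LieRing.of_associative_ring_bracket]
  refine hasSum_of_forall_eq h2 fun k => ?_
  -- By the Leibniz rule the terms `k_j x_k U^k` of the two products cancel.
  simp only [Function.comp, map_smul, delta_mul, delta_Upow, fourierCoeff_delta, mul_smul_comm,
    smul_add, smul_smul]
  rw [mul_comm (fourierCoeff u k), add_sub_cancel_right]

/-- The commutator with `U_j` of the quantization of `b_k U_j^*` is the quantization of the
finite difference of `b`. -/
lemma Quantizes.lie_mulU {b : (Fin n → ℤ) → ℂ} {j : Fin n} {P : Module.End ℂ (SmoothTorus θ)}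
    (hP : Quantizes (fun k => b k • star (U θ j : SmoothTorus θ)) P) :
    Quantizes (fun k => (b (Pi.single j 1 + k) - b k) • 1) ⁅P, mulU θ j⁆ := by
  intro u
  have h1 := (hP u).map (mulU θ j) (continuous_mulU j)
  -- Reindexing by `k ↦ e_j + k` aligns the series of `P(U_j u)` with that of `U_j P(u)`. In both,
  -- `U_j^*` then stands next to a factor `U_j` and cancels, leaving the scalars `b(e_j + k)` and
  -- `b(k)`.
  have h2 := (Equiv.addLeft (Pi.single j 1 : Fin n → ℤ)).hasSum_iff.2 (hP (mulU θ j u))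
  have h3 := h2.sub h1
  rw [LieRing.of_associative_ring_bracket]
  refine hasSum_of_forall_eq h3 fun k => ?_
  have e1 : mulU θ j u = U θ j * u := rfl
  have e2 : ∀ v, mulU θ j v = U θ j * v := fun _ => rfl
  simp only [Function.comp, Equiv.coe_addLeft, e1]
  rw [fourierCoeff_U_mul_smul, e2]
  simp only [smul_mul_assoc, mul_smul_comm, ← mul_assoc]
  rw [Unitary.mul_star_self_of_mem (U θ j).2, Unitary.star_mul_self_of_mem (U θ j).2]
  simp only [one_mul, sub_smul, smul_sub]

/-! ### Smoothing operators -/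

lemma isVonNBounded_of_deltaWord {S : Set (SmoothTorus θ)}
    (h : ∀ w, ∃ C : ℝ, ∀ x ∈ S, ‖toOp (deltaWord θ w x)‖ ≤ C) : Bornology.IsVonNBounded ℂ S := by
  have hε : Tendsto (fun m : ℕ => ((m : ℂ) + 1)⁻¹) atTop (𝓝 0) := by
    rw [tendsto_zero_iff_norm_tendsto_zero]
    have : (fun m : ℕ => ‖((m : ℂ) + 1)⁻¹‖) = fun m : ℕ => 1 / ((m : ℝ) + 1) := by
      funext m
      rw [norm_inv, one_div]
      congr 1
      exact_mod_cast Complex.norm_natCast (m + 1)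
    rw [this]
    exact tendsto_one_div_add_atTop_nhds_zero_nat
  refine Bornology.isVonNBounded_of_smul_tendsto_zero (ε := fun m : ℕ => ((m : ℂ) + 1)⁻¹)
    (l := atTop) (Eventually.of_forall fun m => inv_ne_zero (by exact_mod_cast m.succ_ne_zero)) ?_
  intro x hx
  rw [isInducing_deltaPowOp.tendsto_nhds_iff, tendsto_pi_nhds]
  intro α
  obtain ⟨w, hw⟩ := exists_deltaPow_eq_deltaWord (θ := θ) α
  obtain ⟨C, hC⟩ := h w
  have h0 : (LinearMap.pi (deltaPowOp (θ := θ))) (0 : SmoothTorus θ) α = 0 := by simp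
  rw [h0, tendsto_zero_iff_norm_tendsto_zero]
  have hl : Tendsto (fun m : ℕ => ‖((m : ℂ) + 1)⁻¹‖ * C) atTop (𝓝 0) := by
    simpa using (tendsto_zero_iff_norm_tendsto_zero.1 hε).mul_const C
  refine squeeze_zero (fun _ => norm_nonneg _) (fun m => ?_) hl
  have : LinearMap.pi (deltaPowOp (θ := θ)) (((fun m : ℕ => ((m : ℂ) + 1)⁻¹) • x) m) α =
      ((m : ℂ) + 1)⁻¹ • toOp (deltaWord θ w (x m)) := by
    rw [← hw]
    change deltaPowOp α (((m : ℂ) + 1)⁻¹ • x m) = _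
    rw [map_smul]
    rfl
  simp only [Function.comp, this]
  rw [norm_smul]
  gcongr
  exact hC _ (hx m)

lemma norm_deltaWord_Upow_le (w : List (Fin n)) (k : Fin n → ℤ) :
    ‖toOp (deltaWord θ w (Upow θ k : SmoothTorus θ))‖ ≤ wt k ^ w.length * ‖toOp (1 : SmoothTorus θ)‖ := by
  induction w using List.reverseRecOn with
  | nil =>
    have := norm_toOp_mul_unitary (1 : SmoothTorus θ) (Upow θ k)
    rw [one_mul] at this
    simp [deltaWord_nil, this]
  | append_singleton w j ih =>
    rw [deltaWord_concat, Module.End.mul_apply, delta_Upow, map_smul, map_smul, norm_smul,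
      Complex.norm_intCast, List.length_append, List.length_singleton, pow_succ', mul_assoc]
    exact mul_le_mul (abs_le_wt k j) ih (norm_nonneg _) (wt_pos k).le

lemma norm_deltaWord_star_Upow_le (w : List (Fin n)) (k : Fin n → ℤ) :
    ‖toOp (deltaWord θ w (star (Upow θ k : SmoothTorus θ)))‖ ≤
      wt k ^ w.length * ‖toOp (1 : SmoothTorus θ)‖ := by
  induction w using List.reverseRecOn with
  | nil =>
    have := norm_toOp_mul_unitary (1 : SmoothTorus θ) (star (Upow θ k))
    rw [one_mul, Unitary.coe_star] at this
    simp [deltaWord_nil, this]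
  | append_singleton w j ih =>
    rw [deltaWord_concat, Module.End.mul_apply, delta_star_Upow, map_smul, map_smul, norm_smul,
      norm_neg, Complex.norm_intCast, List.length_append, List.length_singleton, pow_succ',
      mul_assoc]
    exact mul_le_mul (abs_le_wt k j) ih (norm_nonneg _) (wt_pos k).le

lemma polyGrowth_one : PolyGrowth fun _ => (1 : SmoothTorus θ) := fun w =>
  ⟨‖toOp (deltaWord θ w 1)‖, 0, fun k => by simp⟩

/-- The Fourier multiplier with a rapidly decreasing scalar symbol is a smoothing operator. -/
theorem isSmoothing_of_rapidDecay {r : (Fin n → ℤ) → ℂ} (hr : RapidDecay r)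
    {R : Module.End ℂ (SmoothTorus θ)} (hR : Quantizes (fun k => r k • 1) R) : IsSmoothing R := by
  -- These bounded sets serve twice: a functional is bounded on each of them, which gives the rapid
  -- decay of `a φ`, and their polars are neighbourhoods of `0` for the strong topology, which gives
  -- continuity.
  have hbdd : ∀ M : ℕ, Bornology.IsVonNBounded ℂ
      (Set.range fun k => ((wt k : ℂ) ^ M * r k) • star (Upow θ k : SmoothTorus θ)) := by
    intro M
    refine isVonNBounded_of_deltaWord fun w => ?_
    obtain ⟨C, hC⟩ := hr (M + w.length)
    refine ⟨C * ‖toOp (1 : SmoothTorus θ)‖, ?_⟩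
    rintro _ ⟨k, rfl⟩
    have hw := wt_pos k
    rw [map_smul, map_smul, norm_smul, norm_mul, norm_pow, Complex.norm_real,
      Real.norm_of_nonneg hw.le]
    calc _ ≤ wt k ^ M * ‖r k‖ * (wt k ^ w.length * ‖toOp (1 : SmoothTorus θ)‖) := by
          gcongr
          exact norm_deltaWord_star_Upow_le w k
      _ = (wt k ^ (M + w.length) * ‖r k‖) * ‖toOp (1 : SmoothTorus θ)‖ := by ring
      _ ≤ _ := by
          gcongr
          exact hC k
  let a : StrongDual ℂ (SmoothTorus θ) → (Fin n → ℤ) → ℂ :=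
    fun φ k => φ (star (Upow θ k : SmoothTorus θ)) * r k
  have hval : ∀ (φ : StrongDual ℂ (SmoothTorus θ)) (M : ℕ) (k : Fin n → ℤ),
      wt k ^ M * ‖a φ k‖ =
        ‖φ (((wt k : ℂ) ^ M * r k) • star (Upow θ k : SmoothTorus θ))‖ := by
    intro φ M k
    rw [map_smul, smul_eq_mul, norm_mul, norm_mul, norm_mul, norm_pow, Complex.norm_real,
      Real.norm_of_nonneg (wt_pos k).le]
    ring
  have ha : ∀ φ, RapidDecay (a φ) := by
    intro φ M
    have h1 := (hbdd M).image φ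
    rw [NormedSpace.isVonNBounded_iff, isBounded_iff_forall_norm_le] at h1
    obtain ⟨C, hC⟩ := h1
    refine ⟨C, fun k => ?_⟩
    rw [hval]
    exact hC _ ⟨_, ⟨k, rfl⟩, rfl⟩
  have hsum : ∀ φ, AbsSummable fun k => a φ k • (1 * (Upow θ k : SmoothTorus θ)) := fun φ =>
    absSummable_of_polyGrowth polyGrowth_one.mul_Upow (ha φ)
  choose F hF using fun φ => (hsum φ).exists_hasSum
  have hadd : ∀ φ ψ, F (φ + ψ) = F φ + F ψ := fun φ ψ => by
    refine (hF (φ + ψ)).unique (hasSum_of_forall_eq ((hF φ).add (hF ψ)) fun k => ?_)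
    rw [← add_smul]
    simp [a, add_mul]
  have hsmul : ∀ (c : ℂ) φ, F (c • φ) = c • F φ := fun c φ => by
    refine (hF (c • φ)).unique (hasSum_of_forall_eq ((hF φ).const_smul c) fun k => ?_)
    rw [smul_smul]
    simp [a, mul_assoc]
  have hcont : Continuous F := by
    refine continuous_of_deltaWord fun w => ?_
    let G : StrongDual ℂ (SmoothTorus θ) →+ Op n :=
      { toFun := fun φ => toOp (deltaWord θ w (F φ))
        map_zero' := by
          have h := hadd 0 0
          rw [add_zero, left_eq_add] at h
          simp [h]
        map_add' := fun φ ψ => by rw [hadd, map_add, map_add] }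
    change Continuous G
    refine continuous_of_continuousAt_zero G ?_
    rw [ContinuousAt, map_zero, ContinuousLinearMap.hasBasis_nhds_zero.tendsto_iff
      Metric.nhds_basis_closedBall]
    intro ε hε
    let K : ℝ := ‖toOp (1 : SmoothTorus θ)‖ * ∑' k : Fin n → ℤ, ((wt k) ^ (2 * n))⁻¹
    have hK : 0 ≤ K := mul_nonneg (norm_nonneg _) (tsum_nonneg fun k => by
      have := wt_pos k
      positivity)
    -- In the exponent, `w.length` pays for the derivatives of `U^k` and `2 * n` for summability.
    -- The radius has `K + 1` so that it makes sense also when `K = 0`.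
    refine ⟨(Set.range fun k =>
      ((wt k : ℂ) ^ (w.length + 2 * n) * r k) • star (Upow θ k : SmoothTorus θ),
      Metric.closedBall 0 (ε / (K + 1))), ⟨hbdd _, Metric.closedBall_mem_nhds _ (by positivity)⟩, ?_⟩
    intro φ hφ
    rw [mem_closedBall_zero_iff]
    have h1 : ∀ k, wt k ^ (w.length + 2 * n) * ‖a φ k‖ ≤ ε / (K + 1) := fun k => by
      rw [hval, ← mem_closedBall_zero_iff]
      exact hφ _ ⟨k, rfl⟩
    have h2 : HasSum (fun k => toOp (deltaWord θ w (a φ k • (1 * (Upow θ k : SmoothTorus θ)))))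
        (G φ) := (hF φ).map ((toOp : SmoothTorus θ →ₗ[ℂ] Op n).comp (deltaWord θ w))
          (continuous_deltaWord w)
    have h3 : ∀ k, ‖toOp (deltaWord θ w (a φ k • (1 * (Upow θ k : SmoothTorus θ))))‖ ≤
        ε / (K + 1) * ‖toOp (1 : SmoothTorus θ)‖ * ((wt k) ^ (2 * n))⁻¹ := by
      intro k
      have hw := wt_pos k
      rw [one_mul, map_smul, map_smul, norm_smul, ← div_eq_mul_inv, le_div_iff₀ (by positivity)]
      calc _ ≤ ‖a φ k‖ * (wt k ^ w.length * ‖toOp (1 : SmoothTorus θ)‖) * wt k ^ (2 * n) := by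
            gcongr
            exact norm_deltaWord_Upow_le w k
        _ = wt k ^ (w.length + 2 * n) * ‖a φ k‖ * ‖toOp (1 : SmoothTorus θ)‖ := by ring
        _ ≤ _ := by
            gcongr
            exact h1 k
    have h4 := tsum_of_norm_bounded (summable_wt.mul_left _).hasSum h3
    rw [h2.tsum_eq, tsum_mul_left] at h4
    refine h4.trans ?_
    rw [mul_assoc]
    change ε / (K + 1) * K ≤ ε
    rw [div_mul_eq_mul_div, div_le_iff₀ (by positivity)]
    nlinarith
  refine ⟨⟨⟨⟨F, hadd⟩, hsmul⟩, hcont⟩, fun u => ?_⟩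
  -- On the functional attached to `u`, the value at `(U^k)^*` is the Fourier coefficient `u_k`.
  refine (hF (toDual u)).unique (hasSum_of_forall_eq (hR u) fun k => ?_)
  rw [smul_mul_assoc, smul_smul]
  rfl

/-! ### Homogeneous functions -/

section Homogeneous

variable {F : Type*} [NormedAddCommGroup F] [NormedSpace ℝ F] [NormedSpace ℂ F]

/-- Smooth functions on `ℝⁿ ∖ 0`, homogeneous of degree `q`. -/
def Homog (q : ℂ) (f : RR n → F) : Prop :=
  ContDiffOn ℝ ∞ f {0}ᶜ ∧ ∀ t : ℝ, 0 < t → ∀ ξ : RR n, ξ ≠ 0 → f (t • ξ) = ((t : ℂ) ^ q) • f ξ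

lemma Homog.contDiffAt {q : ℂ} {f : RR n → F} (hf : Homog q f) {ξ : RR n} (hξ : ξ ≠ 0) :
    ContDiffAt ℝ ∞ f ξ :=
  hf.1.contDiffAt (isOpen_compl_singleton.mem_nhds hξ)

lemma Homog.zero (q : ℂ) : Homog q (fun _ : RR n => (0 : F)) :=
  ⟨contDiffOn_const, fun t _ ξ _ => by simp⟩

lemma Homog.add {q : ℂ} {f g : RR n → F} (hf : Homog q f) (hg : Homog q g) :
    Homog q (fun ξ => f ξ + g ξ) :=
  ⟨hf.1.add hg.1, fun t ht ξ hξ => by simp only [hf.2 t ht ξ hξ, hg.2 t ht ξ hξ, smul_add]⟩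

lemma Homog.const_smul [IsScalarTower ℝ ℂ F] {q : ℂ} {f : RR n → F} (hf : Homog q f) (c : ℂ) :
    Homog q (fun ξ => c • f ξ) :=
  ⟨hf.1.const_smul c, fun t ht ξ hξ => by
    simp only [hf.2 t ht ξ hξ, smul_comm c]⟩

lemma Homog.sum {ι : Type*} {s : Finset ι} {q : ℂ} {f : ι → RR n → F} (hf : ∀ i ∈ s, Homog q (f i)) :
    Homog q (fun ξ => ∑ i ∈ s, f i ξ) :=
  ⟨ContDiffOn.sum fun i hi => (hf i hi).1, fun t ht ξ hξ => by
    rw [Finset.smul_sum]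
    exact Finset.sum_congr rfl fun i hi => (hf i hi).2 t ht ξ hξ⟩

lemma Homog.eq_norm_smul {q : ℂ} {f : RR n → F} (hf : Homog q f) {ξ : RR n} (hξ : ξ ≠ 0) :
    f ξ = ((‖ξ‖ : ℂ) ^ q) • f (‖ξ‖⁻¹ • ξ) := by
  have h : 0 < ‖ξ‖ := norm_pos_iff.2 hξ
  rw [← hf.2 ‖ξ‖ h _ (smul_ne_zero (inv_ne_zero h.ne') hξ), smul_smul, mul_inv_cancel₀ h.ne',
    one_smul]

lemma Homog.norm_le [IsScalarTower ℝ ℂ F] {q : ℂ} {f : RR n → F} (hf : Homog q f) :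
    ∃ C : ℝ, 0 ≤ C ∧ ∀ ξ : RR n, ξ ≠ 0 → ‖f ξ‖ ≤ C * ‖ξ‖ ^ q.re := by
  have hc : ContinuousOn f (Metric.sphere (0 : RR n) 1) :=
    hf.1.continuousOn.mono fun x hx h => by
      rw [Set.mem_singleton_iff] at h
      subst h
      simp at hx
  obtain ⟨C, hC⟩ := (isCompact_sphere (0 : RR n) 1).exists_bound_of_continuousOn hc
  refine ⟨|C|, abs_nonneg _, fun ξ hξ => ?_⟩
  have h : 0 < ‖ξ‖ := norm_pos_iff.2 hξ
  rw [hf.eq_norm_smul hξ, norm_smul, Complex.norm_cpow_eq_rpow_re_of_pos h, mul_comm]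
  gcongr
  refine (hC _ ?_).trans (le_abs_self C)
  simp [norm_smul, h.ne']

/-- Differentiate `f(tξ) = t^q f(ξ)` in `ξ` and divide by `t`. -/
lemma Homog.fderiv [IsScalarTower ℝ ℂ F] {q : ℂ} {f : RR n → F} (hf : Homog q f) :
    Homog (q - 1) (_root_.fderiv ℝ f) := by
  refine ⟨hf.1.fderiv_of_isOpen isOpen_compl_singleton (by simp), fun t ht ξ hξ => ?_⟩
  have htξ : t • ξ ≠ 0 := smul_ne_zero ht.ne' hξ
  have h1 : HasFDerivAt f (_root_.fderiv ℝ f (t • ξ)) (t • ξ) :=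
    ((hf.contDiffAt htξ).differentiableAt (by simp)).hasFDerivAt
  have h2 := h1.comp ξ ((hasFDerivAt_id (𝕜 := ℝ) ξ).const_smul t)
  have h3 : HasFDerivAt (fun x => ((t : ℂ) ^ q) • f x) (((t : ℂ) ^ q) • _root_.fderiv ℝ f ξ) ξ :=
    ((hf.contDiffAt hξ).differentiableAt (by simp)).hasFDerivAt.const_smul _
  have h4 : (f ∘ fun x => t • x) =ᶠ[𝓝 ξ] fun x => ((t : ℂ) ^ q) • f x := by
    filter_upwards [isOpen_compl_singleton.mem_nhds hξ] with x hx
    exact hf.2 t ht x hx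
  have h5 := h2.unique (h3.congr_of_eventuallyEq h4)
  ext v
  have h6 := DFunLike.congr_fun h5 v
  simp only [ContinuousLinearMap.comp_apply, smul_apply, ContinuousLinearMap.id_apply,
    map_smul] at h6
  have ht0 : (t : ℂ) ≠ 0 := by exact_mod_cast ht.ne'
  rw [Complex.cpow_sub _ _ ht0, Complex.cpow_one, smul_apply, div_eq_inv_mul, mul_smul, ← h6,
    ← algebraMap_smul ℂ t (_root_.fderiv ℝ f (t • ξ) v), Complex.coe_algebraMap, smul_smul, inv_mul_cancel₀ ht0, one_smul]

end Homogeneous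

/-- The target space is generalized in the induction because the derivative takes values in a space
of linear maps. -/
lemma Homog.iteratedFDeriv_le.{u} {F : Type u} [NormedAddCommGroup F] [NormedSpace ℝ F]
    [NormedSpace ℂ F] [IsScalarTower ℝ ℂ F] {q : ℂ} {f : RR n → F} (hf : Homog q f) (k : ℕ) :
    ∃ C : ℝ, 0 ≤ C ∧ ∀ ξ : RR n, ξ ≠ 0 → ‖iteratedFDeriv ℝ k f ξ‖ ≤ C * ‖ξ‖ ^ (q.re - k) := by
  induction k generalizing F q with
  | zero => simpa using hf.norm_le
  | succ k ih =>
    obtain ⟨C, hC, h⟩ := ih hf.fderiv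
    refine ⟨C, hC, fun ξ hξ => ?_⟩
    rw [← norm_iteratedFDeriv_fderiv]
    convert h ξ hξ using 3
    simp
    ring

/-! ### Cut-offs -/

/-- A smooth bump equal to `1` on the ball of radius `1/2`, supported in the unit ball. -/
def bump (n : ℕ) : ContDiffBump (0 : RR n) := ⟨1 / 2, 1, by norm_num, by norm_num⟩

/-- A smooth function vanishing near the origin and equal to `1` outside of the unit ball. -/
def cutoff (ξ : RR n) : ℝ := 1 - bump n ξ

lemma contDiff_cutoff : ContDiff ℝ ∞ (cutoff (n := n)) := contDiff_const.sub (bump n).contDiff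

lemma cutoff_of_norm_le {ξ : RR n} (h : ‖ξ‖ ≤ 1 / 2) : cutoff ξ = 0 := by
  rw [cutoff, (bump n).one_of_mem_closedBall (by simpa [bump] using h), sub_self]

lemma cutoff_of_le_norm {ξ : RR n} (h : 1 ≤ ‖ξ‖) : cutoff ξ = 1 := by
  rw [cutoff, (bump n).zero_of_le_dist (by simpa [bump] using h), sub_zero]

lemma iteratedFDeriv_of_eventuallyEq {E G : Type*} [NormedAddCommGroup E] [NormedSpace ℝ E]
    [NormedAddCommGroup G] [NormedSpace ℝ G] {f g : E → G} {x : E} (h : f =ᶠ[𝓝 x] g) (k : ℕ) :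
    iteratedFDeriv ℝ k f x = iteratedFDeriv ℝ k g x := (h.iteratedFDeriv ℝ k).self_of_nhds

lemma norm_iteratedFDeriv_sum_le {E G : Type*} [NormedAddCommGroup E] [NormedSpace ℝ E]
    [NormedAddCommGroup G] [NormedSpace ℝ G] {ι : Type*} (s : Finset ι) {f : ι → E → G} {x : E}
    (k : ℕ) (h : ∀ i ∈ s, ContDiffAt ℝ ∞ (f i) x) :
    ‖iteratedFDeriv ℝ k (fun y => ∑ i ∈ s, f i y) x‖ ≤ ∑ i ∈ s, ‖iteratedFDeriv ℝ k (f i) x‖ := by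
  classical
  have hk : ((k : ℕ) : WithTop ℕ∞) ≤ ∞ := by exact_mod_cast le_top
  induction s using Finset.induction_on with
  | empty =>
    have : iteratedFDeriv ℝ k (fun _ : E => (0 : G)) x = 0 := by simp
    simp [this]
  | insert i s hi ih =>
    simp only [Finset.sum_insert hi]
    rw [fun_iteratedFDeriv_add_apply ((h i (by simp)).of_le hk)
      (ContDiffAt.sum fun j hj => (h j (by simp [hj])).of_le hk)]
    exact (norm_add_le _ _).trans (add_le_add_right (ih fun j hj => h j (by simp [hj])) _)

lemma contDiff_cutoff_mul {q : ℂ} {c : RR n → ℂ} (hc : Homog q c) :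
    ContDiff ℝ ∞ fun ξ => (cutoff ξ : ℂ) * c ξ := by
  rw [contDiff_iff_contDiffAt]
  intro ξ
  by_cases hξ : ξ = 0
  · subst hξ
    have : (fun ξ => (cutoff ξ : ℂ) * c ξ) =ᶠ[𝓝 0] fun _ => 0 := by
      filter_upwards [Metric.ball_mem_nhds (0 : RR n) (show (0 : ℝ) < 1 / 2 by norm_num)] with x hx
      rw [cutoff_of_norm_le (by simpa using (mem_ball_zero_iff.1 hx).le)]
      simp
    exact contDiffAt_const.congr_of_eventuallyEq this
  · exact ((Complex.ofRealCLM.contDiff.comp contDiff_cutoff).contDiffAt).mul (hc.contDiffAt hξ)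

/-- The product is `c` outside the unit ball, vanishes near each point of norm below `1/4`, and the
annulus left over is compact. -/
lemma cutoff_mul_bound {q : ℂ} {c : RR n → ℂ} (hc : Homog q c) (k : ℕ) :
    ∃ A : ℝ, 0 ≤ A ∧ ∀ ξ : RR n, ξ ≠ 0 →
      ‖iteratedFDeriv ℝ k (fun ξ => (cutoff ξ : ℂ) * c ξ) ξ‖ ≤ A * ‖ξ‖ ^ (q.re - k) := by
  obtain ⟨C, hC, h⟩ := hc.iteratedFDeriv_le k
  set g := fun ξ => (cutoff ξ : ℂ) * c ξ with hg
  have hgs := contDiff_cutoff_mul hc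
  have hcont : ContinuousOn (fun ξ : RR n => ‖iteratedFDeriv ℝ k g ξ‖ * ‖ξ‖ ^ (-(q.re - k)))
      (Metric.closedBall 0 1 \ Metric.ball 0 (1 / 4)) := by
    refine ((hgs.continuous_iteratedFDeriv (m := k) (by exact_mod_cast le_top)).norm.continuousOn).mul ?_
    refine continuousOn_id.norm.rpow_const fun ξ hξ => Or.inl ?_
    intro h0
    have h0' : ξ = 0 := norm_eq_zero.1 h0
    exact hξ.2 (by simp [h0'])
  have hcomp : IsCompact (Metric.closedBall (0 : RR n) 1 \ Metric.ball 0 (1 / 4)) :=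
    (isCompact_closedBall 0 1).diff Metric.isOpen_ball
  obtain ⟨D, hD⟩ := hcomp.exists_bound_of_continuousOn hcont
  refine ⟨C + |D|, by positivity, fun ξ hξ => ?_⟩
  have hpos : 0 < ‖ξ‖ := norm_pos_iff.2 hξ
  have hr : 0 ≤ ‖ξ‖ ^ (q.re - k) := by positivity
  by_cases h1 : 1 < ‖ξ‖
  · have : g =ᶠ[𝓝 ξ] c := by
      filter_upwards [(isOpen_lt continuous_const continuous_norm).mem_nhds h1] with x hx
      simp [hg, cutoff_of_le_norm (le_of_lt hx)]
    rw [iteratedFDeriv_of_eventuallyEq this]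
    refine (h ξ hξ).trans ?_
    gcongr
    linarith [abs_nonneg D]
  by_cases h2 : ‖ξ‖ < 1 / 4
  · have : g =ᶠ[𝓝 ξ] fun _ => 0 := by
      filter_upwards [(isOpen_lt continuous_norm continuous_const).mem_nhds h2] with x hx
      have hx' : ‖x‖ < 1 / 4 := hx
      simp [hg, cutoff_of_norm_le (show ‖x‖ ≤ 1 / 2 by linarith)]
    have h0 : iteratedFDeriv ℝ k (fun _ : RR n => (0 : ℂ)) ξ = 0 := by simp
    rw [iteratedFDeriv_of_eventuallyEq this, h0, norm_zero]
    positivity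
  · have h3 := hD ξ ⟨by simpa using h1, by simpa using h2⟩
    rw [Real.norm_of_nonneg (by positivity), Real.rpow_neg hpos.le, ← div_eq_mul_inv,
      div_le_iff₀ (by positivity)] at h3
    refine h3.trans ?_
    gcongr
    linarith [le_abs_self D]

/-- The function `c`, cut off below the radius `1/ε`. -/
def truncated (c : RR n → ℂ) (ε : ℝ) (ξ : RR n) : ℂ := cutoff (ε • ξ) * c ξ

/-- By homogeneity all truncations are rescaled dilates of a single function. -/
lemma truncated_eq {q : ℂ} {c : RR n → ℂ} (hc : Homog q c) {ε : ℝ} (hε : 0 < ε) :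
    truncated c ε = fun ξ => ((ε : ℂ) ^ q)⁻¹ • (fun η => (cutoff η : ℂ) * c η) (ε • ξ) := by
  funext ξ
  by_cases hξ : ξ = 0
  · subst hξ
    simp [truncated, cutoff_of_norm_le (show ‖(0 : RR n)‖ ≤ 1 / 2 by simp)]
  · have h0 : (ε : ℂ) ^ q ≠ 0 := by
      rw [Complex.cpow_ne_zero_iff]
      left
      exact_mod_cast hε.ne'
    simp only [truncated, hc.2 ε hε ξ hξ, smul_eq_mul]
    field_simp

lemma contDiff_truncated {q : ℂ} {c : RR n → ℂ} (hc : Homog q c) {ε : ℝ} (hε : 0 < ε) :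
    ContDiff ℝ ∞ (truncated c ε) := by
  rw [truncated_eq hc hε]
  exact ((contDiff_cutoff_mul hc).comp (contDiff_id.const_smul ε)).const_smul _

/-- The constant does not depend on `ε`: the powers of `ε` from the scalar factor, from the bound at
`εξ` and from the chain rule multiply to `1`. Borel summation depends on this uniformity. -/
lemma truncated_bound {q : ℂ} {c : RR n → ℂ} (hc : Homog q c) (k : ℕ) :
    ∃ A : ℝ, 0 ≤ A ∧ ∀ ε : ℝ, 0 < ε → ∀ ξ : RR n, ξ ≠ 0 →
      ‖iteratedFDeriv ℝ k (truncated c ε) ξ‖ ≤ A * ‖ξ‖ ^ (q.re - k) := by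
  obtain ⟨A, hA, h⟩ := cutoff_mul_bound hc k
  refine ⟨A, hA, fun ε hε ξ hξ => ?_⟩
  have hpos : 0 < ‖ξ‖ := norm_pos_iff.2 hξ
  have hk : ((k : ℕ) : WithTop ℕ∞) ≤ ∞ := by exact_mod_cast le_top
  set g := fun ξ => (cutoff ξ : ℂ) * c ξ with hg
  have hgs : ContDiff ℝ ∞ g := contDiff_cutoff_mul hc
  let S : RR n →L[ℝ] RR n := ε • ContinuousLinearMap.id ℝ (RR n)
  have hS : ‖S‖ ≤ ε := by
    refine ContinuousLinearMap.opNorm_le_bound _ hε.le fun x => ?_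
    change ‖ε • x‖ ≤ _
    rw [norm_smul, Real.norm_of_nonneg hε.le]
  have h1 : truncated c ε = fun ξ => ((ε : ℂ) ^ q)⁻¹ • (g ∘ S) ξ := truncated_eq hc hε
  rw [h1, iteratedFDeriv_const_smul_apply'
    (((hgs.comp S.contDiff).of_le hk).contDiffAt), norm_smul, norm_inv,
    Complex.norm_cpow_eq_rpow_re_of_pos hε, ContinuousLinearMap.iteratedFDeriv_comp_right S hgs ξ hk]
  have h2 := (iteratedFDeriv ℝ k g (S ξ)).norm_compContinuousLinearMap_le fun _ => S
  have h3 : ‖iteratedFDeriv ℝ k g (S ξ)‖ ≤ A * ‖ε • ξ‖ ^ (q.re - k) :=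
    h (ε • ξ) (smul_ne_zero hε.ne' hξ)
  rw [norm_smul, Real.norm_of_nonneg hε.le, Real.mul_rpow hε.le hpos.le] at h3
  calc _ ≤ (ε ^ q.re)⁻¹ * ((A * (ε ^ (q.re - k) * ‖ξ‖ ^ (q.re - k))) * ε ^ k) := by
        gcongr
        refine h2.trans ?_
        rw [Finset.prod_const, Finset.card_univ, Fintype.card_fin]
        gcongr
    _ = A * ‖ξ‖ ^ (q.re - k) := by
        rw [Real.rpow_sub hε, Real.rpow_natCast]
        have : ε ^ q.re ≠ 0 := by positivity
        field_simp

lemma truncated_eq_zero {c : RR n → ℂ} {ε : ℝ} (hε : 0 < ε) {ξ : RR n} (h : ε * ‖ξ‖ ≤ 1 / 2) :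
    truncated c ε ξ = 0 := by
  rw [truncated, cutoff_of_norm_le (by rwa [norm_smul, Real.norm_of_nonneg hε.le])]
  simp

lemma truncated_eq_self {c : RR n → ℂ} {ε : ℝ} (hε : 0 < ε) {ξ : RR n} (h : 1 ≤ ε * ‖ξ‖) :
    truncated c ε ξ = c ξ := by
  rw [truncated, cutoff_of_le_norm (by rwa [norm_smul, Real.norm_of_nonneg hε.le])]
  simp

/-! ### Scalar symbols -/

/-- The scalar classical symbol `a` of order `q` has the asymptotic expansion `∑ c_j`. -/
structure ScalarExpansion (q : ℂ) (a : RR n → ℂ) (c : ℕ → RR n → ℂ) : Prop where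
  smooth : ContDiff ℝ ∞ a
  homog : ∀ j : ℕ, Homog (q - j) (c j)
  bound : ∀ (N k : ℕ), ∃ C : ℝ, ∀ ξ : RR n, 1 ≤ ‖ξ‖ →
    ‖iteratedFDeriv ℝ k (fun η => a η - ∑ j ∈ Finset.range N, c j η) ξ‖ ≤
      C * ‖ξ‖ ^ (q.re - N - k)

lemma sum_range_half_pow_le (J : ℕ) : ∑ j ∈ Finset.range J, (1 / 2 : ℝ) ^ j ≤ 2 := by
  have := Summable.sum_le_tsum (Finset.range J) (fun i _ => by positivity) summable_geometric_two
  rwa [tsum_geometric_two] at this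

/-- The difference lives on `‖ξ‖ ≤ 1/ε`, where `‖ξ‖ ^ m ≤ (1/ε) ^ m`; so any number `m` of orders
can be gained. -/
lemma norm_iteratedFDeriv_truncated_sub_le {p : ℂ} {c : RR n → ℂ} (hc : Homog p c) {ε : ℝ}
    (hε : 0 < ε) (m k : ℕ) : ∃ C : ℝ, 0 ≤ C ∧ ∀ ξ : RR n, 1 ≤ ‖ξ‖ →
      ‖iteratedFDeriv ℝ k (fun η => truncated c ε η - c η) ξ‖ ≤ C * ‖ξ‖ ^ (p.re - m - k) := by
  obtain ⟨A, hA, h⟩ := truncated_bound hc k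
  obtain ⟨B, hB, h'⟩ := hc.iteratedFDeriv_le k
  refine ⟨(A + B) * (1 / ε) ^ m, by positivity, fun ξ hξ => ?_⟩
  have hpos : 0 < ‖ξ‖ := by linarith
  have hξ0 : ξ ≠ 0 := norm_pos_iff.1 hpos
  have hk : ((k : ℕ) : WithTop ℕ∞) ≤ ∞ := by exact_mod_cast le_top
  by_cases h1 : 1 < ε * ‖ξ‖
  · have : (fun η => truncated c ε η - c η) =ᶠ[𝓝 ξ] fun _ => 0 := by
      filter_upwards [(isOpen_lt continuous_const (continuous_const.mul continuous_norm)).mem_nhds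
        h1] with x hx
      rw [truncated_eq_self hε (le_of_lt hx), sub_self]
    have h0 : iteratedFDeriv ℝ k (fun _ : RR n => (0 : ℂ)) ξ = 0 := by simp
    rw [iteratedFDeriv_of_eventuallyEq this, h0, norm_zero]
    positivity
  · have h2 : ‖ξ‖ ≤ 1 / ε := by
      rw [le_div_iff₀ hε, mul_comm]
      linarith
    rw [fun_iteratedFDeriv_sub_apply (((contDiff_truncated hc hε).of_le hk).contDiffAt)
      ((hc.contDiffAt hξ0).of_le hk)]
    refine (norm_sub_le _ _).trans ((add_le_add (h ε hε ξ hξ0) (h' ξ hξ0)).trans ?_)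
    have h3 : ‖ξ‖ ^ (p.re - k) = ‖ξ‖ ^ m * ‖ξ‖ ^ (p.re - m - k) := by
      rw [← Real.rpow_natCast, ← Real.rpow_add hpos]
      congr 1
      ring
    rw [← add_mul, h3, ← mul_assoc]
    gcongr

/-- Borel summation: every sequence of homogeneous functions is the asymptotic expansion of a
symbol. -/
theorem exists_scalarExpansion {q : ℂ} {c : ℕ → RR n → ℂ} (hc : ∀ j : ℕ, Homog (q - j) (c j)) :
    ∃ b, ScalarExpansion q b c := by
  choose A hA hbound using fun j k => truncated_bound (hc j) k
  -- The scale `ε j` makes `2 ε_j A_{j,k} ≤ 2^{-j}` for all `k ≤ j`. Where the `j`-th term is not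
  -- locally zero, `2 ε_j ‖ξ‖ ≥ 1`, so the constant `A_{j,k}` is traded for `2^{-j}` and one power
  -- of `‖ξ‖`.
  let S : ℕ → ℝ := fun j => ∑ k ∈ Finset.range (j + 1), A j k
  have hS : ∀ j, 0 ≤ S j := fun j => Finset.sum_nonneg fun k _ => hA j k
  let ε : ℕ → ℝ := fun j => (1 / 2) ^ j / (2 * (1 + S j))
  have hε : ∀ j, 0 < ε j := fun j => by
    have := hS j
    positivity
  have hε' : ∀ j, ε j ≤ (1 / 2) ^ j / 2 := fun j => by
    have := hS j
    refine div_le_div_of_nonneg_left (by positivity) (by norm_num) (by linarith)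
  let T : ℕ → RR n → ℂ := fun j => truncated (c j) (ε j)
  have hT : ∀ j, ContDiff ℝ ∞ (T j) := fun j => contDiff_truncated (hc j) (hε j)
  have hT0 : ∀ j (ξ : RR n), (1 / 2 : ℝ) ^ j * ‖ξ‖ ≤ 1 → T j ξ = 0 := by
    intro j ξ h
    refine truncated_eq_zero (hε j) ?_
    have := mul_le_mul_of_nonneg_right (hε' j) (norm_nonneg ξ)
    linarith
  have hre : ∀ j : ℕ, (q - j).re = q.re - j := fun j => by simp
  have hTk : ∀ j k (ξ : RR n), ξ ≠ 0 → ‖iteratedFDeriv ℝ k (T j) ξ‖ ≤ A j k * ‖ξ‖ ^ (q.re - j - k) := by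
    intro j k ξ hξ
    have := hbound j k (ε j) (hε j) ξ hξ
    rwa [hre] at this
  have hTk' : ∀ j k (ξ : RR n), k ≤ j → 1 ≤ ‖ξ‖ →
      ‖iteratedFDeriv ℝ k (T j) ξ‖ ≤ (1 / 2) ^ j * ‖ξ‖ ^ (q.re - j - k + 1) := by
    intro j k ξ hkj hξ
    have hpos : 0 < ‖ξ‖ := by linarith
    have hξ0 : ξ ≠ 0 := norm_pos_iff.1 hpos
    by_cases h1 : ε j * ‖ξ‖ < 1 / 2
    · have : T j =ᶠ[𝓝 ξ] fun _ => 0 := by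
        filter_upwards [(isOpen_lt (continuous_const.mul continuous_norm) continuous_const).mem_nhds
          h1] with x hx
        exact truncated_eq_zero (hε j) (le_of_lt hx)
      have h0 : iteratedFDeriv ℝ k (fun _ : RR n => (0 : ℂ)) ξ = 0 := by simp
      rw [iteratedFDeriv_of_eventuallyEq this, h0, norm_zero]
      positivity
    · rw [not_lt] at h1
      refine (hTk j k ξ hξ0).trans ?_
      have hAS : A j k ≤ S j := Finset.single_le_sum (f := fun k => A j k) (fun k _ => hA j k)
        (Finset.mem_range.2 (by omega))
      have h2 : A j k * (2 * ε j) ≤ (1 / 2) ^ j := by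
        have h3 : (2 * ε j) * (1 + S j) = (1 / 2) ^ j := by
          have := hS j
          simp only [ε]
          field_simp
        rw [← h3, mul_comm]
        have := hε j
        gcongr
        linarith
      rw [Real.rpow_add_one hpos.ne']
      have h4 : A j k ≤ (1 / 2) ^ j * ‖ξ‖ := by
        calc A j k ≤ A j k * (2 * (ε j * ‖ξ‖)) := le_mul_of_one_le_right (hA j k) (by linarith)
          _ = A j k * (2 * ε j) * ‖ξ‖ := by ring
          _ ≤ _ := by gcongr
      calc _ ≤ ((1 / 2) ^ j * ‖ξ‖) * ‖ξ‖ ^ (q.re - j - k) := by gcongr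
        _ = _ := by ring
  -- Only finitely many terms are nonzero on a given ball, so the series is locally a finite sum and
  -- smoothness is free.
  have hloc : ∀ R : ℝ, ∃ J₀ : ℕ, ∀ J, J₀ ≤ J → ∀ ξ : RR n, ‖ξ‖ < R →
      ∑' j, T j ξ = ∑ j ∈ Finset.range J, T j ξ := by
    intro R
    obtain ⟨J₀, hJ₀⟩ := exists_pow_lt_of_lt_one (show (0 : ℝ) < 1 / (|R| + 1) by positivity)
      (show (1 / 2 : ℝ) < 1 by norm_num)
    refine ⟨J₀, fun J hJ ξ hξ => tsum_eq_sum fun j hj => hT0 j ξ ?_⟩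
    rw [Finset.mem_range, not_lt] at hj
    have h1 : (1 / 2 : ℝ) ^ j ≤ 1 / (|R| + 1) :=
      (pow_le_pow_of_le_one (by norm_num) (by norm_num) (hJ.trans hj)).trans hJ₀.le
    calc (1 / 2 : ℝ) ^ j * ‖ξ‖ ≤ 1 / (|R| + 1) * (|R| + 1) := by
          gcongr
          linarith [le_abs_self R]
      _ = 1 := by field_simp
  have hev : ∀ ξ : RR n, ∃ J₀ : ℕ, ∀ J, J₀ ≤ J →
      (fun η => ∑' j, T j η) =ᶠ[𝓝 ξ] fun η => ∑ j ∈ Finset.range J, T j η := by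
    intro ξ
    obtain ⟨J₀, h⟩ := hloc (‖ξ‖ + 1)
    refine ⟨J₀, fun J hJ => ?_⟩
    filter_upwards [(isOpen_lt continuous_norm continuous_const).mem_nhds
      (show ‖ξ‖ < ‖ξ‖ + 1 by linarith)] with x hx
    exact h J hJ x hx
  refine ⟨fun ξ => ∑' j, T j ξ, ?_, hc, ?_⟩
  · rw [contDiff_iff_contDiffAt]
    intro ξ
    obtain ⟨J, h⟩ := hev ξ
    exact (ContDiff.sum fun j _ => hT j).contDiffAt.congr_of_eventuallyEq (h J le_rfl)
  · intro N k
    choose C hC hCb using fun j => norm_iteratedFDeriv_truncated_sub_le (hc j) (hε j)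
      (N - j) k
    refine ⟨∑ j ∈ Finset.range N, C j + (∑ j ∈ Finset.range (N + k + 1), A j k + 2), fun ξ hξ => ?_⟩
    have hpos : 0 < ‖ξ‖ := by linarith
    have hξ0 : ξ ≠ 0 := norm_pos_iff.1 hpos
    obtain ⟨J₀, hJ₀⟩ := hev ξ
    have hNJ : N ≤ J₀ + N := by omega
    have h1 : (fun η => ∑' j, T j η - ∑ j ∈ Finset.range N, c j η) =ᶠ[𝓝 ξ] fun η =>
        ∑ j ∈ Finset.range (J₀ + N), (T j η - if j < N then c j η else 0) := by
      filter_upwards [hJ₀ (J₀ + N) (by omega)] with η hη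
      rw [hη, Finset.sum_sub_distrib, ← Finset.sum_filter]
      congr 2
      ext j
      simp
      omega
    rw [iteratedFDeriv_of_eventuallyEq h1]
    refine (norm_iteratedFDeriv_sum_le _ _ fun j _ => ?_).trans ?_
    · split_ifs
      · exact (hT j).contDiffAt.sub ((hc j).contDiffAt hξ0)
      · exact (hT j).contDiffAt.sub contDiffAt_const
    -- The number of terms depends on `ξ`, so the constants must be summable in `j`. For `j < N` the
    -- term `c_j` is subtracted; for `N ≤ j ≤ N + k` the plain bound is used finitely often; for
    -- larger `j` both `k ≤ j` and the spare order `j ≥ N + 1` are available, and the constants form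
    -- a geometric series.
    have hterm : ∀ j ∈ Finset.range (J₀ + N),
        ‖iteratedFDeriv ℝ k (fun η => T j η - if j < N then c j η else 0) ξ‖ ≤
          ((if j < N then C j else 0) + ((if j < N + k + 1 then A j k else 0) + (1 / 2) ^ j)) *
            ‖ξ‖ ^ (q.re - N - k) := by
      intro j _
      by_cases hj : j < N
      · simp only [hj, if_true]
        have h2 := hCb j ξ hξ
        have h3 : (q - j).re - ((N - j : ℕ) : ℝ) - k = q.re - N - k := by
          rw [hre, Nat.cast_sub hj.le]
          ring
        rw [h3] at h2
        refine h2.trans ?_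
        gcongr
        have := hA j k
        have : 0 ≤ (if j < N + k + 1 then A j k else 0) + (1 / 2 : ℝ) ^ j := by
          split_ifs <;> positivity
        linarith
      · simp only [hj, if_false, sub_zero, zero_add]
        change ‖iteratedFDeriv ℝ k (T j) ξ‖ ≤ _
        by_cases hj2 : j < N + k + 1
        · simp only [hj2, if_true]
          refine (hTk j k ξ hξ0).trans ?_
          have : (N : ℝ) ≤ j := by exact_mod_cast not_lt.1 hj
          have := hA j k
          gcongr
          · have : (0 : ℝ) ≤ (1 / 2) ^ j := by positivity
            linarith
        · simp only [hj2, if_false, zero_add]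
          refine (hTk' j k ξ (by omega) hξ).trans ?_
          have : (N : ℝ) + 1 ≤ j := by exact_mod_cast (show N + 1 ≤ j by omega)
          gcongr
          linarith
    refine (Finset.sum_le_sum hterm).trans ?_
    rw [← Finset.sum_mul]
    gcongr
    rw [Finset.sum_add_distrib, Finset.sum_add_distrib, ← Finset.sum_filter, ← Finset.sum_filter]
    gcongr
    · exact fun j _ _ => hC j
    · intro j hj
      simp only [Finset.mem_filter, Finset.mem_range] at hj ⊢
      omega
    · exact fun j _ _ => hA j k
    · intro j hj
      simp only [Finset.mem_filter, Finset.mem_range] at hj ⊢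
      omega
    · exact sum_range_half_pow_le _

/-! ### Radial integrals of Schwartz functions -/

open scoped SchwartzMap

variable {G : Type*} [NormedAddCommGroup G] [NormedSpace ℝ G]

/-- The weighted integral of a Schwartz function along the rays through the origin. -/
def radialIntegral (S : Set ℝ) (m : ℕ) (B : 𝓢(RR n, G)) (ξ : RR n) : G :=
  ∫ t in S, t ^ m • B (t • ξ)

/-- Near `ξ₀`, the radial integrals over `S` converge uniformly. -/
def RadiallyBounded (S : Set ℝ) (ξ₀ : RR n) : Prop :=
  ∃ D : ℝ, 0 ≤ D ∧ ∀ᶠ ξ in 𝓝 ξ₀, ∀ t ∈ S, 1 + t ≤ D * (1 + t * ‖ξ‖)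

lemma radiallyBounded_Ioc (ξ₀ : RR n) : RadiallyBounded (Set.Ioc 0 1) ξ₀ := by
  refine ⟨2, by norm_num, Eventually.of_forall fun ξ t ht => ?_⟩
  have := mul_nonneg ht.1.le (norm_nonneg ξ)
  linarith [ht.2]

lemma radiallyBounded_Ioi {ξ₀ : RR n} (h : ξ₀ ≠ 0) : RadiallyBounded (Set.Ioi 0) ξ₀ := by
  have hpos : 0 < ‖ξ₀‖ := norm_pos_iff.2 h
  refine ⟨1 + 2 / ‖ξ₀‖, by positivity, ?_⟩
  filter_upwards [(isOpen_lt continuous_const continuous_norm).mem_nhds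
    (show ‖ξ₀‖ / 2 < ‖ξ₀‖ by linarith)] with ξ hξ t ht
  have ht' : 0 < t := ht
  have hξ' : ‖ξ₀‖ / 2 < ‖ξ‖ := hξ
  have h1 : 1 ≤ 2 / ‖ξ₀‖ * ‖ξ‖ := by
    rw [div_mul_eq_mul_div, le_div_iff₀ hpos]
    linarith
  have h2 : t ≤ 2 / ‖ξ₀‖ * (t * ‖ξ‖) := by nlinarith
  have h3 : 0 ≤ t * ‖ξ‖ := by positivity
  have h4 : 0 ≤ 2 / ‖ξ₀‖ := by positivity
  nlinarith

/-- Decay of order `m + 2` of `B` at `t • ξ`, converted into decay in `t` by the hypothesis, leaves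
the integrable majorant `(1 + t)^{-2}` after absorbing `t ^ m`. -/
lemma norm_pow_smul_schwartz_le (m : ℕ) (B : 𝓢(RR n, G)) : ∃ C : ℝ, 0 ≤ C ∧ ∀ (D t : ℝ) (ξ : RR n),
    0 ≤ D → 0 < t → 1 + t ≤ D * (1 + t * ‖ξ‖) →
      ‖t ^ m • B (t • ξ)‖ ≤ C * D ^ (m + 2) * (1 + ‖t‖) ^ (-2 : ℝ) := by
  obtain ⟨C, hC⟩ : ∃ C : ℝ, ∀ x : RR n, (1 + ‖x‖) ^ (m + 2) * ‖B x‖ ≤ C := by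
    refine ⟨2 ^ (m + 2) * ((Finset.Iic (m + 2, 0)).sup fun i => SchwartzMap.seminorm ℝ i.1 i.2) B,
      fun x => ?_⟩
    have := SchwartzMap.one_add_le_sup_seminorm_apply (𝕜 := ℝ) (m := (m + 2, 0)) le_rfl le_rfl B x
    rwa [norm_iteratedFDeriv_zero] at this
  have hC0 : 0 ≤ C := le_trans (by positivity) (hC 0)
  refine ⟨C, hC0, fun D t ξ hD ht h => ?_⟩
  have h1 := hC (t • ξ)
  rw [norm_smul, Real.norm_of_nonneg ht.le] at h1
  have hpos : 0 < 1 + t * ‖ξ‖ := by positivity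
  rw [norm_smul, norm_pow, Real.norm_of_nonneg ht.le, Real.rpow_neg (by positivity), ← div_eq_mul_inv,
    le_div_iff₀ (by positivity), show (2 : ℝ) = ((2 : ℕ) : ℝ) by norm_num, Real.rpow_natCast]
  calc t ^ m * ‖B (t • ξ)‖ * (1 + t) ^ 2 ≤ (1 + t) ^ m * ‖B (t • ξ)‖ * (1 + t) ^ 2 := by
        gcongr
        linarith
    _ = (1 + t) ^ (m + 2) * ‖B (t • ξ)‖ := by ring
    _ ≤ (D * (1 + t * ‖ξ‖)) ^ (m + 2) * ‖B (t • ξ)‖ := by gcongr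
    _ = D ^ (m + 2) * ((1 + t * ‖ξ‖) ^ (m + 2) * ‖B (t • ξ)‖) := by
        rw [mul_pow, mul_assoc]
    _ ≤ D ^ (m + 2) * C := by gcongr
    _ = _ := by ring

lemma continuous_radial_integrand (m : ℕ) (B : 𝓢(RR n, G)) (ξ : RR n) :
    Continuous fun t : ℝ => t ^ m • B (t • ξ) :=
  (continuous_id.pow m).smul (B.continuous.comp (continuous_id.smul continuous_const))

lemma aestronglyMeasurable_radial_integrand (S : Set ℝ) (m : ℕ) (B : 𝓢(RR n, G)) (ξ : RR n) :
    AEStronglyMeasurable (fun t : ℝ => t ^ m • B (t • ξ)) (volume.restrict S) :=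
  (continuous_radial_integrand m B ξ).aestronglyMeasurable

lemma integrable_one_add_norm_rpow : Integrable fun t : ℝ => (1 + ‖t‖) ^ (-2 : ℝ) :=
  integrable_one_add_norm (by simp)

lemma RadiallyBounded.integrableOn {S : Set ℝ} (hS : MeasurableSet S) (hS0 : S ⊆ Set.Ioi 0)
    {ξ : RR n} (h : RadiallyBounded S ξ) (m : ℕ) (B : 𝓢(RR n, G)) :
    IntegrableOn (fun t : ℝ => t ^ m • B (t • ξ)) S := by
  obtain ⟨D, hD, hev⟩ := h
  obtain ⟨C, hC, hb⟩ := norm_pow_smul_schwartz_le m B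
  refine Integrable.mono' ((integrable_one_add_norm_rpow.const_mul (C * D ^ (m + 2))).integrableOn)
    (aestronglyMeasurable_radial_integrand S m B ξ) ?_
  filter_upwards [ae_restrict_mem hS] with t ht
  exact hb D t ξ hD (hS0 ht) (hev.self_of_nhds t ht)

/-- Differentiation under the integral raises the weight exponent by one and replaces `B` by its
derivative, again a Schwartz function. -/
lemma RadiallyBounded.hasFDerivAt {S : Set ℝ} (hS : MeasurableSet S) (hS0 : S ⊆ Set.Ioi 0)
    {ξ : RR n} (h : RadiallyBounded S ξ) (m : ℕ) (B : 𝓢(RR n, G)) :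
    HasFDerivAt (radialIntegral S m B)
      (radialIntegral S (m + 1) (SchwartzMap.fderivCLM ℝ (RR n) G B) ξ) ξ := by
  have hint := h.integrableOn hS hS0 m B
  obtain ⟨D, hD, hev⟩ := h
  obtain ⟨C, hC, hb⟩ := norm_pow_smul_schwartz_le (m + 1) (SchwartzMap.fderivCLM ℝ (RR n) G B)
  refine hasFDerivAt_integral_of_dominated_of_fderiv_le (μ := volume.restrict S)
    (F := fun η t => t ^ m • B (t • η))
    (F' := fun η t => t ^ (m + 1) • SchwartzMap.fderivCLM ℝ (RR n) G B (t • η))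
    (bound := fun t => C * D ^ (m + 1 + 2) * (1 + ‖t‖) ^ (-2 : ℝ)) hev ?_ hint ?_ ?_ ?_ ?_
  · exact Eventually.of_forall fun η => aestronglyMeasurable_radial_integrand S m B η
  · exact aestronglyMeasurable_radial_integrand S (m + 1) _ ξ
  · filter_upwards [ae_restrict_mem hS] with t ht η hη
    exact hb D t η hD (hS0 ht) (hη t ht)
  · exact (integrable_one_add_norm_rpow.const_mul _).integrableOn
  · refine Eventually.of_forall fun t η _ => ?_
    have h1 : HasFDerivAt (fun η : RR n => t • η) (t • ContinuousLinearMap.id ℝ (RR n)) η :=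
      (hasFDerivAt_id η).const_smul t
    refine (((B.differentiableAt (x := t • η)).hasFDerivAt.comp η h1).const_smul (t ^ m)).congr_fderiv
      ?_
    refine ContinuousLinearMap.ext fun v => ?_
    simp [SchwartzMap.fderivCLM_apply, pow_succ, smul_smul]

/-- The quantifiers over the target space, `m` and `B` stay inside the induction, as all three
change when one differentiates. -/
lemma contDiffOn_radialIntegral {S : Set ℝ} (hS : MeasurableSet S) (hS0 : S ⊆ Set.Ioi 0)
    {Ω : Set (RR n)} (hΩ : IsOpen Ω) (h : ∀ ξ ∈ Ω, RadiallyBounded S ξ) (N : ℕ) :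
    ∀ {G : Type} [NormedAddCommGroup G] [NormedSpace ℝ G] (m : ℕ) (B : 𝓢(RR n, G)),
      ContDiffOn ℝ N (radialIntegral S m B) Ω := by
  induction N with
  | zero =>
    intro G _ _ m B
    exact contDiffOn_zero.2 fun ξ hξ =>
      ((h ξ hξ).hasFDerivAt hS hS0 m B).continuousAt.continuousWithinAt
  | succ N ih =>
    intro G _ _ m B
    push_cast
    rw [contDiffOn_succ_iff_fderiv_of_isOpen hΩ]
    refine ⟨fun ξ hξ => ((h ξ hξ).hasFDerivAt hS hS0 m B).differentiableAt.differentiableWithinAt,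
      by simp, ?_⟩
    exact (ih (m + 1) _).congr fun ξ hξ => ((h ξ hξ).hasFDerivAt hS hS0 m B).fderiv

lemma contDiffAt_radialIntegral_Ioi {ξ : RR n} (hξ : ξ ≠ 0) (m : ℕ) (B : 𝓢(RR n, ℂ)) :
    ContDiffAt ℝ ∞ (radialIntegral (Set.Ioi 0) m B) ξ := by
  have hΩ : IsOpen ({0}ᶜ : Set (RR n)) := isOpen_compl_singleton
  refine ContDiffOn.contDiffAt (s := {0}ᶜ) ?_ (hΩ.mem_nhds hξ)
  exact contDiffOn_infty.2 fun N => contDiffOn_radialIntegral measurableSet_Ioi le_rfl hΩ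
    (fun ξ hξ => radiallyBounded_Ioi hξ) N m B

lemma contDiff_radialIntegral_Ioc (m : ℕ) (B : 𝓢(RR n, ℂ)) :
    ContDiff ℝ ∞ (radialIntegral (Set.Ioc 0 1) m B) := by
  rw [← contDiffOn_univ]
  exact contDiffOn_infty.2 fun N => contDiffOn_radialIntegral measurableSet_Ioc
    (fun t ht => ht.1) isOpen_univ (fun ξ _ => radiallyBounded_Ioc ξ) N m B

/-! ### Schwartz functions which are divergences -/

open scoped SchwartzMap FourierTransform LineDeriv

lemma homog_coord_div_norm_sq (l : Fin n) :
    Homog (-1) (fun ξ : RR n => ((ξ l / ‖ξ‖ ^ 2 : ℝ) : ℂ)) := by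
  refine ⟨?_, fun t ht ξ hξ => ?_⟩
  · refine Complex.ofRealCLM.contDiff.comp_contDiffOn (ContDiffOn.div ?_ ?_ ?_)
    · exact (EuclideanSpace.proj (𝕜 := ℝ) l).contDiff.contDiffOn
    · exact (contDiff_norm_sq ℝ).contDiffOn
    · intro ξ hξ
      have : ‖ξ‖ ≠ 0 := norm_ne_zero_iff.2 hξ
      positivity
  · have h1 : ‖ξ‖ ≠ 0 := norm_ne_zero_iff.2 hξ
    have h2 : (‖ξ‖ : ℂ) ≠ 0 := by exact_mod_cast h1
    have h3 : (t : ℂ) ≠ 0 := by exact_mod_cast ht.ne'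
    rw [Complex.cpow_neg_one]
    simp only [norm_smul, Real.norm_of_nonneg ht.le, PiLp.smul_apply, smul_eq_mul]
    push_cast
    field_simp

lemma hasTemperateGrowth_cutoff_mul {c : RR n → ℂ} (hc : Homog (-1) c) :
    Function.HasTemperateGrowth fun ξ => (cutoff ξ : ℂ) * c ξ := by
  refine ⟨contDiff_cutoff_mul hc, fun k => ?_⟩
  obtain ⟨A, hA, h⟩ := cutoff_mul_bound hc k
  refine ⟨0, A * (1 / 4) ^ ((-1 : ℂ).re - k), fun ξ => ?_⟩
  rw [pow_zero, mul_one]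
  by_cases h1 : ‖ξ‖ < 1 / 2
  · have : (fun ξ => (cutoff ξ : ℂ) * c ξ) =ᶠ[𝓝 ξ] fun _ => 0 := by
      filter_upwards [(isOpen_lt continuous_norm continuous_const).mem_nhds h1] with x hx
      simp [cutoff_of_norm_le (le_of_lt hx)]
    have h0 : iteratedFDeriv ℝ k (fun _ : RR n => (0 : ℂ)) ξ = 0 := by simp
    rw [iteratedFDeriv_of_eventuallyEq this, h0, norm_zero]
    positivity
  · have h2 : (1 / 4 : ℝ) ≤ ‖ξ‖ := by linarith
    have hξ : ξ ≠ 0 := norm_pos_iff.1 (by linarith)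
    refine (h ξ hξ).trans ?_
    gcongr A * ?_
    refine Real.rpow_le_rpow_of_nonpos (by norm_num) h2 ?_
    have : (0 : ℝ) ≤ k := by positivity
    simp only [Complex.neg_re, Complex.one_re]
    linarith

/-- The class of `bump * H` in the Schwartz space. -/
def bumpMul (H : RR n → ℂ) (hH : ContDiff ℝ ∞ H) : 𝓢(RR n, ℂ) :=
  HasCompactSupport.toSchwartzMap (f := fun ξ => (bump n ξ : ℂ) * H ξ)
    (((bump n).hasCompactSupport.comp_left (g := fun x : ℝ => (x : ℂ)) Complex.ofReal_zero).mul_right)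
    ((Complex.ofRealCLM.contDiff.comp (bump n).contDiff).mul hH)

lemma bumpMul_apply (H : RR n → ℂ) (hH : ContDiff ℝ ∞ H) (ξ : RR n) :
    bumpMul H hH ξ = (bump n ξ : ℂ) * H ξ := rfl

lemma sum_coord_mul_fderiv {F : Type*} [NormedAddCommGroup F] [NormedSpace ℝ F]
    (L : RR n →L[ℝ] F) (ξ : RR n) : ∑ l, ξ l • L (EuclideanSpace.single l 1) = L ξ := by
  have h : ξ = ∑ l, ξ l • EuclideanSpace.single l (1 : ℝ) := by
    have := (EuclideanSpace.basisFun (Fin n) ℝ).sum_repr ξ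
    simpa using this.symm
  conv_rhs => rw [h]
  simp [map_sum, map_smul]

/-- Hadamard's formula: integrate `d/dt G(tξ)` from `0` to `1`. -/
lemma sum_coord_mul_radialIntegral (G : 𝓢(RR n, ℂ)) (hG : G 0 = 0) (ξ : RR n) :
    ∑ l, (ξ l : ℂ) * radialIntegral (Set.Ioc 0 1) 0 (∂_{EuclideanSpace.single l (1 : ℝ)} G) ξ = G ξ := by
  have hint : ∀ l, Integrable (fun t : ℝ => (ξ l : ℂ) * (t ^ 0 • (∂_{EuclideanSpace.single l (1 : ℝ)} G) (t • ξ)))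
      (volume.restrict (Set.Ioc 0 1)) := fun l =>
    Integrable.const_mul (IntegrableOn.integrable
      ((radiallyBounded_Ioc ξ).integrableOn measurableSet_Ioc (fun t ht => ht.1) 0 _)) _
  have h1 : ∑ l, (ξ l : ℂ) * radialIntegral (Set.Ioc 0 1) 0 (∂_{EuclideanSpace.single l (1 : ℝ)} G) ξ =
      ∫ t in Set.Ioc (0 : ℝ) 1, fderiv ℝ G (t • ξ) ξ := by
    simp only [radialIntegral]
    simp_rw [← MeasureTheory.integral_const_mul]
    rw [← integral_finsetSum _ fun l _ => hint l]
    refine integral_congr_ae (Eventually.of_forall fun t => ?_)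
    simp only [pow_zero, one_smul, SchwartzMap.lineDerivOp_apply_eq_fderiv]
    rw [← sum_coord_mul_fderiv (fderiv ℝ G (t • ξ)) ξ]
    simp
  rw [h1, ← intervalIntegral.integral_of_le zero_le_one]
  have hd : ∀ t ∈ Set.uIcc (0 : ℝ) 1, HasDerivAt (fun t : ℝ => G (t • ξ)) (fderiv ℝ G (t • ξ) ξ) t := by
    intro t _
    have h2 : HasDerivAt (fun t : ℝ => t • ξ) ξ t := by
      simpa using (hasDerivAt_id t).smul_const ξ
    exact (G.differentiableAt (x := t • ξ)).hasFDerivAt.comp_hasDerivAt t h2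
  rw [intervalIntegral.integral_eq_sub_of_hasDerivAt hd]
  · simp [hG]
  · refine Continuous.intervalIntegrable ?_ _ _
    have h3 : Continuous (fderiv ℝ G) := (SchwartzMap.fderivCLM ℝ (RR n) ℂ G).continuous
    exact (h3.comp (continuous_id.smul continuous_const)).clm_apply continuous_const

/-- Hadamard's coefficients are smooth but need not decay, so they are used only under the bump;
elsewhere `ξ_l / ‖ξ‖²` times `G` does the job. The two are glued by `bump + cutoff = 1`. -/
lemma exists_sum_coord_mul_eq (G : 𝓢(RR n, ℂ)) (hG : G 0 = 0) :
    ∃ h : Fin n → 𝓢(RR n, ℂ), ∀ ξ : RR n, ∑ l, (ξ l : ℂ) * h l ξ = G ξ := by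
  let H := fun l : Fin n => radialIntegral (Set.Ioc 0 1) 0 (∂_{EuclideanSpace.single l (1 : ℝ)} G)
  let κ := fun (l : Fin n) (ξ : RR n) => (cutoff ξ : ℂ) * ((ξ l / ‖ξ‖ ^ 2 : ℝ) : ℂ)
  refine ⟨fun l => bumpMul (H l) (contDiff_radialIntegral_Ioc 0 _) + SchwartzMap.smulLeftCLM ℂ (κ l) G,
    fun ξ => ?_⟩
  have hκ : ∀ l, Function.HasTemperateGrowth (κ l) := fun l =>
    hasTemperateGrowth_cutoff_mul (homog_coord_div_norm_sq l)
  have h1 := sum_coord_mul_radialIntegral G hG ξ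
  simp only [add_apply, bumpMul_apply, SchwartzMap.smulLeftCLM_apply_apply (hκ _),
    mul_add, Finset.sum_add_distrib]
  have h2 : ∑ l, (ξ l : ℂ) * ((bump n ξ : ℂ) * H l ξ) = (bump n ξ : ℂ) * G ξ := by
    rw [← h1, Finset.mul_sum]
    exact Finset.sum_congr rfl fun l _ => by simp only [H]; ring
  rw [h2]
  by_cases hξ : ξ = 0
  · subst hξ
    simp [hG]
  · have h3 : ‖ξ‖ ≠ 0 := norm_ne_zero_iff.2 hξ
    have h4 : ∑ l, (ξ l : ℂ) * (ξ l : ℂ) = (‖ξ‖ : ℂ) ^ 2 := by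
      have := EuclideanSpace.real_norm_sq_eq ξ
      rw [← Complex.ofReal_pow, this]
      push_cast
      exact Finset.sum_congr rfl fun l _ => by ring
    have h5 : ∑ l, (ξ l : ℂ) * (κ l ξ • G ξ) = (cutoff ξ : ℂ) * G ξ := by
      have h6 : ∀ l, (ξ l : ℂ) * (κ l ξ • G ξ) =
          ((ξ l : ℂ) * (ξ l : ℂ)) * ((cutoff ξ : ℂ) / (‖ξ‖ : ℂ) ^ 2 * G ξ) := fun l => by
        simp only [κ, smul_eq_mul]
        push_cast
        ring
      rw [Finset.sum_congr rfl fun l _ => h6 l, ← Finset.sum_mul, h4]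
      have : (‖ξ‖ : ℂ) ≠ 0 := by exact_mod_cast h3
      field_simp
    rw [h5, cutoff]
    push_cast
    ring

/-- A Schwartz function of integral zero is the divergence of a Schwartz vector field. -/
lemma exists_sum_lineDeriv_eq (g : 𝓢(RR n, ℂ)) (hg : ∫ ξ, g ξ = 0) :
    ∃ B : Fin n → 𝓢(RR n, ℂ), ∀ ξ : RR n,
      ∑ l, fderiv ℝ (B l) ξ (EuclideanSpace.single l 1) = g ξ := by
  -- The integral of `g` is the value of its Fourier transform at `0`. Hence that transform is a
  -- combination of the coordinates, which the inverse transform turns into partial derivatives, up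
  -- to `2πi`.
  have h0 : (𝓕 g) 0 = 0 := by
    rw [SchwartzMap.fourier_coe, Real.fourier_eq]
    simpa using hg
  obtain ⟨h, hh⟩ := exists_sum_coord_mul_eq (𝓕 g) h0
  have hp : (2 * Real.pi * Complex.I : ℂ) ≠ 0 := Complex.two_pi_I_ne_zero
  refine ⟨fun l => 𝓕⁻ ((2 * Real.pi * Complex.I : ℂ)⁻¹ • h l), fun ξ => ?_⟩
  have h1 : ∀ l, (fun x : RR n => inner ℝ x (EuclideanSpace.single l (1 : ℝ))).HasTemperateGrowth :=
    fun l => by fun_prop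
  have h2 : ∑ l, ∂_{EuclideanSpace.single l (1 : ℝ)} (𝓕⁻ ((2 * Real.pi * Complex.I : ℂ)⁻¹ • h l)) = g := by
    simp_rw [SchwartzMap.lineDerivOp_fourierInv_eq]
    rw [← FourierTransform.fourierInv_fourier_eq (F := 𝓢(RR n, ℂ)) g]
    rw [← FourierTransform.fourierInv_sum]
    congr 1
    ext x
    rw [← hh x]
    simp only [sum_apply, smul_apply,
      SchwartzMap.smulLeftCLM_apply_apply (h1 _)]
    refine Finset.sum_congr rfl fun l _ => ?_
    rw [smul_comm (inner ℝ x (EuclideanSpace.single l (1 : ℝ))), smul_inv_smul₀ hp]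
    simp [EuclideanSpace.inner_single_right]
  have h3 := DFunLike.congr_fun h2 ξ
  rw [← h3]
  simp only [sum_apply, SchwartzMap.lineDerivOp_apply_eq_fderiv]

/-! ### Homogeneous functions which are divergences -/

open scoped SchwartzMap

lemma Homog.mono_eq {F : Type*} [NormedAddCommGroup F] [NormedSpace ℝ F] [NormedSpace ℂ F]
    {p q : ℂ} {f : RR n → F} (hf : Homog p f) (h : p = q) : Homog q f := h ▸ hf

/-- Euler's identity, from the derivative of `f(tξ) = t^q f(ξ)` at `t = 1`. -/
lemma Homog.fderiv_self {q : ℂ} {f : RR n → ℂ} (hf : Homog q f) {ξ : RR n} (hξ : ξ ≠ 0) :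
    _root_.fderiv ℝ f ξ ξ = q * f ξ := by
  have h1 : HasDerivAt (fun t : ℝ => t • ξ) ξ 1 := by
    simpa using (hasDerivAt_id (1 : ℝ)).smul_const ξ
  have h2 : HasFDerivAt f (_root_.fderiv ℝ f ξ) ((fun t : ℝ => t • ξ) 1) := by
    simpa using ((hf.contDiffAt hξ).differentiableAt (by simp)).hasFDerivAt
  have h3 := h2.comp_hasDerivAt (1 : ℝ) h1
  have h4 : HasDerivAt (fun t : ℝ => (t : ℂ) ^ q * f ξ) (q * f ξ) 1 := by
    have h5 : HasDerivAt (fun z : ℂ => z ^ q) (q * ((1 : ℝ) : ℂ) ^ (q - 1)) ((1 : ℝ) : ℂ) := by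
      have := (hasDerivAt_id (((1 : ℝ) : ℂ))).cpow_const (c := q) (by simp)
      simpa using this
    have h6 := (h5.comp_ofReal).mul_const (f ξ)
    simpa using h6
  refine h3.unique (h4.congr_of_eventuallyEq ?_)
  filter_upwards [lt_mem_nhds (show (0 : ℝ) < 1 by norm_num)] with t ht
  exact hf.2 t ht ξ hξ

lemma Homog.coord_mul {q : ℂ} {f : RR n → ℂ} (hf : Homog q f) (l : Fin n) :
    Homog (q + 1) fun ξ => (ξ l : ℂ) * f ξ := by
  refine ⟨(ContDiff.contDiffOn (Complex.ofRealCLM.contDiff.comp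
    (EuclideanSpace.proj (𝕜 := ℝ) l).contDiff)).mul hf.1, fun t ht ξ hξ => ?_⟩
  have h3 : (t : ℂ) ≠ 0 := by exact_mod_cast ht.ne'
  simp only [hf.2 t ht ξ hξ, PiLp.smul_apply, smul_eq_mul]
  rw [Complex.cpow_add _ _ h3, Complex.cpow_one]
  push_cast
  ring

/-- The partial derivative in the direction of the `l`-th basis vector. -/
def pd (l : Fin n) (f : RR n → ℂ) (ξ : RR n) : ℂ := fderiv ℝ f ξ (EuclideanSpace.single l 1)

lemma homog_pd {q : ℂ} {f : RR n → ℂ} (hf : Homog q f) (l : Fin n) : Homog (q - 1) (pd l f) := by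
  have h := hf.fderiv
  refine ⟨h.1.clm_apply contDiffOn_const, fun t ht ξ hξ => ?_⟩
  rw [pd, h.2 t ht ξ hξ]
  rfl

/-- By Euler's identity, the divergence of the field `ξ f` is `(n + q) f`. -/
lemma exists_div_of_ne {q : ℂ} (hq : q ≠ -n) {f : RR n → ℂ} (hf : Homog q f) :
    ∃ c : Fin n → RR n → ℂ, (∀ l, Homog (q + 1) (c l)) ∧
      ∀ ξ : RR n, ξ ≠ 0 → ∑ l, pd l (c l) ξ = f ξ := by
  refine ⟨fun l ξ => (q + n)⁻¹ • ((ξ l : ℂ) * f ξ), fun l => (hf.coord_mul l).const_smul _,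
    fun ξ hξ => ?_⟩
  have hd := ((hf.contDiffAt hξ).differentiableAt (by simp)).hasFDerivAt
  have h1 : ∀ l, pd l (fun ξ => (q + n)⁻¹ • ((ξ l : ℂ) * f ξ)) ξ =
      (q + n)⁻¹ * (f ξ + (ξ l : ℂ) * fderiv ℝ f ξ (EuclideanSpace.single l 1)) := by
    intro l
    have h2 : HasFDerivAt (fun ξ : RR n => (ξ l : ℂ))
        (Complex.ofRealCLM.comp (EuclideanSpace.proj (𝕜 := ℝ) l)) ξ :=
      (Complex.ofRealCLM.comp (EuclideanSpace.proj (𝕜 := ℝ) l)).hasFDerivAt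
    have h3 := (h2.mul hd).const_smul (q + n)⁻¹
    rw [pd]
    refine (DFunLike.congr_fun h3.fderiv _).trans ?_
    simp
    ring
  rw [Finset.sum_congr rfl fun l _ => h1 l, ← Finset.mul_sum, Finset.sum_add_distrib]
  have h4 : ∑ l, (ξ l : ℂ) * fderiv ℝ f ξ (EuclideanSpace.single l 1) = q * f ξ := by
    rw [← hf.fderiv_self hξ, ← sum_coord_mul_fderiv (fderiv ℝ f ξ) ξ]
    simp
  rw [h4]
  have h5 : q + n ≠ 0 := fun h => hq (eq_neg_of_add_eq_zero_left h)
  simp only [Finset.sum_const, Finset.card_univ, Fintype.card_fin, nsmul_eq_mul]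
  field_simp
  ring

/-- Integration in polar coordinates. -/
lemma integral_eq_integral_sphere_integral_Ioi [NeZero n] {g : RR n → ℂ} (hg : Integrable g) :
    ∫ ξ, g ξ = ∫ η : Metric.sphere (0 : RR n) 1, (∫ s in Set.Ioi (0 : ℝ), s ^ (n - 1) • g (s • (η : RR n)))
      ∂((volume : Measure (RR n)).toSphere) := by
  have hmp := (volume : Measure (RR n)).measurePreserving_homeomorphUnitSphereProd
  have hemb := (homeomorphUnitSphereProd (RR n)).measurableEmbedding
  rw [finrank_euclideanSpace_fin] at hmp
  let h : Metric.sphere (0 : RR n) 1 × Set.Ioi (0 : ℝ) → ℂ := fun x => g ((x.2 : ℝ) • (x.1 : RR n))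
  have hh : ∀ x : ({(0 : RR n)}ᶜ : Set (RR n)), h (homeomorphUnitSphereProd (RR n) x) = g x := by
    intro x
    have : ‖(x : RR n)‖ ≠ 0 := norm_ne_zero_iff.2 x.2
    simp [h, smul_smul, this]
  have hgc : Integrable (fun x : ({(0 : RR n)}ᶜ : Set (RR n)) => g x) (Measure.comap Subtype.val volume) :=
    (integrableOn_iff_comap_subtypeVal (measurableSet_singleton _).compl).1 hg.integrableOn
  have hint : Integrable h ((volume : Measure (RR n)).toSphere.prod (.volumeIoiPow (n - 1))) := by
    rw [← hmp.integrable_comp_emb hemb]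
    exact hgc.congr (Eventually.of_forall fun x => (hh x).symm)
  calc ∫ ξ, g ξ = ∫ x : ({(0 : RR n)}ᶜ : Set (RR n)), g x ∂(Measure.comap Subtype.val volume) := by
        rw [integral_subtype_comap (measurableSet_singleton _).compl g, restrict_compl_singleton]
    _ = ∫ x, h x ∂((volume : Measure (RR n)).toSphere.prod (.volumeIoiPow (n - 1))) := by
        rw [← hmp.integral_comp hemb]
        exact integral_congr_ae (Eventually.of_forall fun x => (hh x).symm)
    _ = ∫ η, (∫ s, h (η, s) ∂(.volumeIoiPow (n - 1))) ∂((volume : Measure (RR n)).toSphere) :=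
        integral_prod _ hint
    _ = _ := by
        refine integral_congr_ae (Eventually.of_forall fun η => ?_)
        simp only [Measure.volumeIoiPow, ENNReal.ofReal, h]
        rw [integral_withDensity_eq_integral_smul,
          integral_subtype_comap measurableSet_Ioi
            fun a : ℝ ↦ Real.toNNReal (a ^ (n - 1)) • g (a • (η : RR n)),
          setIntegral_congr_fun measurableSet_Ioi fun x hx ↦ ?_]
        · simp only [NNReal.smul_def]
          rw [Real.coe_toNNReal _ (pow_nonneg (le_of_lt hx) _)]
        · exact (measurable_subtype_coe.pow_const _).real_toNNReal

/-- The radial derivative of the cutoff, times a function homogeneous of degree `-n`. -/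
lemma exists_schwartz_radial {f : RR n → ℂ} (hf : Homog (-n) f) (hn : 1 ≤ n) :
    ∃ g : 𝓢(RR n, ℂ), ∀ ξ : RR n, ξ ≠ 0 → radialIntegral (Set.Ioi 0) (n - 1) g ξ = f ξ := by
  let κ : RR n → ℂ := fun ξ => ((fderiv ℝ cutoff ξ ξ : ℝ) : ℂ)
  have hκ : ContDiff ℝ ∞ κ := Complex.ofRealCLM.contDiff.comp
    ((contDiff_cutoff.fderiv_right (m := ∞) (by simp)).clm_apply contDiff_id)
  have h0 : ∀ ξ : RR n, ‖ξ‖ < 1 / 2 → κ ξ = 0 := by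
    intro ξ h
    have : (cutoff : RR n → ℝ) =ᶠ[𝓝 ξ] fun _ => 0 := by
      filter_upwards [(isOpen_lt continuous_norm continuous_const).mem_nhds h] with x hx
      exact cutoff_of_norm_le (le_of_lt hx)
    simp [κ, this.fderiv_eq]
  have h1 : ∀ ξ : RR n, 1 < ‖ξ‖ → κ ξ = 0 := by
    intro ξ h
    have : (cutoff : RR n → ℝ) =ᶠ[𝓝 ξ] fun _ => 1 := by
      filter_upwards [(isOpen_lt continuous_const continuous_norm).mem_nhds h] with x hx
      exact cutoff_of_le_norm (le_of_lt hx)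
    simp [κ, this.fderiv_eq]
  have hs : ContDiff ℝ ∞ fun ξ => κ ξ * f ξ := by
    rw [contDiff_iff_contDiffAt]
    intro ξ
    by_cases hξ : ξ = 0
    · have : (fun ξ => κ ξ * f ξ) =ᶠ[𝓝 ξ] fun _ => 0 := by
        subst hξ
        filter_upwards [Metric.ball_mem_nhds (0 : RR n) (show (0 : ℝ) < 1 / 2 by norm_num)] with x hx
        rw [h0 x (by simpa using hx), zero_mul]
      exact contDiffAt_const.congr_of_eventuallyEq this
    · exact hκ.contDiffAt.mul (hf.contDiffAt hξ)
  have hc : HasCompactSupport fun ξ => κ ξ * f ξ := by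
    refine HasCompactSupport.intro (isCompact_closedBall (0 : RR n) 1) fun ξ hξ => ?_
    rw [h1 ξ (by simpa using hξ), zero_mul]
  refine ⟨hc.toSchwartzMap hs, fun ξ hξ => ?_⟩
  have hg : ∀ x, (hc.toSchwartzMap hs) x = κ x * f x := fun x => rfl
  have hpos : 0 < ‖ξ‖ := norm_pos_iff.2 hξ
  have hd : ∀ s ∈ Set.Ici (0 : ℝ), HasDerivAt (fun s : ℝ => (cutoff (s • ξ) : ℂ) * f ξ)
      (((fderiv ℝ cutoff (s • ξ) ξ : ℝ) : ℂ) * f ξ) s := by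
    intro s _
    have h2 : HasDerivAt (fun s : ℝ => s • ξ) ξ s := by
      simpa using (hasDerivAt_id s).smul_const ξ
    have h3 := ((contDiff_cutoff (n := n)).differentiable (by simp) (s • ξ)).hasFDerivAt.comp_hasDerivAt
      s h2
    exact (h3.ofReal_comp).mul_const (f ξ)
  have hnn : n - 1 + 1 = n := by omega
  -- Degree `-n` exactly cancels `s ^ (n - 1)` and the factor `s` of the radial derivative. The
  -- integrand is then `d/ds` of `cutoff(sξ) f(ξ)`, which runs from `0` to `f(ξ)`.
  have heq : ∀ s ∈ Set.Ioi (0 : ℝ), s ^ (n - 1) • (hc.toSchwartzMap hs) (s • ξ) =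
      ((fderiv ℝ cutoff (s • ξ) ξ : ℝ) : ℂ) * f ξ := by
    intro s hs'
    have hs0 : (0 : ℝ) < s := hs'
    have hsc : (s : ℂ) ≠ 0 := by exact_mod_cast hs0.ne'
    rw [hg, hf.2 s hs0 ξ hξ, Complex.cpow_neg, Complex.cpow_natCast]
    have h4 : (s : ℂ) ^ n = (s : ℂ) ^ (n - 1) * s := by rw [← pow_succ, hnn]
    simp only [κ, map_smul, smul_eq_mul, Complex.real_smul, h4]
    push_cast
    field_simp
  have hint := (radiallyBounded_Ioi hξ).integrableOn measurableSet_Ioi le_rfl (n - 1)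
    (hc.toSchwartzMap hs)
  have hlim : Tendsto (fun s : ℝ => (cutoff (s • ξ) : ℂ) * f ξ) atTop (𝓝 (f ξ)) := by
    refine tendsto_const_nhds.congr' ?_
    filter_upwards [eventually_ge_atTop (1 / ‖ξ‖)] with s hs'
    have hs0 : 0 < s := lt_of_lt_of_le (by positivity) hs'
    rw [cutoff_of_le_norm]
    · simp
    · rw [norm_smul, Real.norm_of_nonneg hs0.le]
      rwa [div_le_iff₀ hpos] at hs'
  rw [radialIntegral, setIntegral_congr_fun measurableSet_Ioi heq,
    integral_Ioi_of_hasDerivAt_of_tendsto' hd (hint.congr_fun heq measurableSet_Ioi) hlim]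
  simp [cutoff_of_norm_le (show ‖(0 : RR n)‖ ≤ 1 / 2 by simp)]

/-- Change of variable along the ray: `t ^ m dt` accounts for the `m + 1` in the degree. -/
lemma homog_radialIntegral (B : 𝓢(RR n, ℂ)) (m : ℕ) :
    Homog (-(m + 1 : ℕ)) (radialIntegral (Set.Ioi 0) m B) := by
  refine ⟨fun ξ hξ => (contDiffAt_radialIntegral_Ioi hξ m B).contDiffWithinAt, fun t ht ξ _ => ?_⟩
  have hsc : (t : ℂ) ≠ 0 := by exact_mod_cast ht.ne'
  have h1 := integral_comp_mul_right_Ioi (fun x : ℝ => x ^ m • B (x • ξ)) 0 ht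
  rw [zero_mul] at h1
  have h2 : ∀ x : ℝ, x ^ m • B (x • t • ξ) = (t ^ m)⁻¹ • ((x * t) ^ m • B ((x * t) • ξ)) := by
    intro x
    rw [smul_smul, smul_smul, mul_pow]
    congr 1
    have := ht.ne'
    field_simp
  simp only [radialIntegral]
  simp_rw [h2]
  rw [integral_smul, h1, Complex.cpow_neg, Complex.cpow_natCast]
  simp only [Complex.real_smul, smul_eq_mul]
  push_cast
  field_simp
  ring

/-- A function of degree `-n` whose integral over the sphere vanishes is the divergence of a
homogeneous vector field. -/
lemma exists_div_of_integral_sphere_eq_zero (hn : 2 ≤ n) {f : RR n → ℂ} (hf : Homog (-n) f)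
    (h0 : ∫ η : Metric.sphere (0 : RR n) 1, f η ∂((volume : Measure (RR n)).toSphere) = 0) :
    ∃ c : Fin n → RR n → ℂ, (∀ l, Homog (-n + 1) (c l)) ∧
      ∀ ξ : RR n, ξ ≠ 0 → ∑ l, pd l (c l) ξ = f ξ := by
  have : NeZero n := ⟨by omega⟩
  obtain ⟨g, hg⟩ := exists_schwartz_radial hf (by omega)
  -- In polar coordinates the inner integral of `g` along a ray is `f` at the point of the sphere.
  have hg0 : ∫ ξ, g ξ = 0 := by
    rw [integral_eq_integral_sphere_integral_Ioi g.integrable, ← h0]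
    refine integral_congr_ae (Eventually.of_forall fun η => hg η ?_)
    intro h
    have := η.2
    rw [h] at this
    simp at this
  obtain ⟨B, hB⟩ := exists_sum_lineDeriv_eq g hg0
  -- One differentiation raises the weight `n - 2` to the `n - 1` with which `g` represents `f`;
  -- this exponent uses `n ≥ 2` and gives the degree `-n + 1`.
  refine ⟨fun l => radialIntegral (Set.Ioi 0) (n - 2) (B l), fun l => ?_, fun ξ hξ => ?_⟩
  · refine (homog_radialIntegral (B l) (n - 2)).mono_eq ?_
    rw [show n - 2 + 1 = n - 1 by omega, Nat.cast_sub (by omega)]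
    push_cast
    ring
  · have hr := radiallyBounded_Ioi hξ
    rw [← hg ξ hξ]
    have hint : ∀ l, IntegrableOn (fun t : ℝ => t ^ (n - 1) •
        SchwartzMap.fderivCLM ℝ (RR n) ℂ (B l) (t • ξ)) (Set.Ioi 0) := fun l =>
      hr.integrableOn measurableSet_Ioi le_rfl (n - 1) _
    have h1 : ∀ l, pd l (radialIntegral (Set.Ioi 0) (n - 2) (B l)) ξ =
        ∫ t in Set.Ioi (0 : ℝ), t ^ (n - 1) • fderiv ℝ (B l) (t • ξ) (EuclideanSpace.single l 1) := by
      intro l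
      rw [pd, (hr.hasFDerivAt measurableSet_Ioi le_rfl (n - 2) (B l)).fderiv,
        show n - 2 + 1 = n - 1 by omega, radialIntegral,
        ContinuousLinearMap.integral_apply (hint l)]
      rfl
    rw [Finset.sum_congr rfl fun l _ => h1 l, ← integral_finsetSum, radialIntegral]
    · refine integral_congr_ae (Eventually.of_forall fun t => ?_)
      simp only
      rw [← hB (t • ξ), Finset.smul_sum]
    · exact fun l _ => (hint l).apply_continuousLinearMap _

/-! ### Taylor expansion of homogeneous functions -/

lemma homog_iterate_pd {q : ℂ} {f : RR n → ℂ} (hf : Homog q f) (l : Fin n) (m : ℕ) :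
    Homog (q - m) ((pd l)^[m] f) := by
  induction m with
  | zero => simpa using hf
  | succ m ih =>
    rw [Function.iterate_succ_apply']
    refine (homog_pd ih l).mono_eq ?_
    push_cast
    ring

lemma iterate_pd_sum {ι : Type*} (S : Finset ι) (l : Fin n) {p : ι → ℂ} {f : ι → RR n → ℂ}
    (hf : ∀ i, Homog (p i) (f i)) (w : ι → ℂ) (s : ℕ) :
    ∀ ξ : RR n, ξ ≠ 0 → (pd l)^[s] (fun ξ => ∑ i ∈ S, w i • f i ξ) ξ =
      ∑ i ∈ S, w i • (pd l)^[s] (f i) ξ := by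
  induction s with
  | zero => exact fun ξ _ => rfl
  | succ s ih =>
    intro ξ hξ
    have h1 : (pd l)^[s] (fun ξ => ∑ i ∈ S, w i • f i ξ) =ᶠ[𝓝 ξ]
        fun ξ => ∑ i ∈ S, w i • (pd l)^[s] (f i) ξ := by
      filter_upwards [isOpen_compl_singleton.mem_nhds hξ] with x hx
      exact ih x hx
    have h2 : HasFDerivAt (fun ξ => ∑ i ∈ S, w i • (pd l)^[s] (f i) ξ)
        (∑ i ∈ S, w i • fderiv ℝ ((pd l)^[s] (f i)) ξ) ξ :=
      HasFDerivAt.fun_sum fun i _ => ((((homog_iterate_pd (hf i) l s).contDiffAt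
        hξ).differentiableAt (by simp)).hasFDerivAt).const_smul (w i)
    simp only [Function.iterate_succ_apply']
    rw [pd, h1.fderiv_eq, h2.fderiv]
    simp [pd]

/-- Here `h m` plays the `m`-th derivative of `h 0`. The derivative of a Taylor remainder of `h 0`
is the remainder of `h 1` of one order less, so the mean value inequality closes the induction; the
factorial gain in the constant is not needed. -/
lemma norm_sub_taylor_le (K : ℕ) : ∀ (h : ℕ → ℝ → ℂ) (C : ℝ),
    (∀ m, ∀ t ∈ Set.Icc (0 : ℝ) 1, HasDerivAt (h m) (h (m + 1) t) t) →
    (∀ t ∈ Set.Icc (0 : ℝ) 1, ‖h K t‖ ≤ C) → ∀ t ∈ Set.Icc (0 : ℝ) 1,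
      ‖h 0 t - ∑ s ∈ Finset.range K, ((t ^ s / s.factorial : ℝ) : ℂ) * h s 0‖ ≤ C := by
  induction K with
  | zero => exact fun h C _ hC t ht => by simpa using hC t ht
  | succ K ih =>
    intro h C hd hC t ht
    have h1 := ih (fun m => h (m + 1)) C (fun m => hd (m + 1)) hC
    have hC0 : 0 ≤ C := (norm_nonneg _).trans (hC t ht)
    have h2 : ∀ u ∈ Set.Icc (0 : ℝ) 1, HasDerivAt
        (fun t => h 0 t - ∑ s ∈ Finset.range (K + 1), ((t ^ s / s.factorial : ℝ) : ℂ) * h s 0)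
        (h 1 u - ∑ s ∈ Finset.range K, ((u ^ s / s.factorial : ℝ) : ℂ) * h (s + 1) 0) u := by
      intro u hu
      refine (hd 0 u hu).sub ?_
      simp_rw [Finset.sum_range_succ']
      have h3 : HasDerivAt (fun t : ℝ => ∑ s ∈ Finset.range K,
          ((t ^ (s + 1) / (s + 1).factorial : ℝ) : ℂ) * h (s + 1) 0)
          (∑ s ∈ Finset.range K, ((u ^ s / s.factorial : ℝ) : ℂ) * h (s + 1) 0) u := by
        refine HasDerivAt.fun_sum fun s _ => ?_
        have h4 : HasDerivAt (fun t : ℝ => t ^ (s + 1) / (s + 1).factorial) (u ^ s / s.factorial) u := by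
          have := (hasDerivAt_pow (s + 1) u).div_const ((s + 1).factorial : ℝ)
          refine this.congr_deriv ?_
          rw [Nat.factorial_succ]
          push_cast
          have : (s.factorial : ℝ) ≠ 0 := by exact_mod_cast s.factorial_ne_zero
          have : (s : ℝ) + 1 ≠ 0 := by positivity
          field_simp
        exact (h4.ofReal_comp).mul_const _
      simpa using h3.add_const (h 0 0)
    have h5 := Convex.norm_image_sub_le_of_norm_hasDerivWithin_le
      (fun u hu => (h2 u hu).hasDerivWithinAt) h1 (convex_Icc (0 : ℝ) 1)
      (Set.left_mem_Icc.2 zero_le_one) ht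
    have h6 : h 0 0 - ∑ s ∈ Finset.range (K + 1), (((0 : ℝ) ^ s / s.factorial : ℝ) : ℂ) * h s 0 = 0 := by
      rw [Finset.sum_range_succ']
      simp
    rw [h6, sub_zero, sub_zero, Real.norm_of_nonneg ht.1] at h5
    exact h5.trans (mul_le_of_le_one_right hC0 ht.2)

lemma rpow_le_two_rpow_mul {x y : ℝ} (r : ℝ) (hx : 0 < x) (h1 : x / 2 ≤ y) (h2 : y ≤ 2 * x) :
    y ^ r ≤ 2 ^ |r| * x ^ r := by
  have hy : 0 < y := by linarith
  have h3 : y ^ r = (y / x) ^ r * x ^ r := by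
    rw [← Real.mul_rpow (by positivity) hx.le, div_mul_cancel₀ _ hx.ne']
  rw [h3]
  gcongr
  rcases le_total 0 r with hr | hr
  · rw [abs_of_nonneg hr]
    refine Real.rpow_le_rpow (by positivity) ?_ hr
    rwa [div_le_iff₀ hx]
  · rw [abs_of_nonpos hr, Real.rpow_neg (by norm_num), ← Real.inv_rpow (by norm_num)]
    refine Real.rpow_le_rpow_of_nonpos (by norm_num) ?_ hr
    rw [le_div_iff₀ hx]
    linarith

lemma norm_add_smul_single {ξ : RR n} (hξ : 2 ≤ ‖ξ‖) {t : ℝ} (ht : t ∈ Set.Icc (0 : ℝ) 1) (l : Fin n) :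
    1 ≤ ‖ξ + t • EuclideanSpace.single l (1 : ℝ)‖ ∧
      ‖ξ‖ / 2 ≤ ‖ξ + t • EuclideanSpace.single l (1 : ℝ)‖ ∧
      ‖ξ + t • EuclideanSpace.single l (1 : ℝ)‖ ≤ 2 * ‖ξ‖ := by
  have h1 : ‖t • EuclideanSpace.single l (1 : ℝ)‖ ≤ 1 := by
    rw [norm_smul, PiLp.norm_single, norm_one, mul_one, Real.norm_of_nonneg ht.1]
    exact ht.2
  have h2 := norm_add_le ξ (t • EuclideanSpace.single l (1 : ℝ))
  have h3 := norm_sub_norm_le ξ (-(t • EuclideanSpace.single l (1 : ℝ)))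
  rw [sub_neg_eq_add, norm_neg] at h3
  refine ⟨?_, ?_, ?_⟩ <;> linarith

/-- Taylor's formula on the segment from `ξ` to `ξ + e_l`. For `‖ξ‖ ≥ 2` the segment avoids the
origin and has norms comparable to `‖ξ‖`, so homogeneity of the next derivative bounds the
remainder. -/
lemma Homog.norm_shift_sub_taylor_le {q : ℂ} {f : RR n → ℂ} (hf : Homog q f) (l : Fin n) (K : ℕ) :
    ∃ C : ℝ, ∀ ξ : RR n, 2 ≤ ‖ξ‖ →
      ‖f (ξ + EuclideanSpace.single l 1) - f ξ -
        ∑ s ∈ Finset.range K, ((s + 1).factorial : ℂ)⁻¹ * (pd l)^[s + 1] f ξ‖ ≤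
      C * ‖ξ‖ ^ (q.re - (K + 1)) := by
  obtain ⟨C, hC, hb⟩ := (homog_iterate_pd hf l (K + 1)).norm_le
  refine ⟨C * 2 ^ |q.re - (K + 1)|, fun ξ hξ => ?_⟩
  have hpos : 0 < ‖ξ‖ := by linarith
  have hne : ∀ t ∈ Set.Icc (0 : ℝ) 1, ξ + t • EuclideanSpace.single l (1 : ℝ) ≠ 0 := fun t ht =>
    norm_pos_iff.1 (by linarith [(norm_add_smul_single hξ ht l).1])
  have h1 := norm_sub_taylor_le (K + 1) (fun m t => (pd l)^[m] f (ξ + t • EuclideanSpace.single l (1 : ℝ)))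
    (C * 2 ^ |q.re - (K + 1)| * ‖ξ‖ ^ (q.re - (K + 1))) (fun m t ht => ?_) (fun t ht => ?_) 1
    (Set.right_mem_Icc.2 zero_le_one)
  · refine le_trans (le_of_eq ?_) h1
    rw [Finset.sum_range_succ']
    simp only [one_smul, zero_smul, add_zero, Function.iterate_zero, id_eq, one_pow]
    congr 1
    simp only [Nat.factorial_zero, Nat.cast_one, div_one, Complex.ofReal_one, one_mul, one_div]
    push_cast
    ring
  · have h2 : HasDerivAt (fun t : ℝ => ξ + t • EuclideanSpace.single l (1 : ℝ))
        (EuclideanSpace.single l (1 : ℝ)) t := by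
      simpa using ((hasDerivAt_id t).smul_const (EuclideanSpace.single l (1 : ℝ))).const_add ξ
    have h3 := (((homog_iterate_pd hf l m).contDiffAt (hne t ht)).differentiableAt
      (by simp)).hasFDerivAt.comp_hasDerivAt t h2
    rw [Function.iterate_succ_apply']
    exact h3
  · obtain ⟨_, h4, h5⟩ := norm_add_smul_single hξ ht l
    refine (hb _ (hne t ht)).trans ?_
    have h6 : (q - ((K + 1 : ℕ) : ℂ)).re = q.re - (K + 1) := by simp
    rw [h6, mul_assoc]
    gcongr
    exact rpow_le_two_rpow_mul _ hpos h4 h5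

/-! ### Symbols as sums of difference symbols -/

/-- The coefficients of the power series `X / (exp X - 1)`. -/
def toddCoeff (m : ℕ) : ℂ :=
  PowerSeries.coeff m (PowerSeries.mk fun s => ((s + 1).factorial : ℂ)⁻¹)⁻¹

lemma sum_antidiagonal_toddCoeff (r : ℕ) :
    ∑ p ∈ Finset.HasAntidiagonal.antidiagonal r, toddCoeff p.1 * ((p.2 + 1).factorial : ℂ)⁻¹ = if r = 0 then 1 else 0 := by
  have h : (PowerSeries.mk fun s => ((s + 1).factorial : ℂ)⁻¹)⁻¹ *
      (PowerSeries.mk fun s => ((s + 1).factorial : ℂ)⁻¹) = 1 :=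
    PowerSeries.inv_mul_cancel _ (by simp [← PowerSeries.coeff_zero_eq_constantCoeff_apply])
  have h2 := congrArg (PowerSeries.coeff r) h
  rw [PowerSeries.coeff_mul, PowerSeries.coeff_one] at h2
  simpa [toddCoeff] using h2

/-- With `F i k` standing for `∂^k d_i`, this is `(exp ∂ - 1) · ∂/(exp ∂ - 1) = ∂`, truncated by
total order. In the terms with `j + s = r`, the coefficient of `F i (r - i + 1)` is a Cauchy product
coefficient, equal to `1` for `i = r` and `0` otherwise. -/
lemma sum_toddCoeff_regroup (F : ℕ → ℕ → ℂ) (M : ℕ) :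
    ∑ j ∈ Finset.range M, ∑ s ∈ Finset.range (M - j), ((s + 1).factorial : ℂ)⁻¹ *
      ∑ p ∈ Finset.HasAntidiagonal.antidiagonal j, toddCoeff p.1 * F p.2 (p.1 + s + 1) =
    ∑ r ∈ Finset.range M, F r 1 := by
  have h1 : ∀ r ∈ Finset.range M, F r 1 = ∑ i ∈ Finset.range (r + 1), ∑ p ∈ Finset.HasAntidiagonal.antidiagonal (r - i),
      ((p.2 + 1).factorial : ℂ)⁻¹ * (toddCoeff p.1 * F i (p.1 + p.2 + 1)) := by
    intro r _
    have h2 : ∀ i ∈ Finset.range (r + 1), ∑ p ∈ Finset.HasAntidiagonal.antidiagonal (r - i),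
        ((p.2 + 1).factorial : ℂ)⁻¹ * (toddCoeff p.1 * F i (p.1 + p.2 + 1)) =
        if r - i = 0 then F i (r - i + 1) else 0 := by
      intro i _
      rw [← one_mul (F i (r - i + 1)), ← zero_mul (F i (r - i + 1)), ← ite_mul,
        ← sum_antidiagonal_toddCoeff, Finset.sum_mul]
      refine Finset.sum_congr rfl fun p hp => ?_
      rw [Finset.HasAntidiagonal.mem_antidiagonal.1 hp]
      ring
    rw [Finset.sum_congr rfl h2, Finset.sum_eq_single r]
    · simp
    · intro i hi hne
      rw [Finset.mem_range] at hi
      rw [if_neg (by omega)]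
    · simp
  rw [Finset.sum_congr rfl h1]
  simp_rw [Finset.mul_sum, Finset.sum_sigma']
  refine Finset.sum_nbij' (fun x => ⟨x.1 + x.2.1, ⟨x.2.2.2, (x.2.2.1, x.2.1)⟩⟩)
    (fun x => ⟨x.2.2.1 + x.2.1, ⟨x.2.2.2, (x.2.2.1, x.2.1)⟩⟩) ?_ ?_ ?_ ?_ ?_
  · rintro ⟨j, ⟨s, ⟨m, i⟩⟩⟩ h
    simp only [Finset.mem_sigma, Finset.mem_range, Finset.HasAntidiagonal.mem_antidiagonal] at h ⊢
    omega
  · rintro ⟨r, ⟨i, ⟨m, s⟩⟩⟩ h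
    simp only [Finset.mem_sigma, Finset.mem_range, Finset.HasAntidiagonal.mem_antidiagonal] at h ⊢
    obtain ⟨h1, h2, h3⟩ := h
    exact ⟨by omega, by omega, trivial⟩
  · rintro ⟨j, ⟨s, ⟨m, i⟩⟩⟩ h
    simp only [Finset.mem_sigma, Finset.mem_range, Finset.HasAntidiagonal.mem_antidiagonal] at h
    obtain ⟨_, _, rfl⟩ := h
    rfl
  · rintro ⟨r, ⟨i, ⟨m, s⟩⟩⟩ h
    simp only [Finset.mem_sigma, Finset.mem_range, Finset.HasAntidiagonal.mem_antidiagonal] at h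
    have : m + i + s = r := by omega
    subst this
    rfl
  · rintro ⟨j, ⟨s, ⟨m, i⟩⟩⟩ _
    rfl

lemma ScalarExpansion.norm_sub_sum_le {q : ℂ} {a : RR n → ℂ} {c : ℕ → RR n → ℂ}
    (h : ScalarExpansion q a c) (N : ℕ) : ∃ C : ℝ, 0 ≤ C ∧ ∀ ξ : RR n, 1 ≤ ‖ξ‖ →
      ‖a ξ - ∑ j ∈ Finset.range N, c j ξ‖ ≤ C * ‖ξ‖ ^ (q.re - N) := by
  obtain ⟨C, hC⟩ := h.bound N 0
  refine ⟨|C|, abs_nonneg C, fun ξ hξ => ?_⟩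
  have h1 := hC ξ hξ
  rw [norm_iteratedFDeriv_zero, Nat.cast_zero, sub_zero] at h1
  exact h1.trans (by gcongr; exact le_abs_self C)

/-- `b` is asymptotically `∂_l / (exp ∂_l - 1)` applied to `∑ d_i`, so its difference reproduces `∑
∂_l d_i`. The error consists of the truncations of `b` at `ξ + e_l` and at `ξ`, and of the Taylor
remainders of the homogeneous parts. -/
lemma ScalarExpansion.norm_shift_sub_le {q : ℂ} {b : RR n → ℂ} {d : ℕ → RR n → ℂ} {l : Fin n}
    (hd : ∀ i : ℕ, Homog (q - i + 1) (d i))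
    (hb : ScalarExpansion (q + 1) b fun j ξ =>
      ∑ p ∈ Finset.HasAntidiagonal.antidiagonal j, toddCoeff p.1 • (pd l)^[p.1] (d p.2) ξ) (M : ℕ) :
    ∃ C : ℝ, ∀ ξ : RR n, 2 ≤ ‖ξ‖ →
      ‖b (ξ + EuclideanSpace.single l 1) - b ξ - ∑ r ∈ Finset.range M, pd l (d r) ξ‖ ≤
        C * ‖ξ‖ ^ (q.re + 1 - M) := by
  set e : ℕ → RR n → ℂ := fun j ξ =>
      ∑ p ∈ Finset.HasAntidiagonal.antidiagonal j, toddCoeff p.1 • (pd l)^[p.1] (d p.2) ξ with he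
  obtain ⟨C, hC, hR⟩ := hb.norm_sub_sum_le M
  -- The `j`-th part has degree `q + 1 - j`, so expanding it to order `M - j` leaves remainders of
  -- real order `q.re - M`, uniformly in `j < M`.
  choose D hD using fun j => (hb.homog j).norm_shift_sub_taylor_le l (M - j)
  refine ⟨C * 2 ^ |q.re + 1 - M| + C + ∑ j ∈ Finset.range M, |D j|, fun ξ hξ => ?_⟩
  have hpos : 0 < ‖ξ‖ := by linarith
  have hξ0 : ξ ≠ 0 := norm_pos_iff.1 hpos
  have hre : (q + 1).re = q.re + 1 := by simp
  rw [hre] at hR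
  have hsum : ∑ j ∈ Finset.range M, ∑ s ∈ Finset.range (M - j),
      ((s + 1).factorial : ℂ)⁻¹ * (pd l)^[s + 1] (e j) ξ = ∑ r ∈ Finset.range M, pd l (d r) ξ := by
    refine Eq.trans ?_ (sum_toddCoeff_regroup (fun i k => (pd l)^[k] (d i) ξ) M)
    refine Finset.sum_congr rfl fun j _ => Finset.sum_congr rfl fun s _ => ?_
    rw [he, iterate_pd_sum (Finset.HasAntidiagonal.antidiagonal j) l (p := fun p => q - p.2 + 1 - p.1)
      (fun p => homog_iterate_pd (hd p.2) l p.1) (fun p => toddCoeff p.1) (s + 1) ξ hξ0]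
    congr 1
    refine Finset.sum_congr rfl fun p _ => ?_
    rw [← Function.iterate_add_apply, smul_eq_mul, show s + 1 + p.1 = p.1 + s + 1 by ring]
  obtain ⟨h1, h2, h3⟩ := norm_add_smul_single hξ (Set.right_mem_Icc.2 zero_le_one) l
  rw [one_smul] at h1 h2 h3
  have hA : ‖b (ξ + EuclideanSpace.single l 1) -
      ∑ j ∈ Finset.range M, e j (ξ + EuclideanSpace.single l 1)‖ ≤
      C * 2 ^ |q.re + 1 - M| * ‖ξ‖ ^ (q.re + 1 - M) := by
    refine (hR _ h1).trans ?_
    rw [mul_assoc]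
    gcongr
    exact rpow_le_two_rpow_mul _ hpos h2 h3
  have hB := hR ξ (by linarith)
  have hE : ∀ j ∈ Finset.range M, ‖e j (ξ + EuclideanSpace.single l 1) - e j ξ -
      ∑ s ∈ Finset.range (M - j), ((s + 1).factorial : ℂ)⁻¹ * (pd l)^[s + 1] (e j) ξ‖ ≤
      |D j| * ‖ξ‖ ^ (q.re + 1 - M) := by
    intro j hj
    have h4 : (q + 1 - j).re - (((M - j : ℕ) : ℝ) + 1) ≤ q.re + 1 - M := by
      rw [Nat.cast_sub (Finset.mem_range.1 hj).le]
      simp only [Complex.sub_re, Complex.natCast_re, hre]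
      linarith
    refine (hD j ξ hξ).trans (mul_le_mul (le_abs_self _)
      (Real.rpow_le_rpow_of_exponent_le (by linarith) h4) (by positivity) (abs_nonneg _))
  rw [← hsum]
  have hsplit : b (ξ + EuclideanSpace.single l 1) - b ξ - ∑ j ∈ Finset.range M,
      ∑ s ∈ Finset.range (M - j), ((s + 1).factorial : ℂ)⁻¹ * (pd l)^[s + 1] (e j) ξ =
      (b (ξ + EuclideanSpace.single l 1) - ∑ j ∈ Finset.range M, e j (ξ + EuclideanSpace.single l 1)) -
      (b ξ - ∑ j ∈ Finset.range M, e j ξ) +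
      ∑ j ∈ Finset.range M, (e j (ξ + EuclideanSpace.single l 1) - e j ξ -
        ∑ s ∈ Finset.range (M - j), ((s + 1).factorial : ℂ)⁻¹ * (pd l)^[s + 1] (e j) ξ) := by
    simp only [Finset.sum_sub_distrib]
    ring
  rw [hsplit, add_mul, add_mul, Finset.sum_mul]
  refine (norm_add_le _ _).trans (add_le_add ((norm_sub_le _ _).trans (add_le_add hA hB)) ?_)
  exact (norm_sum_le _ _).trans (Finset.sum_le_sum hE)

/-- A scalar symbol whose homogeneous parts are divergences is a sum of difference symbols, up to a
rapidly decaying function. -/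
theorem exists_difference_symbols {q : ℂ} {a : RR n → ℂ} {c : ℕ → RR n → ℂ}
    (ha : ScalarExpansion q a c)
    (hdiv : ∀ j : ℕ, ∃ d : Fin n → RR n → ℂ, (∀ l, Homog (q - j + 1) (d l)) ∧
      ∀ ξ : RR n, ξ ≠ 0 → ∑ l, pd l (d l) ξ = c j ξ) :
    ∃ (b : Fin n → RR n → ℂ) (e : Fin n → ℕ → RR n → ℂ), (∀ l, ScalarExpansion (q + 1) (b l) (e l)) ∧
      ∀ N : ℕ, ∃ C : ℝ, ∀ ξ : RR n,
        (1 + ‖ξ‖) ^ N * ‖a ξ - ∑ l, (b l (ξ + EuclideanSpace.single l 1) - b l ξ)‖ ≤ C := by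
  choose d hd hdc using hdiv
  let e : Fin n → ℕ → RR n → ℂ := fun l j ξ =>
    ∑ p ∈ Finset.HasAntidiagonal.antidiagonal j, toddCoeff p.1 • (pd l)^[p.1] (d p.2 l) ξ
  have he : ∀ l (j : ℕ), Homog (q + 1 - j) (e l j) := by
    intro l j
    refine Homog.sum fun p hp => Homog.const_smul ?_ _
    refine (homog_iterate_pd (hd p.2 l) l p.1).mono_eq ?_
    rw [← Finset.HasAntidiagonal.mem_antidiagonal.1 hp]
    push_cast
    ring
  choose b hb using fun l => exists_scalarExpansion (he l)
  refine ⟨b, e, hb, fun N => ?_⟩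
  -- Enough terms for the error `‖ξ‖ ^ (q.re + 1 - M)` to be at most `‖ξ‖ ^ (-N)`; the ball of
  -- radius `2`, where the expansions are not controlled, is handled by compactness.
  obtain ⟨M, hM⟩ := exists_nat_ge (q.re + 1 + N)
  obtain ⟨A, hA, hA'⟩ := ha.norm_sub_sum_le M
  choose D hD using fun l => ScalarExpansion.norm_shift_sub_le (fun i => hd i l) (hb l) M
  have hcont : Continuous fun ξ : RR n =>
      (1 + ‖ξ‖) ^ N * ‖a ξ - ∑ l, (b l (ξ + EuclideanSpace.single l 1) - b l ξ)‖ := by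
    have h1 := ha.smooth.continuous
    have h2 := fun l => (hb l).smooth.continuous
    fun_prop
  obtain ⟨C₀, hC₀⟩ := (isCompact_closedBall (0 : RR n) 2).exists_bound_of_continuousOn hcont.continuousOn
  refine ⟨|C₀| + 2 ^ N * (A + ∑ l, |D l|), fun ξ => ?_⟩
  have hS : 0 ≤ ∑ l, |D l| := Finset.sum_nonneg fun l _ => abs_nonneg _
  by_cases hξ : ‖ξ‖ ≤ 2
  · have h1 := hC₀ ξ (by simpa using hξ)
    rw [Real.norm_of_nonneg (by positivity)] at h1
    have : 0 ≤ 2 ^ N * (A + ∑ l, |D l|) := by positivity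
    linarith [le_abs_self C₀]
  · rw [not_le] at hξ
    have hpos : 0 < ‖ξ‖ := by linarith
    have hξ0 : ξ ≠ 0 := norm_pos_iff.1 hpos
    have h2 : a ξ - ∑ l, (b l (ξ + EuclideanSpace.single l 1) - b l ξ) =
        (a ξ - ∑ j ∈ Finset.range M, c j ξ) - ∑ l, (b l (ξ + EuclideanSpace.single l 1) - b l ξ -
          ∑ r ∈ Finset.range M, pd l (d r l) ξ) := by
      have h3 : ∑ l, ∑ r ∈ Finset.range M, pd l (d r l) ξ = ∑ r ∈ Finset.range M, c r ξ := by
        rw [Finset.sum_comm]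
        exact Finset.sum_congr rfl fun r _ => hdc r ξ hξ0
      rw [Finset.sum_sub_distrib (f := fun l => b l (ξ + EuclideanSpace.single l 1) - b l ξ), h3]
      ring
    have h4 : ‖a ξ - ∑ l, (b l (ξ + EuclideanSpace.single l 1) - b l ξ)‖ ≤
        (A + ∑ l, |D l|) * ‖ξ‖ ^ (-(N : ℝ)) := by
      rw [h2, add_mul, Finset.sum_mul]
      refine (norm_sub_le _ _).trans (add_le_add ((hA' ξ (by linarith)).trans ?_)
        ((norm_sum_le _ _).trans (Finset.sum_le_sum fun l _ => (hD l ξ hξ.le).trans ?_)))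
      · gcongr
        · linarith
        · linarith
      · gcongr
        · exact le_abs_self _
        · linarith
        · linarith
    have h5 : (1 + ‖ξ‖) ^ N ≤ 2 ^ N * ‖ξ‖ ^ N := by
      rw [← mul_pow]
      gcongr
      linarith
    have h6 : ‖ξ‖ ^ N * ‖ξ‖ ^ (-(N : ℝ)) = 1 := by
      rw [Real.rpow_neg hpos.le, Real.rpow_natCast]
      exact mul_inv_cancel₀ (by positivity)
    calc _ ≤ (2 ^ N * ‖ξ‖ ^ N) * ((A + ∑ l, |D l|) * ‖ξ‖ ^ (-(N : ℝ))) := by gcongr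
      _ = 2 ^ N * (A + ∑ l, |D l|) * (‖ξ‖ ^ N * ‖ξ‖ ^ (-(N : ℝ))) := by ring
      _ ≤ _ := by
        rw [h6, mul_one]
        linarith [abs_nonneg C₀]

/-! ### Uniqueness of the homogeneous parts of a symbol -/

lemma one_le_norm_latticePoint {k : Fin n → ℤ} (hk : k ≠ 0) : 1 ≤ ‖latticePoint k‖ := by
  obtain ⟨j, hj⟩ := Function.ne_iff.1 hk
  have h1 : (1 : ℝ) ≤ |(k j : ℝ)| := by exact_mod_cast Int.one_le_abs hj
  exact h1.trans (PiLp.norm_apply_le (latticePoint k) j)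

lemma latticePoint_smul (t : ℕ) (k : Fin n → ℤ) : latticePoint ((t : ℤ) • k) = (t : ℝ) • latticePoint k := by
  ext j
  simp [latticePoint]

lemma latticePoint_add_single (k : Fin n → ℤ) (j : Fin n) :
    latticePoint (Pi.single j 1 + k) = latticePoint k + EuclideanSpace.single j 1 := by
  ext i
  simp only [latticePoint, Pi.add_apply, PiLp.add_apply, Int.cast_add, PiLp.single_apply,
    Pi.single_apply]
  split_ifs <;> simp [add_comm]

lemma tendsto_floor_latticePoint (ξ : RR n) : Tendsto (fun N : ℕ =>
    ((N : ℝ) + 1)⁻¹ • latticePoint fun j => ⌊((N : ℝ) + 1) * ξ j⌋) atTop (𝓝 ξ) := by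
  rw [(PiLp.homeomorph 2 fun _ : Fin n => ℝ).isInducing.tendsto_nhds_iff, tendsto_pi_nhds]
  intro j
  have h0 : Tendsto (fun N : ℕ => ξ j - 1 / ((N : ℝ) + 1)) atTop (𝓝 (ξ j - 0)) :=
    tendsto_const_nhds.sub tendsto_one_div_add_atTop_nhds_zero_nat
  rw [sub_zero] at h0
  refine tendsto_of_tendsto_of_tendsto_of_le_of_le h0 tendsto_const_nhds (fun N => ?_) (fun N => ?_)
  · change ξ j - 1 / ((N : ℝ) + 1) ≤ ((N : ℝ) + 1)⁻¹ * (⌊((N : ℝ) + 1) * ξ j⌋ : ℝ)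
    have h1 := (Int.sub_one_lt_floor (((N : ℝ) + 1) * ξ j)).le
    have h2 : (0 : ℝ) < (N : ℝ) + 1 := by positivity
    rw [inv_mul_eq_div, le_div_iff₀ h2]
    refine le_trans (le_of_eq ?_) h1
    field_simp
  · change ((N : ℝ) + 1)⁻¹ * (⌊((N : ℝ) + 1) * ξ j⌋ : ℝ) ≤ ξ j
    have h2 : (0 : ℝ) < (N : ℝ) + 1 := by positivity
    rw [inv_mul_eq_div, div_le_iff₀ h2, mul_comm]
    exact Int.floor_le _

/-- By homogeneity the function vanishes at positive multiples of nonzero lattice points, and these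
approximate every `ξ`. -/
lemma Homog.eq_zero_of_latticePoint {q : ℂ} {d : RR n → ℂ} (hd : Homog q d)
    (h : ∀ k : Fin n → ℤ, k ≠ 0 → d (latticePoint k) = 0) {ξ : RR n} (hξ : ξ ≠ 0) : d ξ = 0 := by
  have ht := tendsto_floor_latticePoint ξ
  have h1 := (hd.contDiffAt hξ).continuousAt.tendsto.comp ht
  refine tendsto_nhds_unique h1 (tendsto_const_nhds.congr' ?_)
  filter_upwards [ht.eventually_ne hξ] with N hN
  have h2 : (fun j => ⌊((N : ℝ) + 1) * ξ j⌋) ≠ 0 := by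
    intro h0
    rw [h0] at hN
    refine hN ?_
    ext j
    simp [latticePoint]
  have h3 := one_le_norm_latticePoint h2
  rw [Function.comp_apply, hd.2 _ (by positivity) _ (norm_pos_iff.1 (by linarith)), h _ h2, smul_zero]

/-- Once the earlier terms vanish, `d_j` alone is bounded on the lattice by a power one order below
its degree. Along the multiples `(t + 1) k`, homogeneity turns this into `d_j(k) = O(1/(t + 1))`. -/
lemma homog_eq_zero_of_sum_le {q : ℂ} {d : ℕ → RR n → ℂ} (hd : ∀ j : ℕ, Homog (q - j) (d j))
    (hb : ∀ N : ℕ, ∃ C : ℝ, ∀ k : Fin n → ℤ, k ≠ 0 →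
      ‖∑ j ∈ Finset.range N, d j (latticePoint k)‖ ≤ C * ‖latticePoint k‖ ^ (q.re - N)) (j : ℕ) :
    ∀ ξ : RR n, ξ ≠ 0 → d j ξ = 0 := by
  induction j using Nat.strong_induction_on with
  | _ j ih =>
    intro ξ hξ
    refine (hd j).eq_zero_of_latticePoint (fun k hk => ?_) hξ
    obtain ⟨C, hC⟩ := hb (j + 1)
    have hk1 := one_le_norm_latticePoint hk
    have hpos : 0 < ‖latticePoint k‖ := by linarith
    have hk0 : latticePoint k ≠ 0 := norm_pos_iff.1 hpos
    have h1 : ∀ t : ℕ, ‖d j (latticePoint k)‖ ≤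
        C * ‖latticePoint k‖ ^ (q.re - (j + 1)) * (1 / ((t : ℝ) + 1)) := by
      intro t
      have hs : (0 : ℝ) < ((t + 1 : ℕ) : ℝ) := by positivity
      have hne : ((t + 1 : ℕ) : ℤ) • k ≠ 0 := smul_ne_zero (by positivity) hk
      have h2 := hC _ hne
      rw [Finset.sum_range_succ, Finset.sum_eq_zero fun i hi => ?_, zero_add, latticePoint_smul,
        (hd j).2 _ hs _ hk0, norm_smul, norm_smul, Complex.norm_cpow_eq_rpow_re_of_pos hs,
        Real.norm_of_nonneg hs.le, Real.mul_rpow hs.le hpos.le] at h2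
      · have h3 : (q - j).re = (q.re - ((j + 1 : ℕ) : ℝ)) + 1 := by
          simp
          ring
        rw [h3, Real.rpow_add_one hs.ne'] at h2
        have h4 : (0 : ℝ) < ((t + 1 : ℕ) : ℝ) ^ (q.re - ((j + 1 : ℕ) : ℝ)) := by positivity
        rw [mul_one_div, le_div_iff₀ (by positivity)]
        refine le_of_mul_le_mul_left ?_ h4
        push_cast at h2 ⊢
        linarith
      · refine ih i (Finset.mem_range.1 hi) _ ?_
        exact norm_pos_iff.1 (lt_of_lt_of_le one_pos (one_le_norm_latticePoint hne))
    have h2 : Tendsto (fun t : ℕ => C * ‖latticePoint k‖ ^ (q.re - (j + 1)) * (1 / ((t : ℝ) + 1)))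
        atTop (𝓝 (C * ‖latticePoint k‖ ^ (q.re - (j + 1)) * 0)) :=
      tendsto_one_div_add_atTop_nhds_zero_nat.const_mul _
    rw [mul_zero] at h2
    exact norm_le_zero_iff.1 (ge_of_tendsto' h2 h1)

/-- The expansion `∑ c_j`, preceded by `p` zero terms. -/
def pad (p : ℕ) (c : ℕ → RR n → ℂ) (j : ℕ) : RR n → ℂ := if j < p then 0 else c (j - p)

/-- Padding raises the nominal order from `q` to `q + p`, so that expansions whose orders differ by
an integer can be compared index by index. -/
lemma homog_pad {q : ℂ} {c : ℕ → RR n → ℂ} (hc : ∀ j : ℕ, Homog (q - j) (c j)) (p j : ℕ) :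
    Homog (q + p - j) (pad p c j) := by
  rw [pad]
  split_ifs with h
  · exact Homog.zero _
  · refine (hc (j - p)).mono_eq ?_
    rw [Nat.cast_sub (not_lt.1 h)]
    ring

lemma ScalarExpansion.pad_norm_sub_sum_le {q : ℂ} {a : RR n → ℂ} {c : ℕ → RR n → ℂ}
    (h : ScalarExpansion q a c) (p N : ℕ) : ∃ C : ℝ, ∀ ξ : RR n, 1 ≤ ‖ξ‖ →
      ‖a ξ - ∑ j ∈ Finset.range N, pad p c j ξ‖ ≤ C * ‖ξ‖ ^ (q.re + p - N) := by
  obtain ⟨C, hC, hb⟩ := h.norm_sub_sum_le (N - p)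
  refine ⟨C, fun ξ hξ => ?_⟩
  have h1 : ∑ j ∈ Finset.range N, pad p c j ξ = ∑ j ∈ Finset.range (N - p), c j ξ := by
    rcases le_total p N with hpN | hpN
    · obtain ⟨m, rfl⟩ := Nat.exists_eq_add_of_le hpN
      rw [Finset.sum_range_add, Finset.sum_eq_zero, zero_add, Nat.add_sub_cancel_left]
      · exact Finset.sum_congr rfl fun j _ => by simp [pad]
      · intro j hj
        simp [pad, Finset.mem_range.1 hj]
    · rw [Nat.sub_eq_zero_of_le hpN, Finset.sum_range_zero, Finset.sum_eq_zero]
      intro j hj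
      have := Finset.mem_range.1 hj
      simp [pad, show j < p by omega]
  rw [h1]
  have h2 : (N : ℝ) ≤ ((N - p : ℕ) : ℝ) + p := by exact_mod_cast (show N ≤ N - p + p by omega)
  exact (hb ξ hξ).trans (mul_le_mul_of_nonneg_left
    (Real.rpow_le_rpow_of_exponent_le hξ (by linarith)) hC)

/-- Two symbols which agree on the lattice `ℤⁿ` have the same homogeneous parts. -/
lemma ScalarExpansion.pad_eq {q q' : ℂ} {a a' : RR n → ℂ} {c c' : ℕ → RR n → ℂ} {p p' : ℕ}
    (h : ScalarExpansion q a c) (h' : ScalarExpansion q' a' c') (hp : q + p = q' + p')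
    (ha : ∀ k, a (latticePoint k) = a' (latticePoint k)) (j : ℕ) {ξ : RR n} (hξ : ξ ≠ 0) :
    pad p c j ξ = pad p' c' j ξ := by
  have hre : q.re + p = q'.re + p' := by simpa using congrArg Complex.re hp
  refine sub_eq_zero.1 (homog_eq_zero_of_sum_le (q := q + p)
    (d := fun j ξ => pad p c j ξ - pad p' c' j ξ) (fun j => ?_) (fun N => ?_) j ξ hξ)
  · have h1 := (homog_pad h.homog p j).add (((homog_pad h'.homog p' j).mono_eq
      (show _ = q + p - j by rw [hp])).const_smul (-1))
    simpa [sub_eq_add_neg] using h1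
  · obtain ⟨C, hC⟩ := h.pad_norm_sub_sum_le p N
    obtain ⟨C', hC'⟩ := h'.pad_norm_sub_sum_le p' N
    refine ⟨C + C', fun k hk => ?_⟩
    have hk1 := one_le_norm_latticePoint hk
    have h1 := hC _ hk1
    have h2 := hC' _ hk1
    rw [← ha, ← hre] at h2
    rw [Finset.sum_sub_distrib, add_mul]
    have h3 : (q + p : ℂ).re = q.re + p := by simp
    rw [h3, add_comm (C * _)]
    refine le_trans (le_of_eq ?_) ((norm_sub_le _ _).trans (add_le_add h2 h1))
    congr 1
    ring

/-! ### The noncommutative residue -/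

lemma deltaPowOp_zero (u : SmoothTorus θ) : deltaPowOp 0 u = toOp u := by
  simp [deltaPowOp, deltaPow]

lemma HasExpansion.contDiffAt_sub {q : ℂ} {ρ : RR n → SmoothTorus θ} {c : ℕ → RR n → SmoothTorus θ}
    (h : HasExpansion q ρ c) (N : ℕ) (α : Fin n → ℕ) {ξ : RR n} (hξ : ξ ≠ 0) :
    ContDiffAt ℝ ∞ (fun η => deltaPowOp α (ρ η - ∑ j ∈ Finset.range N, c j η)) ξ := by
  simp only [map_sub, map_sum]
  exact ((h.smooth α).contDiffAt univ_mem).sub (ContDiffAt.sum fun j _ =>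
    ((h.homogeneous j).1 α).contDiffAt (isOpen_compl_singleton.mem_nhds hξ))

lemma norm_iteratedFDeriv_clm_comp_le {E F G : Type*} [NormedAddCommGroup E] [NormedSpace ℝ E]
    [NormedAddCommGroup F] [NormedSpace ℝ F] [NormedSpace ℂ F] [NormedAddCommGroup G]
    [NormedSpace ℝ G] [NormedSpace ℂ G] [IsScalarTower ℝ ℂ F] [IsScalarTower ℝ ℂ G] (L : F →L[ℂ] G)
    {f : E → F} {x : E} (hf : ContDiffAt ℝ ∞ f x) (k : ℕ) :
    ‖iteratedFDeriv ℝ k (fun y => L (f y)) x‖ ≤ ‖L‖ * ‖iteratedFDeriv ℝ k f x‖ := by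
  have h := (L.restrictScalars ℝ).norm_iteratedFDeriv_comp_left hf
    (show ((k : ℕ) : WithTop ℕ∞) ≤ ∞ by exact_mod_cast le_top)
  rwa [ContinuousLinearMap.norm_restrictScalars] at h

lemma contDiff_clm {F G : Type*} [NormedAddCommGroup F] [NormedSpace ℝ F] [NormedSpace ℂ F]
    [NormedAddCommGroup G] [NormedSpace ℝ G] [NormedSpace ℂ G] [IsScalarTower ℝ ℂ F]
    [IsScalarTower ℝ ℂ G] (L : F →L[ℂ] G) : ContDiff ℝ ∞ L :=
  (L.restrictScalars ℝ).contDiff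

lemma HasExpansion.tau {q : ℂ} {ρ : RR n → SmoothTorus θ} {c : ℕ → RR n → SmoothTorus θ}
    (h : HasExpansion q ρ c) :
    ScalarExpansion q (fun ξ => tau (ρ ξ)) (fun j ξ => NCTorus.tau (c j ξ)) := by
  have ht : ∀ u : SmoothTorus θ, NCTorus.tau u = tauOp n (deltaPowOp 0 u) := fun u => by
    rw [deltaPowOp_zero, NCTorus.tau]
  refine ⟨?_, fun j => ⟨?_, fun t ht ξ hξ => ?_⟩, fun N k => ?_⟩
  · simp only [ht]
    exact (contDiff_clm (tauOp n)).comp (contDiffOn_univ.1 (h.smooth 0))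
  · simp only [ht]
    exact (contDiff_clm (tauOp n)).comp_contDiffOn ((h.homogeneous j).1 0)
  · simp only [(h.homogeneous j).2 t ht ξ hξ, tau_smul, smul_eq_mul]
  · obtain ⟨C, hC⟩ := h.bound N 0 k
    refine ⟨‖tauOp n‖ * C, fun ξ hξ => ?_⟩
    have h1 : (fun η => NCTorus.tau (ρ η) - ∑ j ∈ Finset.range N, NCTorus.tau (c j η)) =
        fun η => tauOp n (deltaPowOp 0 (ρ η - ∑ j ∈ Finset.range N, c j η)) := by
      funext η
      simp only [ht, map_sub, map_sum]
    rw [h1, mul_assoc]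
    refine (norm_iteratedFDeriv_clm_comp_le (tauOp n)
      (h.contDiffAt_sub N 0 (norm_pos_iff.1 (by linarith))) k).trans ?_
    gcongr
    exact hC ξ hξ

/-- The residue is computed by any expansion of any symbol of the operator. -/
lemma integral_tau_eq_Res {P : Module.End ℂ (SmoothTorus θ)} {m : ℤ} {ρ : RR n → SmoothTorus θ}
    {c : ℕ → RR n → SmoothTorus θ} (h : HasExpansion (m : ℂ) ρ c) (hP : IsQuantization ρ P) {j : ℕ}
    (hj : m - (j : ℤ) = -(n : ℤ)) :
    ∫ ξ : Metric.sphere (0 : RR n) 1, tau (c j ξ) ∂((volume : Measure (RR n)).toSphere) = Res P := by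
  have hex : ∃ σ, IsSymbolOfDegreeNegDim P σ := ⟨c j, m, ρ, c, h, hP, Or.inl ⟨j, hj, rfl⟩⟩
  have hσ : IsSymbolOfDegreeNegDim P (symbolOfDegreeNegDim P) := by
    rw [symbolOfDegreeNegDim, dif_pos hex]
    exact hex.choose_spec
  obtain ⟨m', ρ', c', h', hP', hc⟩ := hσ
  have hρ : ∀ k, tau (ρ (latticePoint k)) = tau (ρ' (latticePoint k)) := fun k =>
    congrArg tau (congrFun (Quantizes.unique (x := fun k => ρ (latticePoint k))
      (y := fun k => ρ' (latticePoint k)) hP hP') k)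
  refine integral_congr_ae (Eventually.of_forall fun η => ?_)
  have hη : (η : RR n) ≠ 0 := by
    intro h0
    have := η.2
    rw [h0] at this
    simp at this
  simp only
  -- The symbol selected in `Res` may have another nominal order `m'`. The traces agree on the
  -- lattice, so the padded expansions agree in degree `-n`; if `m' < -n`, the padding puts a zero
  -- there.
  rcases hc with ⟨j', hj', hc⟩ | ⟨hm, hc⟩
  · have h1 := h.tau.pad_eq h'.tau (p := j') (p' := j) (by
      have : m + j' = m' + j := by omega
      exact_mod_cast this) hρ (j + j') hη
    rw [hc]
    simpa [pad] using h1
  · obtain ⟨p, hp⟩ := Int.le.dest (show m' ≤ m by omega)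
    have h1 := h.tau.pad_eq h'.tau (p := 0) (p' := p) (by
      rw [← hp]
      simp) hρ j hη
    rw [hc]
    have hjp : j < p := by omega
    simpa [pad, hjp, tau] using h1

/-! ### Operations on classical symbols -/

lemma IsInvariantBounded.hasExpansion {A : Module.End ℂ (SmoothTorus θ)} (hA : IsInvariantBounded A)
    {q : ℂ} {ρ : RR n → SmoothTorus θ} {c : ℕ → RR n → SmoothTorus θ} (h : HasExpansion q ρ c) :
    HasExpansion q (fun ξ => A (ρ ξ)) (fun j ξ => A (c j ξ)) := by
  obtain ⟨B, hB⟩ := hA.deltaPowOp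
  refine ⟨fun α => ?_, fun j => ⟨fun α => ?_, fun t ht ξ hξ => ?_⟩, fun N α k => ?_⟩
  · simp only [hB]
    exact (contDiff_clm B).comp_contDiffOn (h.smooth α)
  · simp only [hB]
    exact (contDiff_clm B).comp_contDiffOn ((h.homogeneous j).1 α)
  · simp only [(h.homogeneous j).2 t ht ξ hξ, map_smul]
  · obtain ⟨C, hC⟩ := h.bound N α k
    refine ⟨‖B‖ * C, fun ξ hξ => ?_⟩
    simp only [← map_sum, ← map_sub, hB]
    rw [mul_assoc]
    refine (norm_iteratedFDeriv_clm_comp_le B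
      (h.contDiffAt_sub N α (norm_pos_iff.1 (by linarith))) k).trans ?_
    gcongr
    exact hC ξ hξ

lemma ScalarExpansion.hasExpansion {q : ℂ} {b : RR n → ℂ} {e : ℕ → RR n → ℂ}
    (h : ScalarExpansion q b e) (x : SmoothTorus θ) :
    HasExpansion q (fun ξ => b ξ • x) (fun j ξ => e j ξ • x) := by
  let L : (Fin n → ℕ) → ℂ →L[ℂ] Op n := fun α =>
    (ContinuousLinearMap.id ℂ ℂ).smulRight (deltaPowOp α x)
  have hL : ∀ α (z : ℂ), deltaPowOp α (z • x) = L α z := fun α z => by simp [L]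
  refine ⟨fun α => ?_, fun j => ⟨fun α => ?_, fun t ht ξ hξ => ?_⟩, fun N α k => ?_⟩
  · simp only [hL]
    exact ((contDiff_clm (L α)).comp h.smooth).contDiffOn
  · simp only [hL]
    exact (contDiff_clm (L α)).comp_contDiffOn (h.homog j).1
  · simp only [(h.homog j).2 t ht ξ hξ, smul_assoc]
  · obtain ⟨C, hC⟩ := h.bound N k
    refine ⟨‖L α‖ * C, fun ξ hξ => ?_⟩
    simp only [← Finset.sum_smul, ← sub_smul, hL]
    have hξ0 : ξ ≠ 0 := norm_pos_iff.1 (by linarith)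
    rw [mul_assoc]
    refine (norm_iteratedFDeriv_clm_comp_le (L α) (h.smooth.contDiffAt.sub
      (ContDiffAt.sum fun j _ => (h.homog j).contDiffAt hξ0)) k).trans ?_
    gcongr
    exact hC ξ hξ

lemma IsClassicalSymbol.polyGrowth {q : ℂ} {ρ : RR n → SmoothTorus θ} (h : IsClassicalSymbol q ρ) :
    PolyGrowth fun k => ρ (latticePoint k) := by
  obtain ⟨c, h⟩ := h
  intro w
  obtain ⟨α, hα⟩ := exists_deltaWord_eq_deltaPow (θ := θ) w
  obtain ⟨C, hC⟩ := h.bound 0 α 0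
  obtain ⟨M, hM⟩ := exists_nat_ge q.re
  refine ⟨|C| + ‖deltaPowOp α (ρ (latticePoint 0))‖, M, fun k => ?_⟩
  have hw := one_le_wt k
  have h1 : toOp (deltaWord θ w (ρ (latticePoint k))) = deltaPowOp α (ρ (latticePoint k)) := by
    rw [hα]
    rfl
  rw [h1]
  by_cases hk : k = 0
  · subst hk
    have h2 : ‖deltaPowOp α (ρ (latticePoint 0))‖ ≤ |C| + ‖deltaPowOp α (ρ (latticePoint 0))‖ := by
      linarith [abs_nonneg C]
    exact h2.trans (le_mul_of_one_le_right (by positivity) (one_le_pow₀ hw))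
  · have hk1 := one_le_norm_latticePoint hk
    have h2 := hC _ hk1
    simp only [Finset.range_zero, Finset.sum_empty, sub_zero, norm_iteratedFDeriv_zero,
      Nat.cast_zero] at h2
    have h3 : ‖latticePoint k‖ ^ q.re ≤ wt k ^ M := by
      rw [← Real.rpow_natCast]
      refine (Real.rpow_le_rpow_of_exponent_le hk1 hM).trans ?_
      exact Real.rpow_le_rpow (norm_nonneg _) (by simp [wt]) (by positivity)
    calc _ ≤ C * ‖latticePoint k‖ ^ q.re := h2
      _ ≤ (|C| + ‖deltaPowOp α (ρ (latticePoint 0))‖) * wt k ^ M := by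
        gcongr
        linarith [le_abs_self C, norm_nonneg (deltaPowOp α (ρ (latticePoint 0)))]

lemma IsClassicalSymbol.exists_isQuantization {q : ℂ} {ρ : RR n → SmoothTorus θ}
    (h : IsClassicalSymbol q ρ) : ∃ P ∈ Psi θ q, IsQuantization ρ P := by
  obtain ⟨P, hP⟩ := h.polyGrowth.exists_quantizes
  exact ⟨P, ⟨ρ, h, hP⟩, hP⟩

/-- The homogeneous parts of `τ ∘ ρ` are divergences. -/
lemma exists_div_tau (hn : 2 ≤ n) {q : ℂ} {P : Module.End ℂ (SmoothTorus θ)}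
    {ρ : RR n → SmoothTorus θ} {c : ℕ → RR n → SmoothTorus θ} (h : HasExpansion q ρ c)
    (hP : IsQuantization ρ P)
    (hq : (¬ ∃ m : ℤ, q = (m : ℂ)) ∨ ((∃ m : ℤ, q = (m : ℂ)) ∧ Res P = 0)) (j : ℕ) :
    ∃ d : Fin n → RR n → ℂ, (∀ l, Homog (q - j + 1) (d l)) ∧
      ∀ ξ : RR n, ξ ≠ 0 → ∑ l, pd l (d l) ξ = tau (c j ξ) := by
  -- Degree `-n` occurs only for integral `q`, and then the obstruction is the residue.
  by_cases hj : q - j = -n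
  · have hm : q = ((j - n : ℤ) : ℂ) := by
      push_cast
      linear_combination hj
    have hR : Res P = 0 := by
      rcases hq with hq | hq
      · exact absurd ⟨_, hm⟩ hq
      · exact hq.2
    rw [hj]
    refine exists_div_of_integral_sphere_eq_zero hn ((h.tau.homog j).mono_eq hj) ?_
    rw [← hR]
    rw [hm] at h
    exact integral_tau_eq_Res h hP (by ring)
  · exact exists_div_of_ne hj (h.tau.homog j)

/-! ### Assembly of the commutators -/

theorem exists_sum_commutators (hn : 2 ≤ n) {q : ℂ} {P : Module.End ℂ (SmoothTorus θ)}
    (hP : P ∈ Psi θ q)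
    (hq : (¬ ∃ m : ℤ, q = (m : ℂ)) ∨ ((∃ m : ℤ, q = (m : ℂ)) ∧ Res P = 0)) :
    ∃ P' Q : Fin n → Module.End ℂ (SmoothTorus θ),
      (∀ j, P' j ∈ Psi θ (q + 1)) ∧ (∀ j, Q j ∈ Psi θ q) ∧
      IsSmoothing (P - (∑ j, ⁅P' j, mulU θ j⁆ + ∑ j, ⁅delta θ j, Q j⁆)) := by
  obtain ⟨ρ, ⟨c, hρ⟩, hPρ⟩ := hP
  obtain ⟨A, hA, hdecomp⟩ := exists_sum_delta_add_tau θ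
  obtain ⟨b, e, hb, hdecay⟩ := exists_difference_symbols hρ.tau (exists_div_tau hn hρ hPρ hq)
  choose Q hQ hQσ using fun j => IsClassicalSymbol.exists_isQuantization
    ⟨_, (hA j).hasExpansion hρ⟩
  -- The factor `U_j^*` in the symbol is there to be cancelled by `U_j`, so that the commutator has
  -- a scalar symbol.
  choose P' hP' hPσ using fun j => IsClassicalSymbol.exists_isQuantization
    ⟨_, (hb j).hasExpansion (star (U θ j : SmoothTorus θ))⟩
  refine ⟨P', Q, hP', hQ, ?_⟩
  let r : (Fin n → ℤ) → ℂ := fun k => tau (ρ (latticePoint k)) -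
    ∑ j, (b j (latticePoint k + EuclideanSpace.single j 1) - b j (latticePoint k))
  have hr : RapidDecay r := fun N => by
    obtain ⟨C, hC⟩ := hdecay N
    exact ⟨C, fun k => hC (latticePoint k)⟩
  refine isSmoothing_of_rapidDecay hr ?_
  have hPQ : Quantizes (fun k => ρ (latticePoint k)) P := hPρ
  have hU : ∀ j, Quantizes (fun k => (b j (latticePoint (Pi.single j 1 + k)) -
      b j (latticePoint k)) • 1) ⁅P' j, mulU θ j⁆ := fun j =>
    Quantizes.lie_mulU (b := fun k => b j (latticePoint k)) (hPσ j)
  have hD : ∀ j, Quantizes (fun k => delta θ j (A j (ρ (latticePoint k)))) ⁅delta θ j, Q j⁆ := fun j =>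
    Quantizes.lie_delta (x := fun k => A j (ρ (latticePoint k))) (hQσ j) j
  have h := hPQ.sub ((Quantizes.sum (s := Finset.univ) hU).add (Quantizes.sum (s := Finset.univ) hD))
  have hx : (fun k => ρ (latticePoint k) - (∑ j, (b j (latticePoint (Pi.single j 1 + k)) -
      b j (latticePoint k)) • (1 : SmoothTorus θ) + ∑ j, delta θ j (A j (ρ (latticePoint k))))) =
      fun k => r k • 1 := by
    funext k
    simp only [r, latticePoint_add_single, sub_smul, Finset.sum_smul]
    -- What is left is the decomposition of `ρ(k)` into derivatives and its trace.
    rw [add_comm, ← sub_sub, sub_left_inj, sub_eq_iff_eq_add']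
    exact hdecomp (ρ (latticePoint k))
  rw [hx] at h
  exact h

end NCTorus

end

theorem mainTheorem8 (n : ℕ) (hn : 2 ≤ n) (θ : Matrix (Fin n) (Fin n) ℝ)
    (hθ : θ.transpose = -θ) (q : ℂ) (P : Module.End ℂ (NCTorus.SmoothTorus θ))
    (hP : P ∈ NCTorus.Psi θ q)
    (hq : (¬ ∃ m : ℤ, q = (m : ℂ)) ∨ ((∃ m : ℤ, q = (m : ℂ)) ∧ NCTorus.Res P = 0)) :
    ∃ P' Q : Fin n → Module.End ℂ (NCTorus.SmoothTorus θ),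
      (∀ j, P' j ∈ NCTorus.Psi θ (q + 1)) ∧
      (∀ j, Q j ∈ NCTorus.Psi θ q) ∧
      NCTorus.IsSmoothing
        (P - (∑ j, ⁅P' j, NCTorus.mulU θ j⁆ + ∑ j, ⁅NCTorus.delta θ j, Q j⁆)) :=
  NCTorus.exists_sum_commutators hn hP hq
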